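/- **Theorem (energy minimizer and scattering length).** Let $n\ge 1$, $\mu>0$, $R_0\ge 0$, and let $v(x)=v(|x|)$ be a real-valued radial potential on $\mathbb{R}^n$, locally integrable on $\mathbb{R}^n\setminus\{0\}$, with $v(r)=0$ for $r>R_0$. Write $v=v_+-v_-$ with $v_\pm=\max(\pm v,0)$ and assume $v_-\in L^1(\mathbb{R})$ if $n=1$, $v_-\in L^{1+\epsilon}(\mathbb{R}^2)$ for some $\epsilon>0$ if $n=2$, and $v_-\in L^{n/2}(\mathbb{R}^n)$ if $n\ge 3$. Assume also that there are no negative energy bound states, i.e. $$\int_{\mathbb{R}^n}\Big(\mu|\nabla\phi|^2+\tfrac12 v|\phi|^2\Big)dx\ \ge 0\qquad\text{for all }\phi\in H^1(\mathbb{R}^n)$$ (the value $+\infty$ is allowed). For $R>R_0$ let $B_R=\{x\in\mathbb{R}^n:|x|<R\}$, $S_R=\{|x|=R\}$ and, for complex-valued $\phi\in H^1(B_R)$, $$\mathcal{E}_R[\phi]=\int_{B_R}\Big(\mu|\nabla\phi|^2+\tfrac12 v|\phi|^2\Big)dx\in(-\infty,+\infty].$$ Then there is an extended real number $a$, the *scattering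 length*, which does not depend on $R$, with $-\infty\le a\le R_0$ if $n=1$, $0\le a\le R_0$ if $n=2$, and $-\infty\le a\le R_0^{\,n-2}$ if $n\ge3$, such that for every $R>R_0$ the following holds. 1. Among all $\phi\in H^1(B_R)$ with $\phi=1$ on $S_R$ (that is, $\phi-1\in H^1_0(B_R)$), there is a minimizer $\phi_0$ of $\mathcal{E}_R$, and it is unique up to equality almost everywhere. 2. $\phi_0$ is nonnegative and spherically symmetric: $\phi_0(x)=f_0(|x|)$ for $0<|x|<R$, with $f_0\ge0$ on $(0,R]$ and $f_0(R)=1$. 3. $-\mu\Delta\phi_0+\frac12v\phi_0=0$ in the sense of distributions on $\{0<|x|<R\}$, and on all of $B_R$ if $v$ is also locally integrable near the origin. 4. For $R_0<r<R$, $$f_0(r)=\begin{cases}(r-a)/(R-a)& n=1\\ \ln(r/a)/\ln(R/a)& n=2\\ (1-ar^{2-n})/(1-aR^{2-n})& n\ge3.\end{cases}$$ 5. The minimum energy is $$\mathcal{E}_R[\phi_0]=\begin{cases}2\mu/(R-a)& n=1\\ 2\pi\mu/\ln(R/a)& n=2\\ \dfrac{2(n-2)\pi^{n/2}\mu\, a}{\Gamma(n/2)\,(1-aR^{2-n})}&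 n\ge3.\end{cases}$$ In the limiting cases $a=-\infty$ for $n=1$, $a=0$ for $n=2$ and $a=-\infty$ for $n\ge3$, the right sides in 4 and 5 are understood as limits: $f_0=1$ with energy $0$ if $n\le2$; $f_0(r)=(r/R)^{2-n}$ with energy $-2(n-2)\pi^{n/2}\mu R^{n-2}/\Gamma(n/2)$ if $n\ge3$. -/

import Mathlib

open MeasureTheory Set
open scoped ENNReal ContDiff

namespace ScatLen

noncomputable section

/-- `ℝⁿ` with its Euclidean norm. -/
abbrev Sp (n : ℕ) : Type := EuclideanSpace ℝ (Fin n)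

/-- The open ball `{x : |x| < R}`. -/
abbrev ballR (n : ℕ) (R : ℝ) : Set (Sp n) := Metric.ball (0 : Sp n) R

/-- The open ball without its centre, `{x : 0 < |x| < R}`. -/
abbrev puncturedBall (n : ℕ) (R : ℝ) : Set (Sp n) := {x | 0 < ‖x‖ ∧ ‖x‖ < R}

/-- `ψ ∈ C_c^∞(Ω; F)`. -/
def IsTestFun {n : ℕ} {F : Type*} [NormedAddCommGroup F] [NormedSpace ℝ F]
    (Ω : Set (Sp n)) (ψ : Sp n → F) : Prop :=
  ContDiff ℝ ∞ ψ ∧ HasCompactSupport ψ ∧ tsupport ψ ⊆ Ω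

/-- The classical partial derivative in the `i`-th coordinate direction. -/
def partialDeriv {n : ℕ} {F : Type*} [NormedAddCommGroup F] [NormedSpace ℝ F]
    (i : Fin n) (ψ : Sp n → F) (x : Sp n) : F :=
  fderiv ℝ ψ x (EuclideanSpace.single i (1 : ℝ))

/-- The classical gradient of a complex-valued function. -/
def classicalGrad {n : ℕ} (ψ : Sp n → ℂ) (x : Sp n) : EuclideanSpace ℂ (Fin n) :=
  WithLp.toLp 2 fun i => partialDeriv i ψ x

/-- `G ∈ L²(Ω)` is a weak gradient of `φ` on `Ω`. -/
def HasWeakGrad {n : ℕ} (Ω : Set (Sp n)) (φ : Sp n → ℂ)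
    (G : Sp n → EuclideanSpace ℂ (Fin n)) : Prop :=
  MemLp G 2 (volume.restrict Ω) ∧
    ∀ ψ : Sp n → ℝ, IsTestFun Ω ψ → ∀ i : Fin n,
      ∫ x in Ω, partialDeriv i ψ x • φ x = - ∫ x in Ω, ψ x • G x i

/-- The Sobolev space `H¹(Ω)`: square integrable functions with a square integrable
weak gradient. -/
def MemH1 {n : ℕ} (Ω : Set (Sp n)) (φ : Sp n → ℂ) : Prop :=
  MemLp φ 2 (volume.restrict Ω) ∧ ∃ G, HasWeakGrad Ω φ G

open Classical in
/-- The weak gradient on `Ω` of a function in `H¹(Ω)` (unique almost everywhere on the open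
set `Ω`). -/
def weakGrad {n : ℕ} (Ω : Set (Sp n)) (φ : Sp n → ℂ) : Sp n → EuclideanSpace ℂ (Fin n) :=
  if h : ∃ G, HasWeakGrad Ω φ G then h.choose else 0

/-- `H¹₀(Ω)`: the closure of `C_c^∞(Ω)` in `H¹(Ω)`. -/
def MemH10 {n : ℕ} (Ω : Set (Sp n)) (u : Sp n → ℂ) : Prop :=
  MemH1 Ω u ∧ ∀ ε : ℝ≥0∞, 0 < ε → ∃ ψ : Sp n → ℂ, IsTestFun Ω ψ ∧
    eLpNorm (fun x => u x - ψ x) 2 (volume.restrict Ω) ≤ ε ∧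
    eLpNorm (fun x => weakGrad Ω u x - classicalGrad ψ x) 2 (volume.restrict Ω) ≤ ε

/-- The energy `∫_Ω μ|∇φ|² + ½ v(|x|)|φ|²`, for `φ ∈ H¹(Ω)`, as the difference of the
integral of `μ|∇φ|² + ½ v₊|φ|²`, which may be `+∞`, and that of `½ v₋|φ|²`. -/
def energy {n : ℕ} (Ω : Set (Sp n)) (μ : ℝ) (v : ℝ → ℝ) (φ : Sp n → ℂ) : EReal :=
  ((∫⁻ x in Ω, ENNReal.ofReal
      (μ * ‖weakGrad Ω φ x‖ ^ 2 + 1 / 2 * max (v ‖x‖) 0 * ‖φ x‖ ^ 2) : ℝ≥0∞) : EReal)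
    - ((∫⁻ x in Ω, ENNReal.ofReal (1 / 2 * max (-v ‖x‖) 0 * ‖φ x‖ ^ 2) : ℝ≥0∞) : EReal)

/-- The integrability condition on the negative part of the radial potential `x ↦ v(|x|)`
on `ℝⁿ`: `L¹` for `n = 1`, `L^{1+ε}` for some `ε > 0` for `n = 2`, `L^{n/2}` for `n ≥ 3`. -/
def NegPartCondition (n : ℕ) (v : ℝ → ℝ) : Prop :=
  (n = 1 → MemLp (fun x : Sp n => max (-v ‖x‖) 0) 1 volume) ∧
  (n = 2 → ∃ ε : ℝ, 0 < ε ∧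
    MemLp (fun x : Sp n => max (-v ‖x‖) 0) (ENNReal.ofReal (1 + ε)) volume) ∧
  (3 ≤ n → MemLp (fun x : Sp n => max (-v ‖x‖) 0) (ENNReal.ofReal ((n : ℝ) / 2)) volume)

/-- Absence of negative energy bound states: the energy on `ℝⁿ` is nonnegative on `H¹(ℝⁿ)`. -/
def NoNegativeBoundStates (n : ℕ) (μ : ℝ) (v : ℝ → ℝ) : Prop :=
  ∀ φ : Sp n → ℂ, MemH1 univ φ → 0 ≤ energy univ μ v φ

/-- The functions of `H¹(B_R)` that equal `1` on the sphere `S_R` (in the sense of traces). -/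
def Admissible {n : ℕ} (R : ℝ) (φ : Sp n → ℂ) : Prop :=
  MemH1 (ballR n R) φ ∧ MemH10 (ballR n R) (fun x => φ x - 1)

/-- `φ` minimizes the energy on `B_R` among the functions that equal `1` on `S_R`. -/
def IsEnergyMinimizer {n : ℕ} (R μ : ℝ) (v : ℝ → ℝ) (φ : Sp n → ℂ) : Prop :=
  Admissible R φ ∧ ∀ χ : Sp n → ℂ, Admissible R χ →
    energy (ballR n R) μ v φ ≤ energy (ballR n R) μ v χ

/-- `-μΔφ + ½ v(|x|)φ = 0` in the sense of distributions on `Ω`. -/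
def SolvesScattering {n : ℕ} (Ω : Set (Sp n)) (μ : ℝ) (v : ℝ → ℝ) (φ : Sp n → ℂ) : Prop :=
  LocallyIntegrableOn φ Ω volume ∧
  LocallyIntegrableOn (fun x => v ‖x‖ • φ x) Ω volume ∧
  ∀ ψ : Sp n → ℝ, IsTestFun Ω ψ →
    - (μ : ℂ) * (∫ x in Ω, Laplacian.laplacian ψ x • φ x)
      + (1 / 2 : ℂ) * (∫ x in Ω, ψ x • (v ‖x‖ • φ x)) = 0

/-- The range of the scattering length: `-∞ ≤ a ≤ R₀` for `n = 1`, `0 ≤ a ≤ R₀` for `n = 2`,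
`-∞ ≤ a ≤ R₀^{n-2}` for `n ≥ 3`. -/
def ScatteringRange (n : ℕ) (R₀ : ℝ) (a : EReal) : Prop :=
  if n = 1 then a ≤ (R₀ : EReal)
  else if n = 2 then 0 ≤ a ∧ a ≤ (R₀ : EReal)
  else a ≤ ((R₀ ^ (n - 2) : ℝ) : EReal)

/-- The harmonic profile with value `1` at `r = R` and scattering length `a`. The limiting
profiles belong to `a = -∞` for `n = 1` (constant), `a = 0` for `n = 2` (constant) and
`a = -∞` for `n ≥ 3` (proportional to `r^{2-n}`). -/
def asympProfile (n : ℕ) (a : EReal) (R r : ℝ) : ℝ :=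
  if n = 1 then
    if a = ⊥ then 1 else (r - a.toReal) / (R - a.toReal)
  else if n = 2 then
    if a = 0 then 1 else Real.log (r / a.toReal) / Real.log (R / a.toReal)
  else
    if a = ⊥ then r ^ (2 - (n : ℤ)) / R ^ (2 - (n : ℤ))
    else (1 - a.toReal * r ^ (2 - (n : ℤ))) / (1 - a.toReal * R ^ (2 - (n : ℤ)))

/-- The minimal energy on `B_R` for scattering length `a`, with the limiting values for the
limiting profiles. -/
def minEnergy (n : ℕ) (μ : ℝ) (a : EReal) (R : ℝ) : ℝ :=
  if n = 1 then
    if a = ⊥ then 0 else 2 * μ / (R - a.toReal)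
  else if n = 2 then
    if a = 0 then 0 else 2 * Real.pi * μ / Real.log (R / a.toReal)
  else
    if a = ⊥ then
      - (2 * ((n : ℝ) - 2) * Real.pi ^ ((n : ℝ) / 2) * μ * R ^ (n - 2) / Real.Gamma ((n : ℝ) / 2))
    else 2 * ((n : ℝ) - 2) * Real.pi ^ ((n : ℝ) / 2) * μ * a.toReal /
      (Real.Gamma ((n : ℝ) / 2) * (1 - a.toReal * R ^ (2 - (n : ℤ))))

end

end ScatLen

namespace ScatLen

open Filter Topology

/-! ### The Cauchy–Schwarz inequality with weights -/

/-! The problem reduces to a quadratic form on a half line. With `N = n - 1` and `V = r^(n-1) v /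
(2μ)`, the energy of a radial function `g(|x|)` is `μ · sphereArea n` times `∫₀ᴿ (r^N g'² + V g²)`.
Tested on radial functions that vanish at `R` and are extended by zero, the absence of bound states
says that this form is nonnegative on every interval `(0, R)` under a Dirichlet condition at `R`
alone; nothing is prescribed at `0` (`radialPotential_potV`). The integrability of `v₋` enters only
through a Hardy-type bound of `∫ V₋ g²` by the kinetic energy, with constant at most `1/2` on short
intervals (`exists_negBounded`).

Nonnegativity on all intervals improves to coercivity on each of them (`RadialPotential.coercive`).
Continuing a function harmonically beyond `R` down to zero bounds its form below by `-κ g(R)²`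
without any boundary condition (`form_lower_bound`), and with this bound coercivity propagates
outwards from short intervals in steps of fixed length. The direct method then yields a minimizer
`f` with `f(R) = 1`, which solves the weak equation (`exists_weakSol`). It is nonnegative, because a
function that solves the equation and vanishes at `d` vanishes on `(0, d]`; and solutions for
different `R` are proportional. Where `V = 0` one has `f = A + B h` with `h` the radial harmonic
function and `B` the value of the form at `f`. The scattering length depends only on the ratio of
`A` and `B` (`lengthOf`), hence not on `R`. Its range follows from `f ≥ 0` and from the lower bound
for `B` obtained by sending the end of the harmonic continuation to infinity.

Competitors that are not radial are treated ray by ray. On almost every ray the real and imaginary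
parts of an admissible function are primitives with boundary values `1` and `0`, and the radial
derivative is at most the full gradient. The splitting `form(g) = g(R)² form(f) + form(g - g(R) f)`,
together with coercivity, bounds the excess energy below by a multiple of the squared `L²` distance
to `f`. Integration over the sphere gives minimality and uniqueness at once (`energy_deficit`,
`radial_minimizer`). The distributional equation is also obtained by restricting test functions to
rays (`weak_equation_ball`). -/

theorem integral_linear_comb {α : Type*} [MeasurableSpace α] {m : Measure α} {A B C : α → ℝ}
    (hA : Integrable A m) (hB : Integrable B m) (hC : Integrable C m) (s t u : ℝ) :
    ∫ a, (s * A a + t * B a + u * C a) ∂m = s * ∫ a, A a ∂m + t * ∫ a, B a ∂m + u * ∫ a, C a ∂m := by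
  have h1 : Integrable (fun a => s * A a + t * B a) m := (hA.const_mul s).add (hB.const_mul t)
  rw [integral_add h1 (hC.const_mul u), integral_add (hA.const_mul s) (hB.const_mul t),
    integral_const_mul, integral_const_mul, integral_const_mul]

theorem integrable_weighted_mul {α : Type*} [MeasurableSpace α] {m : Measure α} {W x y : α → ℝ}
    (hW : ∀ᵐ a ∂m, 0 ≤ W a) (hm : AEStronglyMeasurable (fun a => W a * (x a * y a)) m)
    (hx : Integrable (fun a => W a * x a ^ 2) m) (hy : Integrable (fun a => W a * y a ^ 2) m) :
    Integrable (fun a => W a * (x a * y a)) m := by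
  refine (hx.add hy).mono' hm ?_
  filter_upwards [hW] with a ha
  simp only [Real.norm_eq_abs, abs_mul, Pi.add_apply, abs_of_nonneg ha]
  rw [← mul_add]
  refine mul_le_mul_of_nonneg_left ?_ ha
  rw [← sq_abs (x a), ← sq_abs (y a)]
  nlinarith [sq_nonneg (|x a| - |y a|), sq_nonneg (|x a|), sq_nonneg (|y a|)]

theorem sq_integral_weighted_mul_le {α : Type*} [MeasurableSpace α] {m : Measure α}
    {W x y : α → ℝ}
    (hW : ∀ᵐ a ∂m, 0 ≤ W a) (hm : AEStronglyMeasurable (fun a => W a * (x a * y a)) m)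
    (hx : Integrable (fun a => W a * x a ^ 2) m) (hy : Integrable (fun a => W a * y a ^ 2) m) :
    (∫ a, W a * (x a * y a) ∂m) ^ 2 ≤ (∫ a, W a * x a ^ 2 ∂m) * ∫ a, W a * y a ^ 2 ∂m := by
  have hxy := integrable_weighted_mul hW hm hx hy
  have key : ∀ t : ℝ, 0 ≤ (∫ a, W a * y a ^ 2 ∂m) * (t * t)
      + (2 * ∫ a, W a * (x a * y a) ∂m) * t + ∫ a, W a * x a ^ 2 ∂m := by
    intro t
    have h0 : 0 ≤ ∫ a, W a * (x a + t * y a) ^ 2 ∂m :=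
      integral_nonneg_of_ae (by filter_upwards [hW] with a ha; exact mul_nonneg ha (sq_nonneg _))
    have h1 : (fun a => W a * (x a + t * y a) ^ 2) = fun a =>
        1 * (W a * x a ^ 2) + (2 * t) * (W a * (x a * y a)) + t ^ 2 * (W a * y a ^ 2) := by
      funext a; ring
    rw [h1, integral_linear_comb hx hxy hy] at h0
    linarith
  have := discrim_le_zero key
  rw [discrim] at this
  nlinarith

theorem integrable_of_weighted_sq {α : Type*} [MeasurableSpace α] {m : Measure α} {k f : α → ℝ}
    (hk : ∀ᵐ a ∂m, 0 < k a) (hf : AEStronglyMeasurable f m)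
    (hki : Integrable (fun a => (k a)⁻¹) m) (hx : Integrable (fun a => k a * f a ^ 2) m) :
    Integrable f m := by
  refine (hx.add hki).mono' hf ?_
  filter_upwards [hk] with a ha
  simp only [Real.norm_eq_abs, Pi.add_apply]
  rw [← sq_abs (f a)]
  have h2 : k a * (k a)⁻¹ = 1 := mul_inv_cancel₀ ha.ne'
  have h3 : 0 < (k a)⁻¹ := inv_pos.2 ha
  -- Expanded, this square gives `2|f| ≤ k f² + 1/k`, which dominates `f` by integrable functions.
  have h4 : 0 ≤ (k a)⁻¹ * (k a * |f a| - 1) ^ 2 := by positivity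
  have h5 : (k a)⁻¹ * (k a * |f a| - 1) ^ 2
      = (k a * (k a)⁻¹) * (k a * |f a| ^ 2) - 2 * (k a * (k a)⁻¹) * |f a| + (k a)⁻¹ := by ring
  rw [h5, h2] at h4
  nlinarith [abs_nonneg (f a)]

/-- Cauchy–Schwarz for the splitting `f = √k f · 1/√k`. With `k = r^N` it turns kinetic energy into
pointwise control of a primitive. -/
theorem sq_integral_le_weighted {α : Type*} [MeasurableSpace α] {m : Measure α} {k f : α → ℝ}
    (hk : ∀ᵐ a ∂m, 0 < k a) (hf : AEStronglyMeasurable f m)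
    (hki : Integrable (fun a => (k a)⁻¹) m) (hx : Integrable (fun a => k a * f a ^ 2) m) :
    (∫ a, f a ∂m) ^ 2 ≤ (∫ a, (k a)⁻¹ ∂m) * ∫ a, k a * f a ^ 2 ∂m := by
  have e1 : (fun a => k a * (f a * (k a)⁻¹)) =ᵐ[m] f := by
    filter_upwards [hk] with a ha
    field_simp
  have e2 : (fun a => k a * ((k a)⁻¹) ^ 2) =ᵐ[m] fun a => (k a)⁻¹ := by
    filter_upwards [hk] with a ha
    field_simp
  have := sq_integral_weighted_mul_le (W := k) (x := f) (y := fun a => (k a)⁻¹) (m := m)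
    (hk.mono fun a h => h.le) (hf.congr e1.symm) hx (hki.congr e2.symm)
  rw [integral_congr_ae e1, integral_congr_ae e2] at this
  linarith

/-- Convergence of weighted square integrals. -/
theorem tendsto_integral_weighted_sq {α : Type*} [MeasurableSpace α] {m : Measure α}
    {W : α → ℝ} {x : ℕ → α → ℝ} {y : α → ℝ}
    (hW : ∀ᵐ a ∂m, 0 ≤ W a)
    (hm : ∀ k, AEStronglyMeasurable (fun a => W a * (y a * (x k a - y a))) m)
    (hy : Integrable (fun a => W a * y a ^ 2) m)
    (hd : ∀ k, Integrable (fun a => W a * (x k a - y a) ^ 2) m)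
    (ht : Filter.Tendsto (fun k => ∫ a, W a * (x k a - y a) ^ 2 ∂m) Filter.atTop (nhds 0)) :
    Filter.Tendsto (fun k => ∫ a, W a * x k a ^ 2 ∂m) Filter.atTop
      (nhds (∫ a, W a * y a ^ 2 ∂m)) := by
  have hxy := fun k => integrable_weighted_mul hW (hm k) hy (hd k)
  have e : ∀ k, ∫ a, W a * x k a ^ 2 ∂m = ∫ a, W a * y a ^ 2 ∂m
      + 2 * (∫ a, W a * (y a * (x k a - y a)) ∂m) + ∫ a, W a * (x k a - y a) ^ 2 ∂m := by
    intro k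
    have h1 : (fun a => W a * x k a ^ 2) = fun a =>
        1 * (W a * y a ^ 2) + 2 * (W a * (y a * (x k a - y a)))
          + 1 * (W a * (x k a - y a) ^ 2) := by
      funext a; ring
    rw [h1, integral_linear_comb hy (hxy k) (hd k), one_mul, one_mul]
  have h2 : Filter.Tendsto (fun k => ∫ a, W a * (y a * (x k a - y a)) ∂m) Filter.atTop
      (nhds 0) := by
    have h3 : Filter.Tendsto (fun k => Real.sqrt ((∫ a, W a * y a ^ 2 ∂m) *
        ∫ a, W a * (x k a - y a) ^ 2 ∂m)) Filter.atTop (nhds 0) := by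
      have := (ht.const_mul (∫ a, W a * y a ^ 2 ∂m)).sqrt
      simpa using this
    refine squeeze_zero_norm (fun k => ?_) h3
    exact Real.abs_le_sqrt (sq_integral_weighted_mul_le hW (hm k) hy (hd k))
  simp_rw [e]
  have := (h2.const_mul 2).const_add (∫ a, W a * y a ^ 2 ∂m) |>.add ht
  simpa using this

/-! ### Functions of finite energy on an interval -/

/-- `g` is a primitive of `γ` on `(0, R]` with `∫ rᴺ γ² < ∞` and `∫ |V| g² < ∞`. -/
structure FiniteEnergy (N : ℕ) (V : ℝ → ℝ) (R : ℝ) (g γ : ℝ → ℝ) : Prop where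
  meas : AEStronglyMeasurable γ (volume.restrict (Ioo 0 R))
  sq : IntegrableOn (fun r => r ^ N * γ r ^ 2) (Ioo 0 R)
  prim : ∀ r ∈ Ioc 0 R, g r = g R - ∫ s in r..R, γ s
  pot : IntegrableOn (fun r => V r * g r ^ 2) (Ioo 0 R)

/-- The bilinear form `∫_{(0,R)} rᴺ g' h' + V g h`. -/
noncomputable def formB (N : ℕ) (V : ℝ → ℝ) (R : ℝ) (g γ h η : ℝ → ℝ) : ℝ :=
  ∫ r in Ioo 0 R, (r ^ N * (γ r * η r) + V r * (g r * h r))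

/-- The kinetic energy `∫_{(0,R)} rᴺ |g'|²`. -/
noncomputable def kin (N : ℕ) (R : ℝ) (γ : ℝ → ℝ) : ℝ := ∫ r in Ioo 0 R, r ^ N * γ r ^ 2

theorem kin_nonneg (N : ℕ) (R : ℝ) (γ : ℝ → ℝ) : 0 ≤ kin N R γ :=
  setIntegral_nonneg measurableSet_Ioo fun r hr => by
    have := hr.1.le
    positivity

theorem ae_pow_pos (N : ℕ) {a : ℝ} (ha : 0 ≤ a) (R : ℝ) :
    ∀ᵐ r ∂(volume.restrict (Ioo a R)), 0 < r ^ N := by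
  filter_upwards [ae_restrict_mem measurableSet_Ioo] with r hr
  exact pow_pos (ha.trans_lt hr.1) _

theorem integrableOn_inv_pow (N : ℕ) {a : ℝ} (ha : 0 < a) (b : ℝ) :
    IntegrableOn (fun r : ℝ => (r ^ N)⁻¹) (Ioo a b) := by
  have : ContinuousOn (fun r : ℝ => (r ^ N)⁻¹) (Icc a b) := by
    refine ContinuousOn.inv₀ (by fun_prop) fun r hr => ?_
    exact (pow_pos (ha.trans_le hr.1) _).ne'
  exact (this.integrableOn_Icc).mono_set Ioo_subset_Icc_self

theorem intervalIntegral_eq_Ioo {γ : ℝ → ℝ} {a b : ℝ} (hab : a ≤ b) :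
    ∫ s in a..b, γ s = ∫ s in Ioo a b, γ s := by
  rw [intervalIntegral.integral_of_le hab, integral_Ioc_eq_integral_Ioo]

theorem integrableOn_Ioo_of_kin {N : ℕ} {R a : ℝ} {γ : ℝ → ℝ} (ha : 0 < a)
    (hm : AEStronglyMeasurable γ (volume.restrict (Ioo 0 R)))
    (hs : IntegrableOn (fun r => r ^ N * γ r ^ 2) (Ioo 0 R)) :
    IntegrableOn γ (Ioo a R) := by
  have hsub : Ioo a R ⊆ Ioo 0 R := Ioo_subset_Ioo_left ha.le
  exact integrable_of_weighted_sq (ae_pow_pos N ha.le R) (hm.mono_set hsub)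
    (integrableOn_inv_pow N ha R) (hs.mono_set hsub)

theorem intervalIntegrable_of_kin {N : ℕ} {R a b : ℝ} {γ : ℝ → ℝ} (ha : 0 < a) (hb : 0 < b)
    (haR : a ≤ R) (hbR : b ≤ R)
    (hm : AEStronglyMeasurable γ (volume.restrict (Ioo 0 R)))
    (hs : IntegrableOn (fun r => r ^ N * γ r ^ 2) (Ioo 0 R)) :
    IntervalIntegrable γ volume a b := by
  have h : ∀ c, 0 < c → c ≤ R → IntervalIntegrable γ volume c R := fun c hc hcR => by
    rw [intervalIntegrable_iff_integrableOn_Ioo_of_le hcR]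
    exact integrableOn_Ioo_of_kin hc hm hs
  exact (h a ha haR).trans (h b hb hbR).symm

theorem sq_intervalIntegral_le {N : ℕ} {R a b : ℝ} {γ : ℝ → ℝ} (ha : 0 < a)
    (hab : a ≤ b) (hbR : b ≤ R)
    (hm : AEStronglyMeasurable γ (volume.restrict (Ioo 0 R)))
    (hs : IntegrableOn (fun r => r ^ N * γ r ^ 2) (Ioo 0 R)) :
    (∫ s in a..b, γ s) ^ 2 ≤ (∫ s in Ioo a b, (s ^ N)⁻¹) * ∫ s in Ioo a b, s ^ N * γ s ^ 2 := by
  have hsub : Ioo a b ⊆ Ioo 0 R := Ioo_subset_Ioo ha.le hbR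
  rw [intervalIntegral_eq_Ioo hab]
  exact sq_integral_le_weighted (ae_pow_pos N ha.le b) (hm.mono_set hsub)
    (integrableOn_inv_pow N ha b) (hs.mono_set hsub)

theorem setIntegral_inv_pow_nonneg (N : ℕ) {a : ℝ} (ha : 0 ≤ a) (b : ℝ) :
    0 ≤ ∫ s in Ioo a b, (s ^ N)⁻¹ :=
  setIntegral_nonneg measurableSet_Ioo fun _ hs =>
    inv_nonneg.2 (pow_nonneg (ha.trans hs.1.le) _)

theorem setIntegral_inv_pow_pos (N : ℕ) {a b : ℝ} (ha : 0 < a) (hab : a < b) :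
    0 < ∫ s in Ioo a b, (s ^ N)⁻¹ := by
  rw [setIntegral_pos_iff_support_of_nonneg_ae]
  · have : (Function.support fun s : ℝ => (s ^ N)⁻¹) ∩ Ioo a b = Ioo a b := by
      refine inter_eq_right.2 fun s hs => ?_
      exact inv_ne_zero (pow_pos (ha.trans hs.1) _).ne'
    rw [this]
    simpa using hab
  · filter_upwards [ae_pow_pos N ha.le b] with s hs
    exact (inv_pos.2 hs).le
  · exact integrableOn_inv_pow N ha b

theorem sq_intervalIntegral_le_kin {N : ℕ} {R a : ℝ} {γ : ℝ → ℝ} (ha : 0 < a) (haR : a ≤ R)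
    (hm : AEStronglyMeasurable γ (volume.restrict (Ioo 0 R)))
    (hs : IntegrableOn (fun r => r ^ N * γ r ^ 2) (Ioo 0 R)) :
    (∫ s in a..R, γ s) ^ 2 ≤ (∫ s in Ioo a R, (s ^ N)⁻¹) * kin N R γ := by
  refine (sq_intervalIntegral_le ha haR le_rfl hm hs).trans ?_
  refine mul_le_mul_of_nonneg_left ?_ (setIntegral_inv_pow_nonneg N ha.le R)
  refine setIntegral_mono_set hs ?_ (Ioo_subset_Ioo_left ha.le).eventuallyLE
  filter_upwards [ae_pow_pos N le_rfl R] with r hr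
  exact mul_nonneg hr.le (sq_nonneg _)

namespace FiniteEnergy

variable {N : ℕ} {V : ℝ → ℝ} {R : ℝ} {g γ h η : ℝ → ℝ}

theorem sub_eq (hg : FiniteEnergy N V R g γ) {a b : ℝ} (ha : a ∈ Ioc 0 R) (hb : b ∈ Ioc 0 R) :
    g b - g a = ∫ s in a..b, γ s := by
  have h1 := intervalIntegrable_of_kin ha.1 hb.1 ha.2 hb.2 hg.meas hg.sq
  have h2 := intervalIntegrable_of_kin hb.1 (ha.1.trans_le ha.2) hb.2 le_rfl hg.meas hg.sq
  rw [hg.prim a ha, hg.prim b hb, ← intervalIntegral.integral_add_adjacent_intervals h1 h2]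
  ring

theorem continuousOn (hg : FiniteEnergy N V R g γ) : ContinuousOn g (Ioc 0 R) := by
  intro r hr
  have hR : 0 < R := hr.1.trans_le hr.2
  have h1 : IntegrableOn γ (uIcc (r / 2) R) := by
    rw [uIcc_of_le (by linarith [hr.2, hr.1]), integrableOn_Icc_iff_integrableOn_Ioo]
    exact integrableOn_Ioo_of_kin (half_pos hr.1) hg.meas hg.sq
  have h2 := intervalIntegral.continuousOn_primitive_interval_left h1
  have h3 : ContinuousOn g (Icc (r / 2) R) := by
    have h4 : ContinuousOn (fun x => g R - ∫ s in x..R, γ s) (Icc (r / 2) R) := by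
      rw [uIcc_of_le (by linarith [hr.2, hr.1])] at h2
      exact continuousOn_const.sub h2
    refine h4.congr fun x hx => hg.prim x ⟨(half_pos hr.1).trans_le hx.1, hx.2⟩
  refine (h3 r ⟨by linarith [hr.1], hr.2⟩).mono_of_mem_nhdsWithin ?_
  have : Ioi (r / 2) ∩ Ioc 0 R ⊆ Icc (r / 2) R := fun x hx => ⟨le_of_lt hx.1, hx.2.2⟩
  exact Filter.mem_of_superset (Filter.inter_mem (mem_nhdsWithin_of_mem_nhds
    (Ioi_mem_nhds (by linarith [hr.1]))) self_mem_nhdsWithin) this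

theorem meas_fun (hg : FiniteEnergy N V R g γ) :
    AEStronglyMeasurable g (volume.restrict (Ioo 0 R)) :=
  (hg.continuousOn.mono Ioo_subset_Ioc_self).aestronglyMeasurable measurableSet_Ioo

theorem kin_integrable (hg : FiniteEnergy N V R g γ) (hh : FiniteEnergy N V R h η) :
    IntegrableOn (fun r => r ^ N * (γ r * η r)) (Ioo 0 R) := by
  refine integrable_weighted_mul ((ae_pow_pos N le_rfl R).mono fun _ h => h.le) ?_ hg.sq hh.sq
  exact (by fun_prop : Continuous fun r : ℝ => r ^ N).aestronglyMeasurable.mul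
    (hg.meas.mul hh.meas)

theorem pot_integrable (hV : AEStronglyMeasurable V (volume.restrict (Ioo 0 R)))
    (hg : FiniteEnergy N V R g γ) (hh : FiniteEnergy N V R h η) :
    IntegrableOn (fun r => V r * (g r * h r)) (Ioo 0 R) := by
  refine (hg.pot.norm.add hh.pot.norm).mono' (hV.mul (hg.meas_fun.mul hh.meas_fun)) ?_
  filter_upwards with r
  simp only [Real.norm_eq_abs, abs_mul, Pi.add_apply, abs_pow]
  rw [← mul_add]
  refine mul_le_mul_of_nonneg_left ?_ (abs_nonneg _)
  nlinarith [sq_nonneg (|g r| - |h r|), sq_nonneg (|g r|), sq_nonneg (|h r|)]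

theorem comb (hV : AEStronglyMeasurable V (volume.restrict (Ioo 0 R)))
    (hg : FiniteEnergy N V R g γ) (hh : FiniteEnergy N V R h η) (s t : ℝ) :
    FiniteEnergy N V R (fun r => s * g r + t * h r) (fun r => s * γ r + t * η r) where
  meas := (hg.meas.const_mul s).add (hh.meas.const_mul t)
  sq := by
    have := ((hg.sq.const_mul (s ^ 2)).add ((hg.kin_integrable hh).const_mul (2 * s * t))).add
      (hh.sq.const_mul (t ^ 2))
    refine this.congr (Filter.Eventually.of_forall fun r => ?_)
    simp only [Pi.add_apply]
    ring
  prim := fun r hr => by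
    have hR : 0 < R := hr.1.trans_le hr.2
    have h1 := intervalIntegrable_of_kin hr.1 hR hr.2 le_rfl hg.meas hg.sq
    have h2 := intervalIntegrable_of_kin hr.1 hR hr.2 le_rfl hh.meas hh.sq
    rw [intervalIntegral.integral_add (h1.const_mul s) (h2.const_mul t),
      intervalIntegral.integral_const_mul, intervalIntegral.integral_const_mul,
      hg.prim r hr, hh.prim r hr]
    ring
  pot := by
    have := ((hg.pot.const_mul (s ^ 2)).add
      ((pot_integrable hV hg hh).const_mul (2 * s * t))).add (hh.pot.const_mul (t ^ 2))
    refine this.congr (Filter.Eventually.of_forall fun r => ?_)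
    simp only [Pi.add_apply]
    ring

theorem form_integrable (hV : AEStronglyMeasurable V (volume.restrict (Ioo 0 R)))
    (hg : FiniteEnergy N V R g γ) (hh : FiniteEnergy N V R h η) :
    IntegrableOn (fun r => r ^ N * (γ r * η r) + V r * (g r * h r)) (Ioo 0 R) :=
  (hg.kin_integrable hh).add (pot_integrable hV hg hh)

theorem restrict (hg : FiniteEnergy N V R g γ) {a : ℝ} (ha : 0 < a) (haR : a ≤ R) :
    FiniteEnergy N V a g γ where
  meas := hg.meas.mono_set (Ioo_subset_Ioo_right haR)
  sq := hg.sq.mono_set (Ioo_subset_Ioo_right haR)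
  prim := fun r hr => by
    rw [← hg.sub_eq ⟨hr.1, hr.2.trans haR⟩ ⟨ha, haR⟩]
    ring
  pot := hg.pot.mono_set (Ioo_subset_Ioo_right haR)

end FiniteEnergy

theorem formB_comm (N : ℕ) (V : ℝ → ℝ) (R : ℝ) (g γ h η : ℝ → ℝ) :
    formB N V R g γ h η = formB N V R h η g γ := by
  unfold formB
  congr 1
  funext r
  ring

theorem formB_comb_right {N : ℕ} {V : ℝ → ℝ} {R : ℝ} {f φ g γ h η : ℝ → ℝ}
    (hV : AEStronglyMeasurable V (volume.restrict (Ioo 0 R)))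
    (hf : FiniteEnergy N V R f φ)
    (hg : FiniteEnergy N V R g γ) (hh : FiniteEnergy N V R h η) (s t : ℝ) :
    formB N V R f φ (fun r => s * g r + t * h r) (fun r => s * γ r + t * η r)
      = s * formB N V R f φ g γ + t * formB N V R f φ h η := by
  unfold formB
  rw [← integral_const_mul, ← integral_const_mul, ← integral_add
    ((hf.form_integrable hV hg).const_mul s) ((hf.form_integrable hV hh).const_mul t)]
  congr 1
  funext r
  ring

theorem formB_comb_self {N : ℕ} {V : ℝ → ℝ} {R : ℝ} {g γ h η : ℝ → ℝ}
    (hV : AEStronglyMeasurable V (volume.restrict (Ioo 0 R)))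
    (hg : FiniteEnergy N V R g γ) (hh : FiniteEnergy N V R h η) (s t : ℝ) :
    formB N V R (fun r => s * g r + t * h r) (fun r => s * γ r + t * η r)
        (fun r => s * g r + t * h r) (fun r => s * γ r + t * η r)
      = s ^ 2 * formB N V R g γ g γ + 2 * s * t * formB N V R g γ h η
        + t ^ 2 * formB N V R h η h η := by
  rw [formB_comb_right hV (hg.comb hV hh s t) hg hh, formB_comm _ _ _ _ _ g,
    formB_comm _ _ _ _ _ h, formB_comb_right hV hg hg hh, formB_comb_right hV hh hg hh,
    formB_comm _ _ _ h η g γ]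
  ring

/-- Parallelogram inequality: the kinetic energy of the combination with `t` replaced by `-t` is
nonnegative, and adding it removes the cross term. -/
theorem kin_comb_le {N : ℕ} {R : ℝ} {γ η : ℝ → ℝ}
    (hm : AEStronglyMeasurable (fun r => r ^ N * (γ r * η r)) (volume.restrict (Ioo 0 R)))
    (hg : IntegrableOn (fun r => r ^ N * γ r ^ 2) (Ioo 0 R))
    (hh : IntegrableOn (fun r => r ^ N * η r ^ 2) (Ioo 0 R)) (s t : ℝ) :
    kin N R (fun r => s * γ r + t * η r) ≤ 2 * s ^ 2 * kin N R γ + 2 * t ^ 2 * kin N R η := by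
  have hi := integrable_weighted_mul ((ae_pow_pos N le_rfl R).mono fun _ h => h.le) hm hg hh
  have e : ∀ t, kin N R (fun r => s * γ r + t * η r) = s ^ 2 * kin N R γ
      + 2 * s * t * (∫ r in Ioo 0 R, r ^ N * (γ r * η r)) + t ^ 2 * kin N R η := by
    intro t
    unfold kin
    rw [← integral_linear_comb hg hi hh]
    congr 1
    funext r
    ring
  have e1 := e t
  have e2 := e (-t)
  have := kin_nonneg N R (fun r => s * γ r + (-t) * η r)
  nlinarith

theorem setIntegral_Ioo_split {F : ℝ → ℝ} {a b c : ℝ} (hab : a ≤ b) (hbc : b ≤ c)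
    (hF : IntegrableOn F (Ioo a c)) :
    ∫ r in Ioo a c, F r = (∫ r in Ioo a b, F r) + ∫ r in Ioo b c, F r := by
  have h1 : IntervalIntegrable F volume a b :=
    (intervalIntegrable_iff_integrableOn_Ioo_of_le hab).2 (hF.mono_set (Ioo_subset_Ioo_right hbc))
  have h2 : IntervalIntegrable F volume b c :=
    (intervalIntegrable_iff_integrableOn_Ioo_of_le hbc).2 (hF.mono_set (Ioo_subset_Ioo_left hab))
  rw [← intervalIntegral_eq_Ioo hab, ← intervalIntegral_eq_Ioo hbc,
    ← intervalIntegral_eq_Ioo (hab.trans hbc), intervalIntegral.integral_add_adjacent_intervals h1 h2]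

theorem integrableOn_Ioo_union {F : ℝ → ℝ} {a b c : ℝ} (hab : a ≤ b) (hbc : b ≤ c)
    (h1 : IntegrableOn F (Ioo a b)) (h2 : IntegrableOn F (Ioo b c)) :
    IntegrableOn F (Ioo a c) := by
  rw [← intervalIntegrable_iff_integrableOn_Ioo_of_le hab] at h1
  rw [← intervalIntegrable_iff_integrableOn_Ioo_of_le hbc] at h2
  rw [← intervalIntegrable_iff_integrableOn_Ioo_of_le (hab.trans hbc)]
  exact h1.trans h2

/-- The hypotheses on the one-dimensional potential `V`: local integrability on `(0, ∞)`,
relative form boundedness of the negative part, and nonnegativity of the quadratic form with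
Dirichlet condition at the right end point. -/
structure RadialPotential (N : ℕ) (V : ℝ → ℝ) : Prop where
  meas : AEStronglyMeasurable V (volume.restrict (Ioi 0))
  int : ∀ s R : ℝ, 0 < s → IntegrableOn V (Ioo s R)
  neg : ∀ R : ℝ, 0 < R → ∃ C : ℝ, ∀ γ : ℝ → ℝ,
    AEStronglyMeasurable γ (volume.restrict (Ioo 0 R)) →
    IntegrableOn (fun r => r ^ N * γ r ^ 2) (Ioo 0 R) →
    IntegrableOn (fun r => max (-V r) 0 * (∫ s in r..R, γ s) ^ 2) (Ioo 0 R) ∧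
    ∫ r in Ioo 0 R, max (-V r) 0 * (∫ s in r..R, γ s) ^ 2 ≤ C * kin N R γ
  neg_small : ∃ R : ℝ, 0 < R ∧ ∀ R', 0 < R' → R' ≤ R → ∀ γ : ℝ → ℝ,
    AEStronglyMeasurable γ (volume.restrict (Ioo 0 R')) →
    IntegrableOn (fun r => r ^ N * γ r ^ 2) (Ioo 0 R') →
    ∫ r in Ioo 0 R', max (-V r) 0 * (∫ s in r..R', γ s) ^ 2 ≤ 1 / 2 * kin N R' γ
  nonneg : ∀ (R : ℝ) (g γ : ℝ → ℝ), 0 < R → FiniteEnergy N V R g γ → g R = 0 →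
    0 ≤ formB N V R g γ g γ

theorem RadialPotential.meas_Ioo {N : ℕ} {V : ℝ → ℝ} (H : RadialPotential N V) (R : ℝ) :
    AEStronglyMeasurable V (volume.restrict (Ioo 0 R)) :=
  H.meas.mono_set Ioo_subset_Ioi_self

/-! ### Gluing -/

/-- Continuation of `g` beyond `R` with derivative `η`. -/
noncomputable def glue (R : ℝ) (g η : ℝ → ℝ) (r : ℝ) : ℝ :=
  if r ≤ R then g r else g R + ∫ s in R..r, η s

/-- The derivative of the continuation. -/
noncomputable def glueDeriv (R : ℝ) (γ η : ℝ → ℝ) (r : ℝ) : ℝ := if r ≤ R then γ r else η r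

theorem glue_of_le {R r : ℝ} (g η : ℝ → ℝ) (h : r ≤ R) : glue R g η r = g r := if_pos h

theorem glue_of_ge {R r : ℝ} (g η : ℝ → ℝ) (h : R ≤ r) :
    glue R g η r = g R + ∫ s in R..r, η s := by
  rcases h.eq_or_lt with rfl | h
  · simp [glue]
  · exact if_neg (not_le.2 h)

theorem glueDeriv_of_le {R r : ℝ} (γ η : ℝ → ℝ) (h : r ≤ R) : glueDeriv R γ η r = γ r := if_pos h

theorem glueDeriv_of_gt {R r : ℝ} (γ η : ℝ → ℝ) (h : R < r) : glueDeriv R γ η r = η r :=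
  if_neg (not_le.2 h)

/-- The continuation is continuous, hence bounded, on `[R, ρ]`, so integrability of `V` away from
the origin is enough for its potential energy. -/
theorem FiniteEnergy.glue {N : ℕ} {V : ℝ → ℝ} {R ρ : ℝ} {g γ η : ℝ → ℝ}
    (hV : ∀ s R : ℝ, 0 < s → IntegrableOn V (Ioo s R))
    (hg : FiniteEnergy N V R g γ) (hR : 0 < R) (hRρ : R ≤ ρ)
    (hm : AEStronglyMeasurable η (volume.restrict (Ioo R ρ)))
    (hs : IntegrableOn (fun r => r ^ N * η r ^ 2) (Ioo R ρ)) :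
    FiniteEnergy N V ρ (glue R g η) (glueDeriv R γ η) := by
  have hη : IntegrableOn η (Ioo R ρ) :=
    integrable_of_weighted_sq (ae_pow_pos N hR.le ρ) hm (integrableOn_inv_pow N hR ρ) hs
  have hηi : IntervalIntegrable η volume R ρ :=
    (intervalIntegrable_iff_integrableOn_Ioo_of_le hRρ).2 hη
  have e1 : ∀ r ∈ Ioo 0 R, glueDeriv R γ η r = γ r := fun r hr => glueDeriv_of_le _ _ hr.2.le
  have e2 : ∀ r ∈ Ioo R ρ, glueDeriv R γ η r = η r := fun r hr => glueDeriv_of_gt _ _ hr.1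
  have e3 : ∀ r, 0 < r → r ≤ R → ∫ s in r..R, glueDeriv R γ η s = ∫ s in r..R, γ s := by
    intro r hr hrR
    rw [intervalIntegral_eq_Ioo hrR, intervalIntegral_eq_Ioo hrR]
    exact setIntegral_congr_fun measurableSet_Ioo fun s hs => e1 s ⟨hr.trans hs.1, hs.2⟩
  have e4 : ∀ r, R ≤ r → r ≤ ρ → ∫ s in r..ρ, glueDeriv R γ η s = ∫ s in r..ρ, η s := by
    intro r hr hrR
    rw [intervalIntegral_eq_Ioo hrR, intervalIntegral_eq_Ioo hrR]
    exact setIntegral_congr_fun measurableSet_Ioo fun s hs => e2 s ⟨hr.trans_lt hs.1, hs.2⟩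
  have hsq : IntegrableOn (fun r => r ^ N * glueDeriv R γ η r ^ 2) (Ioo 0 ρ) := by
    refine integrableOn_Ioo_union hR.le hRρ (hg.sq.congr_fun (fun r hr => ?_) measurableSet_Ioo)
      (hs.congr_fun (fun r hr => ?_) measurableSet_Ioo)
    · simp only [e1 r hr]
    · simp only [e2 r hr]
  have hmeas : AEStronglyMeasurable (glueDeriv R γ η) (volume.restrict (Ioo 0 ρ)) := by
    have h1 : AEStronglyMeasurable (glueDeriv R γ η) (volume.restrict (Ioo 0 R ∪ Ioo R ρ)) := by
      refine aestronglyMeasurable_union_iff.2 ⟨hg.meas.congr ?_, hm.congr ?_⟩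
      · filter_upwards [ae_restrict_mem measurableSet_Ioo] with r hr using (e1 r hr).symm
      · filter_upwards [ae_restrict_mem measurableSet_Ioo] with r hr using (e2 r hr).symm
    rcases hRρ.eq_or_lt with rfl | hlt
    · simpa using h1
    rw [← Ioc_union_Ioo_eq_Ioo hR.le hlt]
    have h2 : volume.restrict (Ioo 0 R ∪ Ioo R ρ) = volume.restrict (Ioc 0 R ∪ Ioo R ρ) :=
      Measure.restrict_congr_set (Ioo_ae_eq_Ioc.union (ae_eq_refl _))
    rwa [h2] at h1
  refine ⟨hmeas, hsq, fun r hr => ?_, ?_⟩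
  · rw [glue_of_ge g η hRρ]
    rcases le_total r R with hrR | hrR
    · have hi := intervalIntegrable_of_kin hr.1 hR hr.2 hRρ hmeas hsq
      have hi' := intervalIntegrable_of_kin hR (hR.trans_le hRρ) hRρ le_rfl hmeas hsq
      rw [← intervalIntegral.integral_add_adjacent_intervals hi hi', e3 r hr.1 hrR,
        e4 R le_rfl hRρ, glue_of_le g η hrR, hg.prim r ⟨hr.1, hrR⟩]
      ring
    · rw [e4 r hrR hr.2, glue_of_ge g η hrR]
      have hi : IntervalIntegrable η volume R r := hηi.mono_set (by
        rw [uIcc_of_le hrR, uIcc_of_le hRρ]; exact Icc_subset_Icc_right hr.2)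
      have hi' : IntervalIntegrable η volume r ρ := hηi.mono_set (by
        rw [uIcc_of_le hr.2, uIcc_of_le hRρ]; exact Icc_subset_Icc_left hrR)
      rw [← intervalIntegral.integral_add_adjacent_intervals hi hi']
      ring
  · refine integrableOn_Ioo_union hR.le hRρ (hg.pot.congr_fun (fun r hr => ?_) measurableSet_Ioo) ?_
    · simp only [glue_of_le g η hr.2.le]
    · have hc : ContinuousOn (fun r => (g R + ∫ s in R..r, η s) ^ 2) (Icc R ρ) := by
        refine (continuousOn_const.add ?_).pow 2
        have := intervalIntegral.continuousOn_primitive_interval (μ := volume) (f := η)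
          (a := R) (b := ρ) (by rwa [uIcc_of_le hRρ, integrableOn_Icc_iff_integrableOn_Ioo])
        rwa [uIcc_of_le hRρ] at this
      have hVi : IntegrableOn V (Icc R ρ) := by
        rw [integrableOn_Icc_iff_integrableOn_Ioo]; exact hV R ρ hR
      refine ((hVi.mul_continuousOn hc isCompact_Icc).mono_set Ioo_subset_Icc_self).congr_fun
        (fun r hr => ?_) measurableSet_Ioo
      simp only [glue_of_ge g η hr.1.le]

theorem FiniteEnergy.zero (N : ℕ) (V : ℝ → ℝ) (R : ℝ) :
    FiniteEnergy N V R (fun _ => 0) (fun _ => 0) where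
  meas := aestronglyMeasurable_const
  sq := by simp
  prim := fun r _ => by simp
  pot := by simp

theorem formB_glue {N : ℕ} {V : ℝ → ℝ} {R ρ : ℝ} {f φ g γ η : ℝ → ℝ}
    (hV : AEStronglyMeasurable V (volume.restrict (Ioo 0 ρ)))
    (hR : 0 ≤ R) (hRρ : R ≤ ρ) (hf : FiniteEnergy N V ρ f φ)
    (hg : FiniteEnergy N V ρ (glue R g η) (glueDeriv R γ η)) :
    formB N V ρ f φ (glue R g η) (glueDeriv R γ η) = formB N V R f φ g γ +
      ∫ r in Ioo R ρ, (r ^ N * (φ r * η r) + V r * (f r * (g R + ∫ s in R..r, η s))) := by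
  have := hf.form_integrable hV hg
  unfold formB
  rw [setIntegral_Ioo_split hR hRρ this]
  congr 1
  · refine setIntegral_congr_fun measurableSet_Ioo fun r hr => ?_
    simp only [glue_of_le g η hr.2.le, glueDeriv_of_le γ η hr.2.le]
  · refine setIntegral_congr_fun measurableSet_Ioo fun r hr => ?_
    simp only [glue_of_ge g η hr.1.le, glueDeriv_of_gt γ η hr.1]

theorem formB_glue_self {N : ℕ} {V : ℝ → ℝ} {R ρ : ℝ} {g γ η : ℝ → ℝ}
    (hV : AEStronglyMeasurable V (volume.restrict (Ioo 0 ρ)))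
    (hR : 0 ≤ R) (hRρ : R ≤ ρ)
    (hg : FiniteEnergy N V ρ (glue R g η) (glueDeriv R γ η)) :
    formB N V ρ (glue R g η) (glueDeriv R γ η) (glue R g η) (glueDeriv R γ η) =
      formB N V R g γ g γ + ∫ r in Ioo R ρ, (r ^ N * (η r * η r) +
        V r * ((g R + ∫ s in R..r, η s) * (g R + ∫ s in R..r, η s))) := by
  have := hg.form_integrable hV hg
  unfold formB
  rw [setIntegral_Ioo_split hR hRρ this]
  congr 1
  · refine setIntegral_congr_fun measurableSet_Ioo fun r hr => ?_
    simp only [glue_of_le g η hr.2.le, glueDeriv_of_le γ η hr.2.le]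
  · refine setIntegral_congr_fun measurableSet_Ioo fun r hr => ?_
    simp only [glue_of_ge g η hr.1.le, glueDeriv_of_gt γ η hr.1]

/-- Extension by zero. -/
theorem FiniteEnergy.extend_zero {N : ℕ} {V : ℝ → ℝ} {R ρ : ℝ} {g γ : ℝ → ℝ}
    (hV : ∀ s R : ℝ, 0 < s → IntegrableOn V (Ioo s R))
    (hg : FiniteEnergy N V R g γ) (hR : 0 < R) (hRρ : R ≤ ρ) :
    FiniteEnergy N V ρ (ScatLen.glue R g (fun _ => 0)) (glueDeriv R γ (fun _ => 0)) :=
  hg.glue hV hR hRρ aestronglyMeasurable_const (by simp)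

/-- Lets functions that live on `(0, R)` and vanish at `R` serve as test functions for an equation
on a longer interval. -/
theorem formB_extend_zero {N : ℕ} {V : ℝ → ℝ} {R ρ : ℝ} {f φ g γ : ℝ → ℝ}
    (H : RadialPotential N V)
    (hR : 0 < R) (hRρ : R ≤ ρ) (hf : FiniteEnergy N V ρ f φ)
    (hg : FiniteEnergy N V R g γ) (h0 : g R = 0) :
    formB N V ρ f φ (glue R g (fun _ => 0)) (glueDeriv R γ (fun _ => 0))
      = formB N V R f φ g γ := by
  rw [formB_glue (H.meas_Ioo ρ) hR.le hRρ hf (hg.extend_zero H.int hR hRρ)]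
  simp [h0]

theorem intervalIntegral_inv_pow (N : ℕ) {a b : ℝ} (hab : a ≤ b) :
    ∫ s in a..b, (s ^ N)⁻¹ = ∫ s in Ioo a b, (s ^ N)⁻¹ := intervalIntegral_eq_Ioo hab

theorem pow_mul_sq_const_inv_integrableOn (N : ℕ) {a : ℝ} (ha : 0 < a) (b c : ℝ) :
    IntegrableOn (fun r : ℝ => r ^ N * (c * (r ^ N)⁻¹) ^ 2) (Ioo a b) := by
  refine ((integrableOn_inv_pow N ha b).const_mul (c ^ 2)).congr ?_
  filter_upwards [ae_pow_pos N ha.le b] with r hr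
  field_simp

/-- Lower bound for the form without boundary condition, by comparison with the continuation
that decreases to zero at `ρ`. -/
theorem RadialPotential.form_lower_bound {N : ℕ} {V : ℝ → ℝ} (H : RadialPotential N V)
    {R ρ : ℝ} {g γ : ℝ → ℝ} (hR : 0 < R) (hRρ : R < ρ) (hg : FiniteEnergy N V R g γ) :
    -((∫ s in Ioo R ρ, (s ^ N)⁻¹)⁻¹ + ∫ s in Ioo R ρ, |V s|) * g R ^ 2
      ≤ formB N V R g γ g γ := by
  set I := ∫ s in Ioo R ρ, (s ^ N)⁻¹ with hI
  have hIpos : 0 < I := setIntegral_inv_pow_pos N hR hRρ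
  -- The flux `c` is the one for which the harmonic continuation, with derivative `c r^(-N)`,
  -- reaches zero exactly at `ρ`; its kinetic energy is `c² I = g(R)² / I`.
  set c := -(g R * I⁻¹) with hc
  have hG := hg.glue (η := fun r => c * (r ^ N)⁻¹) (ρ := ρ) H.int hR hRρ.le
    ((integrableOn_inv_pow N hR ρ).aestronglyMeasurable.const_mul c)
    (pow_mul_sq_const_inv_integrableOn N hR ρ c)
  have hend : glue R g (fun r => c * (r ^ N)⁻¹) ρ = 0 := by
    rw [glue_of_ge _ _ hRρ.le, intervalIntegral.integral_const_mul,
      intervalIntegral_inv_pow N hRρ.le, ← hI, hc]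
    field_simp
    ring
  have hpos := H.nonneg ρ _ _ (hR.trans hRρ) hG hend
  rw [formB_glue_self (H.meas_Ioo ρ) hR.le hRρ.le hG] at hpos
  -- The continuation is `g(R)` times a factor that decreases from `1` to `0`.
  have hbd : ∀ r ∈ Ioo R ρ, (g R + ∫ s in R..r, c * (s ^ N)⁻¹) ^ 2 ≤ g R ^ 2 := by
    intro r hr
    rw [intervalIntegral.integral_const_mul, intervalIntegral_inv_pow N hr.1.le]
    set J := ∫ s in Ioo R r, (s ^ N)⁻¹
    have hJ0 : 0 ≤ J := setIntegral_inv_pow_nonneg N hR.le r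
    have hJI : J ≤ I := by
      refine setIntegral_mono_set (integrableOn_inv_pow N hR ρ) ?_
        (Ioo_subset_Ioo_right hr.2.le).eventuallyLE
      filter_upwards [ae_pow_pos N hR.le ρ] with s hs using (inv_pos.2 hs).le
    have : g R + c * J = g R * (1 - J * I⁻¹) := by rw [hc]; ring
    rw [this, mul_pow]
    have h1 : J * I⁻¹ ≤ 1 := by rw [← div_eq_mul_inv]; exact (div_le_one hIpos).2 hJI
    have h2 : 0 ≤ J * I⁻¹ := by positivity
    have : (1 - J * I⁻¹) ^ 2 ≤ 1 := by nlinarith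
    nlinarith [sq_nonneg (g R)]
  have hmain : ∫ r in Ioo R ρ, (r ^ N * (c * (r ^ N)⁻¹ * (c * (r ^ N)⁻¹)) +
        V r * ((g R + ∫ s in R..r, c * (s ^ N)⁻¹) * (g R + ∫ s in R..r, c * (s ^ N)⁻¹)))
      ≤ ∫ r in Ioo R ρ, (c ^ 2 * (r ^ N)⁻¹ + g R ^ 2 * |V r|) := by
    refine setIntegral_mono_on ?_ ?_ measurableSet_Ioo fun r hr => ?_
    · refine ((hG.form_integrable (H.meas_Ioo ρ) hG).mono_set
        (Ioo_subset_Ioo_left hR.le)).congr_fun (fun r hr => ?_) measurableSet_Ioo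
      simp only [glue_of_ge _ _ hr.1.le, glueDeriv_of_gt _ _ hr.1]
    · exact ((integrableOn_inv_pow N hR ρ).const_mul _).add ((H.int R ρ hR).abs.const_mul _)
    · have hp : 0 < r ^ N := pow_pos (hR.trans hr.1) _
      have e : r ^ N * (c * (r ^ N)⁻¹ * (c * (r ^ N)⁻¹)) = c ^ 2 * (r ^ N)⁻¹ := by field_simp
      rw [e, ← sq]
      have h1 := hbd r hr
      have h2 := neg_abs_le (V r)
      have h3 := le_abs_self (V r)
      have h4 : V r * (g R + ∫ s in R..r, c * (s ^ N)⁻¹) ^ 2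
          ≤ |V r| * (g R + ∫ s in R..r, c * (s ^ N)⁻¹) ^ 2 :=
        mul_le_mul_of_nonneg_right h3 (sq_nonneg _)
      have h5 := mul_le_mul_of_nonneg_left h1 (abs_nonneg (V r))
      linarith
  rw [integral_add ((integrableOn_inv_pow N hR ρ).const_mul _) ((H.int R ρ hR).abs.const_mul _),
    integral_const_mul, integral_const_mul, ← hI] at hmain
  have : c ^ 2 * I = I⁻¹ * g R ^ 2 := by rw [hc]; field_simp
  rw [this] at hmain
  linarith

/-! ### Completeness of the weighted `L²` space of derivatives -/

theorem norm_toLp_sub_sq {α : Type*} [MeasurableSpace α] {m : Measure α} {f g : α → ℝ}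
    (hf : MemLp f 2 m) (hg : MemLp g 2 m) :
    ‖hf.toLp f - hg.toLp g‖ ^ 2 = ∫ a, (f a - g a) ^ 2 ∂m := by
  rw [← MemLp.toLp_sub, ← real_inner_self_eq_norm_sq, L2.inner_def]
  refine integral_congr_ae ?_
  filter_upwards [(hf.sub hg).coeFn_toLp] with a ha
  rw [ha]
  simp [sq]

theorem exists_l2_limit {α : Type*} [MeasurableSpace α] {m : Measure α} {F : ℕ → α → ℝ}
    (hF : ∀ k, MemLp (F k) 2 m) {b : ℕ → ℝ} (hb : Tendsto b atTop (𝓝 0))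
    (h : ∀ j k, ∫ a, (F j a - F k a) ^ 2 ∂m ≤ b j + b k) :
    ∃ G, MemLp G 2 m ∧ Tendsto (fun k => ∫ a, (F k a - G a) ^ 2 ∂m) atTop (𝓝 0) := by
  have hc : CauchySeq fun k => (hF k).toLp (F k) := by
    rw [Metric.cauchySeq_iff]
    intro ε hε
    have h1 : ∀ᶠ k in atTop, b k < ε ^ 2 / 2 := hb.eventually_lt_const (by positivity)
    obtain ⟨K, hK⟩ := eventually_atTop.1 h1
    refine ⟨K, fun j hj k hk => ?_⟩
    rw [dist_eq_norm]
    have h2 := norm_toLp_sub_sq (hF j) (hF k)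
    have h3 := h j k
    have h4 := hK j hj
    have h5 := hK k hk
    exact lt_of_pow_lt_pow_left₀ 2 hε.le (by linarith)
  obtain ⟨G, hG⟩ := cauchySeq_tendsto_of_complete hc
  refine ⟨G, Lp.memLp G, ?_⟩
  have h1 : Tendsto (fun k => ‖(hF k).toLp (F k) - G‖ ^ 2) atTop (𝓝 0) := by
    have := (tendsto_iff_norm_sub_tendsto_zero.1 hG).pow 2
    simpa using this
  refine h1.congr fun k => ?_
  have := norm_toLp_sub_sq (hF k) (Lp.memLp G)
  rwa [Lp.toLp_coeFn] at this

/-- Multiplication by `√(r^N)` carries the kinetic norm to the plain `L²` norm. The hypothesis in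
terms of `b j + b k` is the Cauchy condition that the parallelogram identity delivers for a
minimizing sequence. -/
theorem exists_kin_limit {N : ℕ} {R : ℝ} {γ : ℕ → ℝ → ℝ}
    (hm : ∀ k, AEStronglyMeasurable (γ k) (volume.restrict (Ioo 0 R)))
    (hs : ∀ k, IntegrableOn (fun r => r ^ N * γ k r ^ 2) (Ioo 0 R))
    {b : ℕ → ℝ} (hb : Tendsto b atTop (𝓝 0))
    (h : ∀ j k, kin N R (fun r => γ j r - γ k r) ≤ b j + b k) :
    ∃ φ, AEStronglyMeasurable φ (volume.restrict (Ioo 0 R)) ∧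
      IntegrableOn (fun r => r ^ N * φ r ^ 2) (Ioo 0 R) ∧
      Tendsto (fun k => kin N R (fun r => γ k r - φ r)) atTop (𝓝 0) := by
  have hw : AEStronglyMeasurable (fun r : ℝ => √(r ^ N)) (volume.restrict (Ioo 0 R)) :=
    (by fun_prop : Continuous fun r : ℝ => √(r ^ N)).aestronglyMeasurable
  have hwi : AEStronglyMeasurable (fun r : ℝ => (√(r ^ N))⁻¹) (volume.restrict (Ioo 0 R)) :=
    (by fun_prop : Measurable fun r : ℝ => (√(r ^ N))⁻¹).aestronglyMeasurable
  have e : ∀ x : ℝ → ℝ, (fun r => r ^ N * x r ^ 2) =ᵐ[volume.restrict (Ioo 0 R)]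
      fun r => (√(r ^ N) * x r) ^ 2 := fun x => by
    filter_upwards [ae_pow_pos N le_rfl R] with r hr
    rw [mul_pow, Real.sq_sqrt hr.le]
  have hF : ∀ k, MemLp (fun r => √(r ^ N) * γ k r) 2 (volume.restrict (Ioo 0 R)) := fun k => by
    exact (memLp_two_iff_integrable_sq (hw.mul (hm k))).2 ((hs k).congr (e _))
  obtain ⟨G, hG, hlim⟩ := exists_l2_limit hF hb fun j k => by
    refine le_trans (le_of_eq ?_) (h j k)
    unfold kin
    rw [integral_congr_ae (e _)]
    congr 1
    funext r
    ring
  refine ⟨fun r => (√(r ^ N))⁻¹ * G r, hwi.mul hG.1, ?_, ?_⟩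
  · have h1 := (memLp_two_iff_integrable_sq hG.1).1 hG
    refine Integrable.congr h1 ?_
    filter_upwards [ae_pow_pos N le_rfl R] with r hr
    rw [mul_pow, inv_pow, Real.sq_sqrt hr.le]
    field_simp
  · refine hlim.congr fun k => ?_
    unfold kin
    refine integral_congr_ae ?_
    filter_upwards [ae_pow_pos N le_rfl R] with r hr
    have h1 : √(r ^ N) ≠ 0 := (Real.sqrt_pos.2 hr).ne'
    have h2 : r ^ N = √(r ^ N) ^ 2 := (Real.sq_sqrt hr.le).symm
    have h3 : √(r ^ N) * γ k r - G r = √(r ^ N) * (γ k r - (√(r ^ N))⁻¹ * G r) := by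
      field_simp
    rw [h3, mul_pow, ← h2]

/-- The form is bounded below by a multiple of the kinetic energy, under the Dirichlet
condition at `R`. -/
def Coercive (N : ℕ) (V : ℝ → ℝ) (R : ℝ) : Prop :=
  ∃ c : ℝ, 0 < c ∧ ∀ g γ, FiniteEnergy N V R g γ → g R = 0 →
    c * kin N R γ ≤ formB N V R g γ g γ

/-- `f` solves the weak zero-energy equation on `(0, R)` with `f R = 1`. -/
structure IsWeakSol (N : ℕ) (V : ℝ → ℝ) (R : ℝ) (f φ : ℝ → ℝ) : Prop where
  fe : FiniteEnergy N V R f φ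
  one : f R = 1
  weak : ∀ h η, FiniteEnergy N V R h η → h R = 0 → formB N V R f φ h η = 0

namespace FiniteEnergy

variable {N : ℕ} {V : ℝ → ℝ} {R : ℝ} {g γ h η : ℝ → ℝ}

theorem neg_integrable (hV : AEStronglyMeasurable V (volume.restrict (Ioo 0 R)))
    (hg : FiniteEnergy N V R g γ) :
    IntegrableOn (fun r => max (-V r) 0 * g r ^ 2) (Ioo 0 R) := by
  refine hg.pot.norm.mono' ((hV.neg.sup aestronglyMeasurable_const).mul (hg.meas_fun.pow 2)) ?_
  filter_upwards with r
  rw [Real.norm_eq_abs, Real.norm_eq_abs, abs_mul, abs_mul]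
  refine mul_le_mul_of_nonneg_right ?_ (abs_nonneg _)
  rw [abs_of_nonneg (le_max_right _ _)]
  exact max_le (neg_le_abs _) (abs_nonneg _)

theorem pos_integrable (hV : AEStronglyMeasurable V (volume.restrict (Ioo 0 R)))
    (hg : FiniteEnergy N V R g γ) :
    IntegrableOn (fun r => max (V r) 0 * g r ^ 2) (Ioo 0 R) := by
  refine hg.pot.norm.mono' ((hV.sup aestronglyMeasurable_const).mul (hg.meas_fun.pow 2)) ?_
  filter_upwards with r
  rw [Real.norm_eq_abs, Real.norm_eq_abs, abs_mul, abs_mul]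
  refine mul_le_mul_of_nonneg_right ?_ (abs_nonneg _)
  rw [abs_of_nonneg (le_max_right _ _)]
  exact max_le (le_abs_self _) (abs_nonneg _)

theorem formB_self_eq (hV : AEStronglyMeasurable V (volume.restrict (Ioo 0 R)))
    (hg : FiniteEnergy N V R g γ) :
    formB N V R g γ g γ = kin N R γ + (∫ r in Ioo 0 R, max (V r) 0 * g r ^ 2)
      - ∫ r in Ioo 0 R, max (-V r) 0 * g r ^ 2 := by
  have := integral_linear_comb hg.sq (hg.pos_integrable hV) (hg.neg_integrable hV) 1 1 (-1)
  unfold formB kin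
  rw [one_mul, one_mul, neg_one_mul, ← sub_eq_add_neg] at this
  rw [← this]
  congr 1
  funext r
  rcases le_total (V r) 0 with h | h
  · rw [max_eq_right h, max_eq_left (by linarith)]; ring
  · rw [max_eq_left h, max_eq_right (by linarith)]; ring

end FiniteEnergy

/-! ### Existence of a one-dimensional minimizer by the direct method -/

theorem RadialPotential.exists_competitor {N : ℕ} {V : ℝ → ℝ} (H : RadialPotential N V)
    {R : ℝ} (hR : 0 < R) : ∃ g γ, FiniteEnergy N V R g γ ∧ g R = 1 := by
  have hR2 : R / 2 ≤ R := by linarith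
  -- The potential may fail to be integrable at `0`, so the constant `1` need not have finite
  -- energy. A linear ramp that vanishes on `(0, R/2]` avoids the origin.
  refine ⟨_, _, (FiniteEnergy.zero N V (R / 2)).glue (η := fun _ => 2 / R) H.int (half_pos hR) hR2
    aestronglyMeasurable_const ?_, ?_⟩
  · exact ((by fun_prop : Continuous fun r : ℝ => r ^ N * (2 / R) ^ 2).integrableOn_Icc
      (a := R / 2) (b := R)).mono_set Ioo_subset_Icc_self
  · rw [glue_of_ge _ _ hR2]
    simp
    field_simp
    ring

/-- A function given by a primitive is of finite energy as soon as the positive part of the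
potential energy is finite. -/
theorem FiniteEnergy.of_primitive {N : ℕ} {V : ℝ → ℝ} {R c : ℝ} {γ : ℝ → ℝ}
    (hm : AEStronglyMeasurable γ (volume.restrict (Ioo 0 R)))
    (hs : IntegrableOn (fun r => r ^ N * γ r ^ 2) (Ioo 0 R))
    (hp : IntegrableOn (fun r => V r * (c - ∫ s in r..R, γ s) ^ 2) (Ioo 0 R)) :
    FiniteEnergy N V R (fun r => c - ∫ s in r..R, γ s) γ where
  meas := hm
  sq := hs
  prim := fun r _ => by simp
  pot := hp

theorem integrable_pot_of_pos_neg {V : ℝ → ℝ} {R : ℝ} {w : ℝ → ℝ}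
    (hp : IntegrableOn (fun r => max (V r) 0 * w r ^ 2) (Ioo 0 R))
    (hn : IntegrableOn (fun r => max (-V r) 0 * w r ^ 2) (Ioo 0 R)) :
    IntegrableOn (fun r => V r * w r ^ 2) (Ioo 0 R) := by
  refine (hp.sub hn).congr (Eventually.of_forall fun r => ?_)
  simp only [Pi.sub_apply]
  rcases le_total (V r) 0 with h | h
  · rw [max_eq_right h, max_eq_left (by linarith)]; ring
  · rw [max_eq_left h, max_eq_right (by linarith)]; ring

theorem integrable_weighted_sq_add {α : Type*} [MeasurableSpace α] {m : Measure α} {W x y : α → ℝ}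
    (hW : ∀ᵐ a ∂m, 0 ≤ W a) (hm : AEStronglyMeasurable (fun a => W a * (x a * y a)) m)
    (hx : Integrable (fun a => W a * x a ^ 2) m) (hy : Integrable (fun a => W a * y a ^ 2) m) :
    Integrable (fun a => W a * (x a + y a) ^ 2) m := by
  have := (hx.add ((integrable_weighted_mul hW hm hx hy).const_mul 2)).add hy
  refine this.congr (Eventually.of_forall fun a => ?_)
  simp only [Pi.add_apply]
  ring

theorem continuousOn_primitive_of_kin {N : ℕ} {R : ℝ} {γ : ℝ → ℝ}
    (hm : AEStronglyMeasurable γ (volume.restrict (Ioo 0 R)))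
    (hs : IntegrableOn (fun r => r ^ N * γ r ^ 2) (Ioo 0 R)) :
    ContinuousOn (fun r => ∫ s in r..R, γ s) (Ioc 0 R) := by
  have h : FiniteEnergy N (fun _ => 0) R (fun r => 0 - ∫ s in r..R, γ s) γ :=
    FiniteEnergy.of_primitive hm hs (by simp)
  refine h.continuousOn.neg.congr fun r _ => by simp

/-- By coercivity a minimizing sequence has derivatives that converge in the kinetic norm. The
negative potential energy then converges, being form bounded, while the positive part is only lower
semicontinuous, which is the favourable direction. The weak equation is the first variation at the
minimizer. -/
theorem RadialPotential.exists_weakSol {N : ℕ} {V : ℝ → ℝ} (H : RadialPotential N V)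
    {R : ℝ} (hR : 0 < R) (hc : Coercive N V R) : ∃ f φ, IsWeakSol N V R f φ := by
  obtain ⟨c, hc0, hc⟩ := hc
  have hVm := H.meas_Ioo R
  set S : Set ℝ := {q | ∃ g γ, FiniteEnergy N V R g γ ∧ g R = 1 ∧ formB N V R g γ g γ = q} with hS
  have hne : S.Nonempty := by
    obtain ⟨g, γ, h1, h2⟩ := H.exists_competitor hR
    exact ⟨_, g, γ, h1, h2, rfl⟩
  have hbdd : BddBelow S := by
    refine ⟨-((∫ s in Ioo R (R + 1), (s ^ N)⁻¹)⁻¹ + ∫ s in Ioo R (R + 1), |V s|), ?_⟩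
    rintro q ⟨g, γ, h1, h2, rfl⟩
    have := H.form_lower_bound hR (lt_add_one R) h1
    rw [h2] at this
    linarith
  set e := sInf S with he
  have hlow : ∀ g γ, FiniteEnergy N V R g γ → g R = 1 → e ≤ formB N V R g γ g γ :=
    fun g γ h1 h2 => csInf_le hbdd ⟨g, γ, h1, h2, rfl⟩
  have hex : ∀ k : ℕ, ∃ g γ, FiniteEnergy N V R g γ ∧ g R = 1 ∧
      formB N V R g γ g γ < e + 1 / ((k : ℝ) + 1) := fun k => by
    obtain ⟨q, ⟨g, γ, h1, h2, rfl⟩, hq⟩ := exists_lt_of_csInf_lt hne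
      (show sInf S < e + 1 / ((k : ℝ) + 1) from lt_add_of_pos_right _ (by positivity))
    exact ⟨g, γ, h1, h2, hq⟩
  choose g γ hg hg1 hgq using hex
  have h0 : Tendsto (fun k : ℕ => 1 / ((k : ℝ) + 1)) atTop (𝓝 0) :=
    tendsto_one_div_add_atTop_nhds_zero_nat
  -- Parallelogram identity: the form of `g j - g k` is `2 q j + 2 q k` minus four times the form of
  -- the midpoint, which is at least `e`. Only the excesses over `e` remain.
  obtain ⟨φ, hφm, hφs, hφ⟩ := exists_kin_limit (fun k => (hg k).meas) (fun k => (hg k).sq)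
    (b := fun k => c⁻¹ * (2 * (1 / ((k : ℝ) + 1)))) (by simpa using (h0.const_mul 2).const_mul c⁻¹)
    (fun j k => by
      have d := (hg j).comb hVm (hg k) 1 (-1)
      have m := (hg j).comb hVm (hg k) (1 / 2) (1 / 2)
      have h1 := hc _ _ d (by rw [hg1, hg1]; ring)
      have h2 := hlow _ _ m (by rw [hg1, hg1]; ring)
      rw [formB_comb_self hVm (hg j) (hg k)] at h1 h2
      have h3 := hgq j
      have h4 := hgq k
      have h5 : kin N R (fun r => γ j r - γ k r) = kin N R fun r => 1 * γ j r + -1 * γ k r := by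
        congr 1; funext r; ring
      rw [h5, ← mul_add, ← div_eq_inv_mul, le_div_iff₀ hc0]
      linarith)
  set f : ℝ → ℝ := fun r => 1 - ∫ s in r..R, φ s with hf
  have hdm : ∀ k, AEStronglyMeasurable (fun r => γ k r - φ r) (volume.restrict (Ioo 0 R)) :=
    fun k => (hg k).meas.sub hφm
  have hds : ∀ k, IntegrableOn (fun r => r ^ N * (γ k r - φ r) ^ 2) (Ioo 0 R) := fun k => by
    have hp := ((ae_pow_pos N le_rfl R).mono fun _ h => h.le)
    have h1 := integrable_weighted_sq_add (x := γ k) (y := fun r => -φ r) hp ?_ (hg k).sq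
      (by simpa only [neg_sq, IntegrableOn] using hφs)
    · exact h1.congr (Eventually.of_forall fun r => by simp only; ring)
    · exact (by fun_prop : Continuous fun r : ℝ => r ^ N).aestronglyMeasurable.mul
        ((hg k).meas.mul hφm.neg)
  have hdiff : ∀ k, ∀ r ∈ Ioc 0 R, g k r - f r = -∫ s in r..R, (γ k s - φ s) := by
    intro k r hr
    rw [intervalIntegral.integral_sub
      (intervalIntegrable_of_kin hr.1 hR hr.2 le_rfl (hg k).meas (hg k).sq)
      (intervalIntegrable_of_kin hr.1 hR hr.2 le_rfl hφm hφs), (hg k).prim r hr, hg1, hf]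
    ring
  have hfm : AEStronglyMeasurable f (volume.restrict (Ioo 0 R)) :=
    ((continuousOn_const.sub (continuousOn_primitive_of_kin hφm hφs)).mono
      Ioo_subset_Ioc_self).aestronglyMeasurable measurableSet_Ioo
  -- All functions take the value `1` at `R`, so convergence of the derivatives in the kinetic norm
  -- forces pointwise convergence away from the origin.
  have hptw : ∀ r ∈ Ioc 0 R, Tendsto (fun k => g k r) atTop (𝓝 (f r)) := by
    intro r hr
    rw [tendsto_iff_norm_sub_tendsto_zero]
    have h1 : Tendsto (fun k => √((∫ s in Ioo r R, (s ^ N)⁻¹) *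
        kin N R (fun r => γ k r - φ r))) atTop (𝓝 0) := by
      have := (hφ.const_mul (∫ s in Ioo r R, (s ^ N)⁻¹)).sqrt
      simpa using this
    refine squeeze_zero (fun _ => norm_nonneg _) (fun k => ?_) h1
    rw [hdiff k r hr, norm_neg]
    exact Real.abs_le_sqrt (sq_intervalIntegral_le_kin hr.1 hr.2 (hdm k) (hds k))
  obtain ⟨C, hC⟩ := H.neg R hR
  have hnW : ∀ᵐ r ∂(volume.restrict (Ioo 0 R)), 0 ≤ max (-V r) 0 :=
    Eventually.of_forall fun r => le_max_right _ _
  have hnm : AEStronglyMeasurable (fun r => max (-V r) 0) (volume.restrict (Ioo 0 R)) :=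
    hVm.neg.sup aestronglyMeasurable_const
  have hnd : ∀ k, IntegrableOn (fun r => max (-V r) 0 * (g k r - f r) ^ 2) (Ioo 0 R) := fun k =>
    (hC _ (hdm k) (hds k)).1.congr_fun (fun r hr => by
      simp only [hdiff k r ⟨hr.1, hr.2.le⟩, neg_sq]) measurableSet_Ioo
  have hnlim : Tendsto (fun k => ∫ r in Ioo 0 R, max (-V r) 0 * (g k r - f r) ^ 2) atTop (𝓝 0) := by
    refine squeeze_zero (fun k => setIntegral_nonneg measurableSet_Ioo fun r _ => by positivity)
      (fun k => ?_) (by simpa using hφ.const_mul C)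
    refine le_trans (le_of_eq ?_) (hC _ (hdm k) (hds k)).2
    refine setIntegral_congr_fun measurableSet_Ioo fun r hr => ?_
    simp only [hdiff k r ⟨hr.1, hr.2.le⟩, neg_sq]
  have hnf : IntegrableOn (fun r => max (-V r) 0 * f r ^ 2) (Ioo 0 R) := by
    have h1 := integrable_weighted_sq_add (x := g 0) (y := fun r => -(g 0 r - f r)) hnW
      (hnm.mul ((hg 0).meas_fun.mul ((hg 0).meas_fun.sub hfm).neg)) ((hg 0).neg_integrable hVm)
      (by simpa only [neg_sq, IntegrableOn] using hnd 0)
    exact h1.congr (Eventually.of_forall fun r => by simp only; ring)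
  have hB := tendsto_integral_weighted_sq hnW
    (fun k => hnm.mul (hfm.mul ((hg k).meas_fun.sub hfm))) hnf hnd hnlim
  have hP : Tendsto (fun k => kin N R (γ k)) atTop (𝓝 (kin N R φ)) :=
    tendsto_integral_weighted_sq ((ae_pow_pos N le_rfl R).mono fun _ h => h.le)
      (fun k => (by fun_prop : Continuous fun r : ℝ => r ^ N).aestronglyMeasurable.mul
        (hφm.mul (hdm k))) hφs hds hφ
  have hQ : Tendsto (fun k => formB N V R (g k) (γ k) (g k) (γ k)) atTop (𝓝 e) := by
    refine tendsto_of_tendsto_of_tendsto_of_le_of_le tendsto_const_nhds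
      (by simpa using h0.const_add e) (fun k => hlow _ _ (hg k) (hg1 k)) fun k => (hgq k).le
  -- The limit of the positive potential energies is found by difference, from the limits of the
  -- form, of the kinetic energy and of the negative part; Fatou's lemma then bounds that of `f`.
  have hA : Tendsto (fun k => ∫ r in Ioo 0 R, max (V r) 0 * g k r ^ 2) atTop
      (𝓝 (e - kin N R φ + ∫ r in Ioo 0 R, max (-V r) 0 * f r ^ 2)) := by
    refine ((hQ.sub hP).add hB).congr fun k => ?_
    rw [(hg k).formB_self_eq hVm]
    ring
  have hA0 : 0 ≤ e - kin N R φ + ∫ r in Ioo 0 R, max (-V r) 0 * f r ^ 2 :=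
    ge_of_tendsto' hA fun k => setIntegral_nonneg measurableSet_Ioo fun r _ => by positivity
  have hpm : AEStronglyMeasurable (fun r => max (V r) 0) (volume.restrict (Ioo 0 R)) :=
    hVm.sup aestronglyMeasurable_const
  have hfatou : ∫⁻ r in Ioo 0 R, ENNReal.ofReal (max (V r) 0 * f r ^ 2)
      ≤ ENNReal.ofReal (e - kin N R φ + ∫ r in Ioo 0 R, max (-V r) 0 * f r ^ 2) := by
    have h1 : ∫⁻ r in Ioo 0 R, ENNReal.ofReal (max (V r) 0 * f r ^ 2) =
        ∫⁻ r in Ioo 0 R, liminf (fun k => ENNReal.ofReal (max (V r) 0 * g k r ^ 2)) atTop := by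
      refine setLIntegral_congr_fun measurableSet_Ioo fun r hr => ?_
      refine (Tendsto.liminf_eq ?_).symm
      exact ENNReal.tendsto_ofReal (((hptw r ⟨hr.1, hr.2.le⟩).pow 2).const_mul _)
    rw [h1]
    refine (lintegral_liminf_le' fun k => ?_).trans ?_
    · exact (hpm.mul ((hg k).meas_fun.pow 2)).aemeasurable.ennreal_ofReal
    · refine le_of_eq (Tendsto.liminf_eq ?_)
      refine (ENNReal.tendsto_ofReal hA).congr fun k => ?_
      exact ofReal_integral_eq_lintegral_ofReal ((hg k).pos_integrable hVm)
        (Eventually.of_forall fun r => by positivity)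
  have hpf : IntegrableOn (fun r => max (V r) 0 * f r ^ 2) (Ioo 0 R) := by
    refine ⟨hpm.mul (hfm.pow 2), ?_⟩
    rw [hasFiniteIntegral_iff_ofReal (Eventually.of_forall fun r => by positivity)]
    exact hfatou.trans_lt ENNReal.ofReal_lt_top
  have hfe : FiniteEnergy N V R f φ := FiniteEnergy.of_primitive hφm hφs
    (integrable_pot_of_pos_neg hpf hnf)
  have hf1 : f R = 1 := by simp [hf]
  have hfq : formB N V R f φ f φ ≤ e := by
    rw [← ofReal_integral_eq_lintegral_ofReal hpf (Eventually.of_forall fun r => by positivity),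
      ENNReal.ofReal_le_ofReal_iff hA0] at hfatou
    rw [hfe.formB_self_eq hVm]
    linarith
  refine ⟨f, φ, hfe, hf1, fun h η hh hh0 => ?_⟩
  -- Minimality of `f` along `f + t h`. A quadratic polynomial in `t` that is nonnegative and has no
  -- constant term has no linear term either.
  have key : ∀ t : ℝ, 0 ≤ formB N V R h η h η * (t * t) + (2 * formB N V R f φ h η) * t + 0 := by
    intro t
    have h1 := hlow _ _ (hfe.comb hVm hh 1 t) (by rw [hf1, hh0]; ring)
    rw [formB_comb_self hVm hfe hh] at h1
    linarith
  have := discrim_le_zero key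
  rw [discrim] at this
  nlinarith [sq_nonneg (formB N V R f φ h η)]

/-! ### Coercivity on every interval -/

theorem FiniteEnergy.eq_zero_of_kin {N : ℕ} {V : ℝ → ℝ} {R : ℝ} {g γ : ℝ → ℝ}
    (hg : FiniteEnergy N V R g γ) (h0 : g R = 0) (hk : kin N R γ = 0) :
    ∀ r ∈ Ioc 0 R, g r = 0 := by
  intro r hr
  have := sq_intervalIntegral_le_kin hr.1 hr.2 hg.meas hg.sq
  rw [hk, mul_zero] at this
  rw [hg.prim r hr, h0, zero_sub, neg_eq_zero]
  exact pow_eq_zero_iff two_ne_zero |>.1 (le_antisymm this (sq_nonneg _))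

theorem Coercive.eq_zero {N : ℕ} {V : ℝ → ℝ} {R : ℝ} {g γ : ℝ → ℝ} (hc : Coercive N V R)
    (hg : FiniteEnergy N V R g γ) (h0 : g R = 0) (hq : formB N V R g γ g γ ≤ 0) :
    ∀ r ∈ Ioc 0 R, g r = 0 := by
  obtain ⟨c, hc0, hc⟩ := hc
  refine hg.eq_zero_of_kin h0 ?_
  have h1 := hc g γ hg h0
  have h2 := kin_nonneg N R γ
  by_contra hne
  have : 0 < kin N R γ := lt_of_le_of_ne h2 (Ne.symm hne)
  nlinarith

/-- On a short interval the negative potential energy absorbs at most half of the kinetic energy. -/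
theorem RadialPotential.coercive_small {N : ℕ} {V : ℝ → ℝ} (H : RadialPotential N V) :
    ∃ s : ℝ, 0 < s ∧ ∀ R, 0 < R → R ≤ s → Coercive N V R := by
  obtain ⟨s, hs, h⟩ := H.neg_small
  refine ⟨s, hs, fun R hR hRs => ⟨1 / 2, by norm_num, fun g γ hg h0 => ?_⟩⟩
  have h1 := h R hR hRs γ hg.meas hg.sq
  have h2 : ∫ r in Ioo 0 R, max (-V r) 0 * (∫ s in r..R, γ s) ^ 2
      = ∫ r in Ioo 0 R, max (-V r) 0 * g r ^ 2 := by
    refine setIntegral_congr_fun measurableSet_Ioo fun r hr => ?_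
    simp only [hg.prim r ⟨hr.1, hr.2.le⟩, h0, zero_sub, neg_sq]
  have h3 : 0 ≤ ∫ r in Ioo 0 R, max (V r) 0 * g r ^ 2 :=
    setIntegral_nonneg measurableSet_Ioo fun r _ => by positivity
  rw [hg.formB_self_eq (H.meas_Ioo R)]
  linarith

/-- The difference `g - g(R) f` vanishes at `R`, so the weak equation makes it orthogonal to `f` for
the form, and the cross term drops out. -/
theorem IsWeakSol.form_split {N : ℕ} {V : ℝ → ℝ} (H : RadialPotential N V) {R : ℝ}
    {f φ g γ : ℝ → ℝ} (hf : IsWeakSol N V R f φ) (hg : FiniteEnergy N V R g γ) :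
    formB N V R g γ g γ = g R ^ 2 * formB N V R f φ f φ +
      formB N V R (fun r => 1 * g r + -g R * f r) (fun r => 1 * γ r + -g R * φ r)
        (fun r => 1 * g r + -g R * f r) (fun r => 1 * γ r + -g R * φ r) := by
  have hV := H.meas_Ioo R
  have hw := hf.weak _ _ (hg.comb hV hf.fe 1 (-g R)) (by simp only [hf.one]; ring)
  rw [formB_comb_right hV hf.fe hg hf.fe] at hw
  rw [formB_comb_self hV hg hf.fe, formB_comm N V R g γ f φ]
  linear_combination (2 * g R) * hw

/-- Inside `R` write `g = g(R) f + w` with `w(R) = 0`. The form controls `w`, and the loss from `f`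
is at most `κ g(R)²`. Outside, `g` vanishes at `R'`, so `g² ≤ δ X` there, with `X` the outer kinetic
energy. When `δ (κ + M) ≤ 1/2`, half of `X` pays for both the loss at `R` and the outer potential.
-/
theorem RadialPotential.coercive_step {N : ℕ} {V : ℝ → ℝ} (H : RadialPotential N V)
    {R R' κ M : ℝ} (hR : 0 < R) (hRR : R ≤ R') (hc : Coercive N V R)
    (hκ0 : 0 ≤ κ) (hκ : ∀ g γ, FiniteEnergy N V R g γ → -κ * g R ^ 2 ≤ formB N V R g γ g γ)
    (hM : ∫ r in Ioo R R', |V r| ≤ M)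
    (hδ : (∫ r in Ioo R R', (r ^ N)⁻¹) * (κ + M) ≤ 1 / 2) : Coercive N V R' := by
  obtain ⟨f, φ, hf⟩ := H.exists_weakSol hR hc
  obtain ⟨c, hc0, hc⟩ := hc
  set δ := ∫ r in Ioo R R', (r ^ N)⁻¹ with hδdef
  have hδ0 : 0 ≤ δ := setIntegral_inv_pow_nonneg N hR.le R'
  set F := kin N R φ
  have hF : 0 ≤ F := kin_nonneg N R φ
  have hd : 0 < 1 + 2 * δ * F := by positivity
  -- The form is at least `X/2 + c W`, with `W` the kinetic energy of `w`, and the kinetic energy of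
  -- `g` is at most `2 W + (1 + 2 δ F) X`; the constant compares the coefficients.
  refine ⟨min (c / 2) (1 / (2 * (1 + 2 * δ * F))), lt_min (by positivity) (by positivity),
    fun g γ hg h0 => ?_⟩
  have hR' : 0 < R' := hR.trans_le hRR
  have hV := H.meas_Ioo R
  have hgR := hg.restrict hR hRR
  set X := ∫ r in Ioo R R', r ^ N * γ r ^ 2 with hX
  have hX0 : 0 ≤ X := setIntegral_nonneg measurableSet_Ioo fun r hr => by
    have : 0 < r := hR.trans hr.1
    positivity
  have hpt : ∀ r, R ≤ r → r ≤ R' → g r ^ 2 ≤ δ * X := by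
    intro r hr hr'
    have h1 := sq_intervalIntegral_le (hR.trans_le hr) hr' le_rfl hg.meas hg.sq
    rw [hg.prim r ⟨hR.trans_le hr, hr'⟩, h0, zero_sub, neg_sq]
    refine h1.trans (mul_le_mul ?_ ?_ ?_ hδ0)
    · refine setIntegral_mono_set (integrableOn_inv_pow N hR R') ?_
        (Ioo_subset_Ioo_left hr).eventuallyLE
      filter_upwards [ae_pow_pos N hR.le R'] with s hs using (inv_pos.2 hs).le
    · refine setIntegral_mono_set (hg.sq.mono_set (Ioo_subset_Ioo_left hR.le)) ?_
        (Ioo_subset_Ioo_left hr).eventuallyLE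
      filter_upwards [ae_pow_pos N hR.le R'] with s hs using mul_nonneg hs.le (sq_nonneg _)
    · exact setIntegral_nonneg measurableSet_Ioo fun s hs => by
        have : 0 < s := (hR.trans_le hr).trans hs.1
        positivity
  have hsplit : formB N V R' g γ g γ = formB N V R g γ g γ +
      ∫ r in Ioo R R', (r ^ N * (γ r * γ r) + V r * (g r * g r)) :=
    setIntegral_Ioo_split hR.le hRR (hg.form_integrable (H.meas_Ioo R') hg)
  have hout : X - δ * X * M ≤ ∫ r in Ioo R R', (r ^ N * (γ r * γ r) + V r * (g r * g r)) := by
    have h1 : ∫ r in Ioo R R', (r ^ N * γ r ^ 2 - δ * X * |V r|)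
        ≤ ∫ r in Ioo R R', (r ^ N * (γ r * γ r) + V r * (g r * g r)) := by
      refine setIntegral_mono_on ?_ ((hg.form_integrable (H.meas_Ioo R') hg).mono_set
        (Ioo_subset_Ioo_left hR.le)) measurableSet_Ioo fun r hr => ?_
      · exact (hg.sq.mono_set (Ioo_subset_Ioo_left hR.le)).sub ((H.int R R' hR).abs.const_mul _)
      · have h2 := hpt r hr.1.le hr.2.le
        have h3 := neg_abs_le (V r)
        have h4 := mul_le_mul_of_nonneg_left h2 (abs_nonneg (V r))
        have h5 := mul_le_mul_of_nonneg_right h3 (sq_nonneg (g r))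
        nlinarith
    rw [integral_sub (hg.sq.mono_set (Ioo_subset_Ioo_left hR.le))
      ((H.int R R' hR).abs.const_mul _), integral_const_mul] at h1
    have h2 := mul_le_mul_of_nonneg_left hM (mul_nonneg hδ0 hX0)
    linarith
  have hin := hf.form_split H hgR
  have hff := hκ f φ hf.fe
  rw [hf.one] at hff
  have hww := hc _ _ (hgR.comb hV hf.fe 1 (-g R)) (by simp only [hf.one]; ring)
  set W := kin N R (fun r => 1 * γ r + -g R * φ r) with hW
  have hW0 : 0 ≤ W := kin_nonneg _ _ _
  have hkin : kin N R' γ = kin N R γ + X := setIntegral_Ioo_split hR.le hRR hg.sq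
  have hkR : kin N R γ ≤ 2 * W + 2 * g R ^ 2 * F := by
    have h1 := kin_comb_le (N := N) (R := R) (γ := fun r => 1 * γ r + -g R * φ r) (η := φ)
      ((hgR.comb hV hf.fe 1 (-g R)).kin_integrable hf.fe).aestronglyMeasurable
      (hgR.comb hV hf.fe 1 (-g R)).sq hf.fe.sq 1 (g R)
    have h2 : (fun r => 1 * (1 * γ r + -g R * φ r) + g R * φ r) = γ := by funext r; ring
    rw [h2] at h1
    linarith
  have hgR2 := hpt R le_rfl hRR
  have hκf : -(κ * (g R ^ 2)) ≤ g R ^ 2 * formB N V R f φ f φ := by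
    have := mul_le_mul_of_nonneg_left hff (sq_nonneg (g R))
    linarith
  have e1 : κ * g R ^ 2 ≤ κ * (δ * X) := mul_le_mul_of_nonneg_left hgR2 hκ0
  have e2 : δ * (κ + M) * X ≤ 1 / 2 * X := mul_le_mul_of_nonneg_right hδ hX0
  have e3 : X / 2 + c * W ≤ formB N V R' g γ g γ := by
    rw [hsplit, hin]; nlinarith
  have e4 : kin N R' γ ≤ 2 * W + (1 + 2 * δ * F) * X := by
    rw [hkin]
    nlinarith
  refine le_trans ?_ e3
  have m1 := min_le_left (c / 2) (1 / (2 * (1 + 2 * δ * F)))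
  have m2 := min_le_right (c / 2) (1 / (2 * (1 + 2 * δ * F)))
  set m := min (c / 2) (1 / (2 * (1 + 2 * δ * F)))
  have m0 : 0 ≤ m := (lt_min (by positivity) (by positivity)).le
  calc m * kin N R' γ ≤ m * (2 * W + (1 + 2 * δ * F) * X) := mul_le_mul_of_nonneg_left e4 m0
    _ = (2 * W) * m + ((1 + 2 * δ * F) * X) * m := by ring
    _ ≤ (2 * W) * (c / 2) + ((1 + 2 * δ * F) * X) * (1 / (2 * (1 + 2 * δ * F))) :=
      add_le_add (mul_le_mul_of_nonneg_left m1 (by positivity))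
        (mul_le_mul_of_nonneg_left m2 (by positivity))
    _ = X / 2 + c * W := by field_simp; ring

/-- The form is nonnegative on the longer interval ending at `L + 1`, so the lower bound `-κ g(R)²`
holds with one `κ` for all `R` between `s` and `L`. Hence one step length serves throughout, and
finitely many steps lead from `s` to `L`. -/
theorem RadialPotential.coercive {N : ℕ} {V : ℝ → ℝ} (H : RadialPotential N V)
    {L : ℝ} (hL : 0 < L) : Coercive N V L := by
  obtain ⟨s, hs, hsmall⟩ := H.coercive_small
  rcases le_total L s with h | hsL
  · exact hsmall L hL h
  set M := ∫ r in Ioo s (L + 1), |V r| with hM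
  have hM0 : 0 ≤ M := setIntegral_nonneg measurableSet_Ioo fun r _ => abs_nonneg _
  set J := ∫ r in Ioo L (L + 1), (r ^ N)⁻¹ with hJ
  have hJ0 : 0 < J := setIntegral_inv_pow_pos N hL (lt_add_one L)
  have hMle : ∀ a b, s ≤ a → b ≤ L + 1 → ∫ r in Ioo a b, |V r| ≤ M := fun a b ha hb =>
    setIntegral_mono_set (H.int s (L + 1) hs).abs (Eventually.of_forall fun r => abs_nonneg _)
      (Ioo_subset_Ioo ha hb).eventuallyLE
  have hκ : ∀ R, s ≤ R → R ≤ L → ∀ g γ, FiniteEnergy N V R g γ →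
      -(J⁻¹ + M) * g R ^ 2 ≤ formB N V R g γ g γ := by
    intro R hR hRL g γ hg
    have hR0 := hs.trans_le hR
    refine le_trans ?_ (H.form_lower_bound hR0 (show R < L + 1 by linarith) hg)
    have h1 : (∫ r in Ioo R (L + 1), (r ^ N)⁻¹)⁻¹ ≤ J⁻¹ := by
      refine inv_anti₀ hJ0 (setIntegral_mono_set (integrableOn_inv_pow N hR0 _) ?_
        (Ioo_subset_Ioo_left hRL).eventuallyLE)
      filter_upwards [ae_pow_pos N hR0.le (L + 1)] with r hr using (inv_pos.2 hr).le
    have h2 := hMle R (L + 1) hR le_rfl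
    have h3 := mul_le_mul_of_nonneg_right (add_le_add h1 h2) (sq_nonneg (g R))
    linarith
  -- On `[s, L]` the weight `r^(-N)` is at most `s^(-N)`, so a step of length `η` satisfies the
  -- smallness condition of `coercive_step` with `κ = J⁻¹ + M`.
  set η := s ^ N / (2 * (J⁻¹ + M + M)) with hη
  have hη0 : 0 < η := by positivity
  have hstep : ∀ R R', s ≤ R → R ≤ R' → R' ≤ L → R' ≤ R + η → Coercive N V R → Coercive N V R' := by
    intro R R' hR hRR hRL hRη hc
    have hR0 := hs.trans_le hR
    refine H.coercive_step hR0 hRR hc (by positivity) (hκ R hR (hRR.trans hRL))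
      (hMle R R' hR (by linarith)) ?_
    have h1 : ∫ r in Ioo R R', (r ^ N)⁻¹ ≤ ∫ _ in Ioo R R', (s ^ N)⁻¹ := by
      refine setIntegral_mono_on (integrableOn_inv_pow N hR0 _) (by simp) measurableSet_Ioo
        fun r hr => ?_
      exact inv_anti₀ (by positivity) (pow_le_pow_left₀ hs.le (hR.trans hr.1.le) _)
    rw [setIntegral_const, Real.volume_real_Ioo_of_le hRR, smul_eq_mul] at h1
    have h2 : (R' - R) * (s ^ N)⁻¹ ≤ η * (s ^ N)⁻¹ :=
      mul_le_mul_of_nonneg_right (by linarith) (by positivity)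
    have h3 : η * (s ^ N)⁻¹ * (J⁻¹ + M + M) = 1 / 2 := by
      rw [hη]; field_simp
    rw [← h3]
    exact mul_le_mul_of_nonneg_right (h1.trans h2) (by positivity)
  have hind : ∀ k : ℕ, Coercive N V (min (s + k * η) L) := by
    intro k
    induction k with
    | zero => simpa [hsL] using hsmall s hs le_rfl
    | succ k ih =>
      refine hstep _ _ (le_min (by nlinarith [hη0.le, (Nat.cast_nonneg k : (0 : ℝ) ≤ k)]) hsL) ?_
        (min_le_right _ _) ?_ ih
      · refine min_le_min_right _ ?_
        push_cast; linarith
      · rw [← min_add_add_right]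
        refine le_min ((min_le_left _ _).trans (by push_cast; linarith))
          ((min_le_right _ _).trans (by linarith))
  obtain ⟨k, hk⟩ := exists_nat_gt (L / η)
  have := hind k
  rwa [min_eq_right] at this
  rw [div_lt_iff₀ hη0] at hk
  linarith

/-! ### Qualitative properties of the weak solution -/

namespace IsWeakSol

variable {N : ℕ} {V : ℝ → ℝ} {R : ℝ} {f φ : ℝ → ℝ}

/-- Testing the equation with `f` cut off at its zero `d` shows that the form of `f` on `(0, d)` is
zero; coercivity on `(0, d)` does the rest. -/
theorem eq_zero_of_zero (hf : IsWeakSol N V R f φ) (H : RadialPotential N V) {d : ℝ}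
    (hd : d ∈ Ioc 0 R) (h0 : f d = 0) : ∀ r ∈ Ioc 0 d, f r = 0 := by
  have hfd := hf.fe.restrict hd.1 hd.2
  refine (H.coercive hd.1).eq_zero hfd h0 (le_of_eq ?_)
  rw [← formB_extend_zero H hd.1 hd.2 hf.fe hfd h0]
  refine hf.weak _ _ (hfd.extend_zero H.int hd.1 hd.2) ?_
  rw [glue_of_ge _ _ hd.2]
  simp [h0]

/-- A negative value at `b` forces a zero between `b` and `R`, since `f(R) = 1`; but then `f`
vanishes to the left of that zero, in particular at `b`. -/
theorem nonneg (hf : IsWeakSol N V R f φ) (H : RadialPotential N V) :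
    ∀ r ∈ Ioc 0 R, 0 ≤ f r := by
  intro b hb
  by_contra hneg
  rw [not_le] at hneg
  have hc : ContinuousOn f (Icc b R) :=
    hf.fe.continuousOn.mono fun x hx => ⟨hb.1.trans_le hx.1, hx.2⟩
  obtain ⟨d, hd, hd0⟩ := intermediate_value_Icc hb.2 hc (show (0 : ℝ) ∈ Icc (f b) (f R) from
    ⟨hneg.le, by rw [hf.one]; exact zero_le_one⟩)
  have := hf.eq_zero_of_zero H ⟨hb.1.trans_le hd.1, hd.2⟩ hd0 b ⟨hb.1, hd.1⟩
  exact hneg.ne this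

/-- The difference `f' - f'(R) f` vanishes at `R` and is orthogonal to both solutions, hence to
itself, so coercivity annihilates it. This is the source of the independence of `a` from `R`. -/
theorem scaling (hf : IsWeakSol N V R f φ) (H : RadialPotential N V) (hR : 0 < R) {R' : ℝ}
    {f' φ' : ℝ → ℝ} (hf' : IsWeakSol N V R' f' φ') (hRR : R ≤ R') :
    ∀ r ∈ Ioc 0 R, f' r = f' R * f r := by
  have hV := H.meas_Ioo R
  have hr := hf'.fe.restrict hR hRR
  have hw := hr.comb hV hf.fe 1 (-f' R)
  have h0 : (fun r => 1 * f' r + -f' R * f r) R = 0 := by simp only [hf.one]; ring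
  have h1 := hf.weak _ _ hw h0
  have h2 := formB_extend_zero H hR hRR hf'.fe hw h0
  have h3 := hf'.weak _ _ (hw.extend_zero H.int hR hRR) (by
    rw [glue_of_ge _ _ hRR]
    simp [hf.one])
  have h4 : formB N V R (fun r => 1 * f' r + -f' R * f r) (fun r => 1 * φ' r + -f' R * φ r)
      (fun r => 1 * f' r + -f' R * f r) (fun r => 1 * φ' r + -f' R * φ r) = 0 := by
    rw [formB_comb_right hV hw hr hf.fe 1 (-f' R), formB_comm N V R _ _ f',
      formB_comm N V R _ _ f, h1, ← h2, h3]
    ring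
  intro r hr'
  have := (H.coercive hR).eq_zero hw h0 h4.le r hr'
  linarith

/-- Compare `f` with the function that is zero up to `a` and rises harmonically to `1` at `R`. The
two agree at `R`, so the form pairs `f` with them equally. The second pairing involves only the
region where `V = 0`, and there it is `(f(R) - f(a)) / I`. -/
theorem outside (hf : IsWeakSol N V R f φ) (H : RadialPotential N V) {R₀ : ℝ}
    (hV0 : ∀ r, R₀ < r → V r = 0) {a : ℝ} (ha0 : 0 < a) (ha : R₀ < a) (haR : a < R) :
    f a = 1 - formB N V R f φ f φ * ∫ s in Ioo a R, (s ^ N)⁻¹ := by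
  set I := ∫ s in Ioo a R, (s ^ N)⁻¹ with hI
  have hIpos : 0 < I := setIntegral_inv_pow_pos N ha0 haR
  have hG := (FiniteEnergy.zero N V a).glue (η := fun r => I⁻¹ * (r ^ N)⁻¹) H.int ha0 haR.le
    ((integrableOn_inv_pow N ha0 R).aestronglyMeasurable.const_mul _)
    (pow_mul_sq_const_inv_integrableOn N ha0 R _)
  have hend : glue a (fun _ => 0) (fun r => I⁻¹ * (r ^ N)⁻¹) R = 1 := by
    rw [glue_of_ge _ _ haR.le, intervalIntegral.integral_const_mul,
      intervalIntegral_inv_pow N haR.le, ← hI]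
    field_simp
    ring
  have hw := hf.weak _ _ (hf.fe.comb (H.meas_Ioo R) hG 1 (-1)) (by
    simp only [hf.one, hend]; ring)
  rw [formB_comb_right (H.meas_Ioo R) hf.fe hf.fe hG, formB_glue (H.meas_Ioo R) ha0.le haR.le
    hf.fe hG] at hw
  have e1 : formB N V a f φ (fun _ => 0) (fun _ => 0) = 0 := by simp [formB]
  have e2 : ∫ r in Ioo a R, (r ^ N * (φ r * (I⁻¹ * (r ^ N)⁻¹)) + V r * (f r * ((0 : ℝ) +
      ∫ s in a..r, I⁻¹ * (s ^ N)⁻¹))) = I⁻¹ * (f R - f a) := by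
    rw [hf.fe.sub_eq ⟨ha0, haR.le⟩ ⟨ha0.trans haR, le_rfl⟩, intervalIntegral_eq_Ioo haR.le,
      ← integral_const_mul]
    refine setIntegral_congr_fun measurableSet_Ioo fun r hr => ?_
    have : 0 < r ^ N := pow_pos (ha0.trans hr.1) _
    simp only [hV0 r (ha.trans hr.1), zero_mul, add_zero]
    field_simp
  rw [e1, e2, hf.one] at hw
  have : formB N V R f φ f φ * I = 1 - f a := by
    have h1 : formB N V R f φ f φ = I⁻¹ * (1 - f a) := by linarith
    rw [h1]; field_simp
  linarith

theorem energy_lower_bound (hf : IsWeakSol N V R f φ) (H : RadialPotential N V) {R₀ : ℝ}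
    (hV0 : ∀ r, R₀ < r → V r = 0) (hR : 0 < R) (hR₀ : R₀ ≤ R) {ρ : ℝ} (hρ : R < ρ) :
    -(∫ s in Ioo R ρ, (s ^ N)⁻¹)⁻¹ ≤ formB N V R f φ f φ := by
  have h := H.form_lower_bound hR hρ hf.fe
  have h0 : ∫ s in Ioo R ρ, |V s| = 0 := by
    rw [setIntegral_congr_fun measurableSet_Ioo (g := fun _ => (0 : ℝ)) fun r hr => ?_]
    · simp
    · simp [hV0 r (hR₀.trans_lt hr.1)]
  rw [h0, hf.one] at h
  linarith

end IsWeakSol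

/-! ### Harmonic profiles and the scattering length -/

/-- The nonconstant radial harmonic function on `ℝⁿ`, with derivative `r^{1-n}`. -/
noncomputable def radialHarmonic (n : ℕ) (r : ℝ) : ℝ :=
  if n = 1 then r else if n = 2 then Real.log r else -(r ^ (2 - (n : ℤ)) / ((n : ℝ) - 2))

theorem setIntegral_inv_pow_eq {n : ℕ} (hn : 1 ≤ n) {a b : ℝ} (ha : 0 < a) (hab : a ≤ b) :
    ∫ s in Ioo a b, (s ^ (n - 1))⁻¹ = radialHarmonic n b - radialHarmonic n a := by
  rw [← intervalIntegral_inv_pow _ hab]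
  unfold radialHarmonic
  have hb : 0 < b := ha.trans_le hab
  have h0 : (0 : ℝ) ∉ uIcc a b := by
    rw [uIcc_of_le hab]; exact fun h => absurd h.1 (not_le.2 ha)
  rcases eq_or_ne n 1 with rfl | h1
  · simp
  rcases eq_or_ne n 2 with rfl | h2
  · simp [integral_inv h0, Real.log_div hb.ne' ha.ne']
  rw [if_neg h1, if_neg h2, if_neg h1, if_neg h2]
  have h3 : 3 ≤ n := by omega
  have e : ∀ s : ℝ, (s ^ (n - 1))⁻¹ = s ^ (1 - (n : ℤ)) := fun s => by
    rw [← zpow_natCast, ← zpow_neg]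
    congr 1
    push_cast [hn]
    ring
  simp_rw [e]
  have hn2 : (n : ℝ) - 2 ≠ 0 := by
    have : (3 : ℝ) ≤ n := by exact_mod_cast h3
    linarith
  rw [integral_zpow (Or.inr ⟨by omega, h0⟩)]
  have e2 : (1 - (n : ℤ) + 1) = 2 - n := by ring
  have e3 : (((1 - (n : ℤ)) : ℤ) : ℝ) + 1 = -((n : ℝ) - 2) := by push_cast; ring
  rw [e2, e3, div_neg]
  field_simp
  ring

/-- The scattering length of the harmonic profile `A + B h(r)`. -/
noncomputable def lengthOf (n : ℕ) (A B : ℝ) : EReal :=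
  if n = 1 then if B = 0 then ⊥ else ((-A / B : ℝ) : EReal)
  else if n = 2 then if B = 0 then 0 else ((Real.exp (-A / B) : ℝ) : EReal)
  else if A = 0 then ⊥ else ((B / (((n : ℝ) - 2) * A) : ℝ) : EReal)

/-- Proportional profiles have the same scattering length; with `IsWeakSol.scaling` this removes the
dependence on `R`. -/
theorem lengthOf_smul (n : ℕ) {t : ℝ} (ht : t ≠ 0) (A B : ℝ) :
    lengthOf n (t * A) (t * B) = lengthOf n A B := by
  unfold lengthOf
  have e1 : -(t * A) / (t * B) = -A / B := by
    rw [← mul_neg, mul_div_mul_left _ _ ht]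
  have e2 : t * B / (((n : ℝ) - 2) * (t * A)) = B / (((n : ℝ) - 2) * A) := by
    rw [mul_left_comm, mul_div_mul_left _ _ ht]
  rw [e1, e2]
  simp [ht]

theorem coe_exp_ne_zero (x : ℝ) : ((Real.exp x : ℝ) : EReal) ≠ 0 := by
  have := Real.exp_ne_zero x
  exact_mod_cast this

/-- For `n ≤ 2` the profile changes sign at `a` and `B ≥ 0` makes it increasing, so nonnegativity
beyond `R₀` keeps `a` at or below `R₀`. For `n ≥ 3` the profile is `A (1 - a r^(2-n))`, and `A ≥ 0`
fixes the direction of the inequality. -/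
theorem scatteringRange_lengthOf {n : ℕ} {A B R₀ R : ℝ} (hn : 1 ≤ n) (hR₀ : 0 ≤ R₀) (hR : R₀ < R)
    (hB : n ≤ 2 → 0 ≤ B) (hA : 3 ≤ n → 0 ≤ A)
    (hpos : ∀ r ∈ Ioo R₀ R, 0 ≤ A + B * radialHarmonic n r) :
    ScatteringRange n R₀ (lengthOf n A B) := by
  -- The sign of the profile is known only for `r > R₀`; the bound at `R₀` itself comes from letting
  -- `r` decrease to `R₀`.
  have hle : ∀ x : ℝ, (∀ r ∈ Ioo R₀ R, x ≤ r) → x ≤ R₀ := by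
    intro x hx
    refine le_of_forall_gt_imp_ge_of_dense fun y hy => ?_
    have h1 : R₀ < min y ((R₀ + R) / 2) := lt_min hy (by linarith)
    exact (hx _ ⟨h1, (min_le_right _ _).trans_lt (by linarith)⟩).trans (min_le_left _ _)
  unfold ScatteringRange lengthOf
  unfold radialHarmonic at hpos
  rcases eq_or_ne n 1 with rfl | h1
  · simp only [if_true]
    split_ifs with h
    · exact bot_le
    · have hB' : 0 < B := lt_of_le_of_ne (hB (by norm_num)) (Ne.symm h)
      simp only [if_true] at hpos
      refine EReal.coe_le_coe_iff.2 (hle _ fun r hr => ?_)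
      rw [div_le_iff₀ hB']
      have := hpos r hr
      linarith
  rcases eq_or_ne n 2 with rfl | h2
  · simp only [OfNat.ofNat_ne_one, if_true, if_false]
    split_ifs with h
    · exact ⟨le_rfl, by exact_mod_cast hR₀⟩
    · have hB' : 0 < B := lt_of_le_of_ne (hB le_rfl) (Ne.symm h)
      simp only [OfNat.ofNat_ne_one, if_true, if_false] at hpos
      refine ⟨by exact_mod_cast (Real.exp_pos _).le,
        EReal.coe_le_coe_iff.2 (hle _ fun r hr => ?_)⟩
      rw [← Real.le_log_iff_exp_le (hR₀.trans_lt hr.1), div_le_iff₀ hB']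
      have := hpos r hr
      linarith
  · simp only [if_neg h1, if_neg h2] at hpos ⊢
    split_ifs with h
    · exact bot_le
    · have hn3 : 3 ≤ n := by omega
      have hA' : 0 < A := lt_of_le_of_ne (hA hn3) (Ne.symm h)
      have hn2 : 0 < (n : ℝ) - 2 := by
        have : (3 : ℝ) ≤ n := by exact_mod_cast hn3
        linarith
      refine EReal.coe_le_coe_iff.2 ?_
      have hr : ∀ r ∈ Ioo R₀ R, B / (((n : ℝ) - 2) * A) ≤ r ^ (n - 2) := by
        intro r hr
        have hr0 : 0 < r := hR₀.trans_lt hr.1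
        have h3 := hpos r hr
        have e : r ^ (2 - (n : ℤ)) = (r ^ (n - 2))⁻¹ := by
          rw [← zpow_natCast, ← zpow_neg]
          congr 1
          push_cast [show 2 ≤ n by omega]
          ring
        have hp : 0 < r ^ (n - 2) := by positivity
        rw [e] at h3
        rw [div_le_iff₀ (by positivity)]
        have h4 := mul_nonneg h3 (mul_pos hp hn2).le
        have h5 : (A + B * -((r ^ (n - 2))⁻¹ / ((n : ℝ) - 2))) * (r ^ (n - 2) * ((n : ℝ) - 2))
          = r ^ (n - 2) * (((n : ℝ) - 2) * A) - B := by field_simp; ring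
        linarith
      have hlim : Tendsto (fun r : ℝ => r ^ (n - 2)) (𝓝[>] R₀) (𝓝 (R₀ ^ (n - 2))) :=
        ((continuous_pow (n - 2)).tendsto R₀).mono_left nhdsWithin_le_nhds
      exact ge_of_tendsto hlim (by
        filter_upwards [Ioo_mem_nhdsGT hR] with r h using hr r h)

/-- The normalization at `R` turns the denominators `R - a`, `log (R/a)` and `1 - a R^(2-n)` into
`1/B`, `1/B` and `1/A`. The limiting cases are `B = 0` for `n ≤ 2` and `A = 0` for `n ≥ 3`. -/
theorem asympProfile_lengthOf {n : ℕ} {A B R r : ℝ} (hn : 1 ≤ n) (hr0 : 0 < r) (hR : 0 < R)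
    (h1 : A + B * radialHarmonic n R = 1) :
    A + B * radialHarmonic n r = asympProfile n (lengthOf n A B) R r := by
  unfold asympProfile lengthOf
  unfold radialHarmonic at h1 ⊢
  rcases eq_or_ne n 1 with rfl | hn1
  · simp only [if_true] at h1 ⊢
    by_cases h : B = 0
    · simp only [h, if_true]; simp only [h] at h1; linarith
    · rw [if_neg h, if_neg (EReal.coe_ne_bot _), EReal.toReal_coe]
      have e1 : r - -A / B = (A + B * r) / B := by field_simp; ring
      have e2 : R - -A / B = 1 / B := by rw [← h1]; field_simp; ring
      rw [e1, e2]; field_simp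
  rcases eq_or_ne n 2 with rfl | hn2
  · simp only [OfNat.ofNat_ne_one, if_true, if_false] at h1 ⊢
    by_cases h : B = 0
    · simp only [h, if_true]; simp only [h] at h1; linarith
    · rw [if_neg h, if_neg (coe_exp_ne_zero _), EReal.toReal_coe,
        Real.log_div hr0.ne' (Real.exp_ne_zero _), Real.log_div hR.ne' (Real.exp_ne_zero _),
        Real.log_exp]
      have e1 : Real.log r - -A / B = (A + B * Real.log r) / B := by field_simp; ring
      have e2 : Real.log R - -A / B = 1 / B := by rw [← h1]; field_simp; ring
      rw [e1, e2]; field_simp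
  · simp only [if_neg hn1, if_neg hn2] at h1 ⊢
    have hn3 : 0 < (n : ℝ) - 2 := by
      have : (3 : ℝ) ≤ n := by exact_mod_cast (show 3 ≤ n by omega)
      linarith
    have hz : R ^ (2 - (n : ℤ)) ≠ 0 := (zpow_pos hR _).ne'
    by_cases h : A = 0
    · simp only [h, if_true]
      rw [h] at h1
      have : B = -((n : ℝ) - 2) / R ^ (2 - (n : ℤ)) := by
        field_simp at h1 ⊢; linarith
      rw [this]
      field_simp
      ring
    · rw [if_neg h, if_neg (EReal.coe_ne_bot _), EReal.toReal_coe]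
      have e1 : 1 - B / (((n : ℝ) - 2) * A) * r ^ (2 - (n : ℤ))
        = (A + B * -(r ^ (2 - (n : ℤ)) / ((n : ℝ) - 2))) / A := by field_simp; ring
      have e2 : 1 - B / (((n : ℝ) - 2) * A) * R ^ (2 - (n : ℤ)) = 1 / A := by
        rw [show (1 : ℝ) / A = (A + B * -(R ^ (2 - (n : ℤ)) / ((n : ℝ) - 2))) / A by rw [h1]]
        field_simp
        ring
      rw [e1, e2]; field_simp

/-- The surface area of the unit sphere in `ℝⁿ`. -/
noncomputable def sphereArea (n : ℕ) : ℝ :=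
  2 * Real.pi ^ ((n : ℝ) / 2) / Real.Gamma ((n : ℝ) / 2)

theorem minEnergy_lengthOf {n : ℕ} {A B R μ : ℝ} (hn : 1 ≤ n) (hR : 0 < R)
    (h1 : A + B * radialHarmonic n R = 1) :
    minEnergy n μ (lengthOf n A B) R = μ * B * sphereArea n := by
  unfold minEnergy lengthOf sphereArea
  unfold radialHarmonic at h1
  rcases eq_or_ne n 1 with rfl | hn1
  · have hπ : Real.sqrt Real.pi ≠ 0 := (Real.sqrt_pos.2 Real.pi_pos).ne'
    simp only [if_true] at h1 ⊢
    have hs : 2 * Real.pi ^ (((1 : ℕ) : ℝ) / 2) / Real.Gamma (((1 : ℕ) : ℝ) / 2) = 2 := by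
      rw [Nat.cast_one, Real.Gamma_one_half_eq, ← Real.sqrt_eq_rpow]
      field_simp
    rw [hs]
    by_cases h : B = 0
    · simp only [h, if_true]; ring
    · rw [if_neg h, if_neg (EReal.coe_ne_bot _), EReal.toReal_coe]
      have e2 : R - -A / B = 1 / B := by rw [← h1]; field_simp; ring
      rw [e2]; field_simp
  rcases eq_or_ne n 2 with rfl | hn2
  · simp only [OfNat.ofNat_ne_one, if_true, if_false] at h1 ⊢
    have hs : 2 * Real.pi ^ (((2 : ℕ) : ℝ) / 2) / Real.Gamma (((2 : ℕ) : ℝ) / 2) = 2 * Real.pi := by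
      norm_num [Real.Gamma_one]
    rw [hs]
    by_cases h : B = 0
    · simp only [h, if_true]; ring
    · rw [if_neg h, if_neg (coe_exp_ne_zero _), EReal.toReal_coe,
        Real.log_div hR.ne' (Real.exp_ne_zero _), Real.log_exp]
      have e2 : Real.log R - -A / B = 1 / B := by rw [← h1]; field_simp; ring
      rw [e2]; field_simp
  · simp only [if_neg hn1, if_neg hn2] at h1 ⊢
    have hn3 : 0 < (n : ℝ) - 2 := by
      have : (3 : ℝ) ≤ n := by exact_mod_cast (show 3 ≤ n by omega)
      linarith
    have hG : Real.Gamma ((n : ℝ) / 2) ≠ 0 := (Real.Gamma_pos_of_pos (by positivity)).ne'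
    have hz : R ^ (2 - (n : ℤ)) ≠ 0 := (zpow_pos hR _).ne'
    have e : R ^ (n - 2) = (R ^ (2 - (n : ℤ)))⁻¹ := by
      rw [← zpow_natCast, ← zpow_neg]
      congr 1
      push_cast [show 2 ≤ n by omega]
      ring
    by_cases h : A = 0
    · simp only [h, if_true]
      rw [h] at h1
      have : B = -((n : ℝ) - 2) / R ^ (2 - (n : ℤ)) := by
        field_simp at h1 ⊢; linarith
      rw [this, e]
      field_simp
    · rw [if_neg h, if_neg (EReal.coe_ne_bot _), EReal.toReal_coe]
      have e2 : 1 - B / (((n : ℝ) - 2) * A) * R ^ (2 - (n : ℤ)) = 1 / A := by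
        rw [show (1 : ℝ) / A = (A + B * -(R ^ (2 - (n : ℤ)) / ((n : ℝ) - 2))) / A by rw [h1]]
        field_simp
        ring
      rw [e2]; field_simp

theorem radialHarmonic_strictMono {n : ℕ} (hn : 1 ≤ n) {a b : ℝ} (ha : 0 < a) (hab : a < b) :
    radialHarmonic n a < radialHarmonic n b := by
  have h1 := setIntegral_inv_pow_eq hn ha hab.le
  have h2 := setIntegral_inv_pow_pos (n - 1) ha hab
  linarith

theorem tendsto_radialHarmonic {n : ℕ} (hn : 1 ≤ n) (hn2 : n ≤ 2) :
    Tendsto (radialHarmonic n) atTop atTop := by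
  unfold radialHarmonic
  interval_cases n
  · simp only [if_true]
    exact tendsto_id
  · simpa using Real.tendsto_log_atTop

theorem tendsto_radialHarmonic_zero {n : ℕ} (hn : 3 ≤ n) :
    Tendsto (radialHarmonic n) atTop (𝓝 0) := by
  have e : radialHarmonic n = fun r : ℝ => -((r ^ (n - 2))⁻¹ / ((n : ℝ) - 2)) := by
    funext r
    unfold radialHarmonic
    rw [if_neg (by omega), if_neg (by omega), ← zpow_natCast, ← zpow_neg]
    congr 3
    push_cast [show 2 ≤ n by omega]
    ring
  rw [e]
  have h1 : Tendsto (fun r : ℝ => (r ^ (n - 2))⁻¹) atTop (𝓝 0) :=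
    (tendsto_pow_atTop (by omega)).inv_tendsto_atTop
  simpa using (h1.div_const ((n : ℝ) - 2)).neg

/-- The coefficient `B` of the harmonic function is the value of the form at `f`, and `A = 1 - B
h(R)`. The length is read off at `R₀ + 1` and carried to every other `R` by proportionality. -/
theorem exists_scatteringLength {n : ℕ} (hn : 1 ≤ n) {V : ℝ → ℝ} (H : RadialPotential (n - 1) V)
    {R₀ : ℝ} (hR₀ : 0 ≤ R₀) (hV0 : ∀ r, R₀ < r → V r = 0) :
    ∃ a : EReal, ScatteringRange n R₀ a ∧ ∀ R, R₀ < R → ∃ f φ, IsWeakSol (n - 1) V R f φ ∧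
      (∀ r ∈ Ioo R₀ R, f r = asympProfile n a R r) ∧
      ∀ μ, minEnergy n μ a R = μ * formB (n - 1) V R f φ f φ * sphereArea n := by
  have hex : ∀ R, R₀ < R → ∃ f φ, IsWeakSol (n - 1) V R f φ := fun R hR =>
    H.exists_weakSol (hR₀.trans_lt hR) (H.coercive (hR₀.trans_lt hR))
  have hform : ∀ R f φ, R₀ < R → IsWeakSol (n - 1) V R f φ → ∀ r, R₀ < r → r ≤ R →
      f r = (1 - formB (n - 1) V R f φ f φ * radialHarmonic n R)
        + formB (n - 1) V R f φ f φ * radialHarmonic n r := by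
    intro R f φ hR hf r hr hrR
    rcases hrR.eq_or_lt with rfl | hlt
    · rw [hf.one]; ring
    · have hr0 := hR₀.trans_lt hr
      rw [hf.outside H hV0 hr0 hr hlt, setIntegral_inv_pow_eq hn hr0 hlt.le]
      ring
  have hscale : ∀ R R' f φ f' φ', R₀ < R → R ≤ R' → IsWeakSol (n - 1) V R f φ →
      IsWeakSol (n - 1) V R' f' φ' →
      lengthOf n (1 - formB (n - 1) V R f φ f φ * radialHarmonic n R) (formB (n - 1) V R f φ f φ) =
      lengthOf n (1 - formB (n - 1) V R' f' φ' f' φ' * radialHarmonic n R')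
        (formB (n - 1) V R' f' φ' f' φ') := by
    intro R R' f φ f' φ' hR hRR hf hf'
    have hR0 := hR₀.trans_lt hR
    have hs := hf.scaling H hR0 hf' hRR
    have h1 := hform R f φ hR hf
    have h2 := hform R' f' φ' (hR.trans_le hRR) hf'
    set B := formB (n - 1) V R f φ f φ
    set B' := formB (n - 1) V R' f' φ' f' φ'
    set A := 1 - B * radialHarmonic n R with hA
    set A' := 1 - B' * radialHarmonic n R' with hA'
    set c := f' R
    -- Two distinct points in the region where `V = 0` determine both coefficients, since `h` is
    -- strictly increasing.
    have hx : R₀ < (R₀ + R) / 2 := by linarith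
    have hxR : (R₀ + R) / 2 < R := by linarith
    have hx0 := hR₀.trans_lt hx
    have e1 := hs _ ⟨hx0, hxR.le⟩
    have e2 := hs R ⟨hR0, le_rfl⟩
    rw [h1 _ hx hxR.le, h2 _ hx (hxR.le.trans hRR)] at e1
    rw [h1 R hR le_rfl, h2 R hR hRR] at e2
    have hlt := radialHarmonic_strictMono hn hx0 hxR
    have eB : B' = c * B := by
      have : (B' - c * B) * (radialHarmonic n R - radialHarmonic n ((R₀ + R) / 2)) = 0 := by
        linear_combination e2 - e1
      rcases mul_eq_zero.1 this with h | h <;> linarith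
    have eA : A' = c * A := by rw [eB] at e2; linarith
    -- A zero factor would give `A' = B' = 0`, against `A' + B' h(R') = 1`.
    have hc : c ≠ 0 := by
      intro h0
      rw [h0] at eA eB
      rw [eB] at hA'
      linarith
    rw [eA, eB, lengthOf_smul n hc]
  obtain ⟨f₁, φ₁, hf₁⟩ := hex (R₀ + 1) (lt_add_one _)
  have hlen : ∀ R f φ, R₀ < R → IsWeakSol (n - 1) V R f φ →
      lengthOf n (1 - formB (n - 1) V (R₀ + 1) f₁ φ₁ f₁ φ₁ * radialHarmonic n (R₀ + 1))
        (formB (n - 1) V (R₀ + 1) f₁ φ₁ f₁ φ₁) =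
      lengthOf n (1 - formB (n - 1) V R f φ f φ * radialHarmonic n R)
        (formB (n - 1) V R f φ f φ) := by
    intro R f φ hR hf
    rcases le_total R (R₀ + 1) with h | h
    · exact (hscale _ _ _ _ _ _ hR h hf hf₁).symm
    · exact hscale _ _ _ _ _ _ (lt_add_one _) h hf₁ hf
  refine ⟨lengthOf n (1 - formB (n - 1) V (R₀ + 1) f₁ φ₁ f₁ φ₁ * radialHarmonic n (R₀ + 1))
    (formB (n - 1) V (R₀ + 1) f₁ φ₁ f₁ φ₁), ?_, fun R hR => ?_⟩
  · have hR0 : 0 < R₀ + 1 := by linarith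
    have hlow : ∀ ρ, R₀ + 1 < ρ → -(radialHarmonic n ρ - radialHarmonic n (R₀ + 1))⁻¹ ≤
        formB (n - 1) V (R₀ + 1) f₁ φ₁ f₁ φ₁ := fun ρ hρ => by
      have := hf₁.energy_lower_bound H hV0 hR0 (by linarith) hρ
      rwa [setIntegral_inv_pow_eq hn hR0 hρ.le] at this
    -- Let `ρ → ∞` in `hlow`. For `n ≤ 2`, `h(ρ) → ∞` gives `B ≥ 0`. For `n ≥ 3`, `h(ρ) → 0` gives
    -- `B ≥ 1/h(R₀ + 1)`, and since `h < 0` this means `A ≥ 0`.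
    refine scatteringRange_lengthOf (R := R₀ + 1) hn hR₀ (lt_add_one _) (fun h2 => ?_)
      (fun h3 => ?_) fun r hr => ?_
    · have h4 : Tendsto (fun ρ => -(radialHarmonic n ρ - radialHarmonic n (R₀ + 1))⁻¹) atTop
          (𝓝 (-0)) :=
        (((tendsto_radialHarmonic hn h2).atTop_add tendsto_const_nhds).inv_tendsto_atTop).neg
      rw [neg_zero] at h4
      exact le_of_tendsto h4 (by filter_upwards [eventually_gt_atTop (R₀ + 1)] with ρ h using hlow ρ h)
    · have h5 : radialHarmonic n (R₀ + 1) < 0 := by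
        unfold radialHarmonic
        rw [if_neg (by omega), if_neg (by omega), neg_lt_zero]
        have : (3 : ℝ) ≤ n := by exact_mod_cast h3
        exact div_pos (zpow_pos hR0 _) (by linarith)
      have h4 : Tendsto (fun ρ => -(radialHarmonic n ρ - radialHarmonic n (R₀ + 1))⁻¹) atTop
          (𝓝 (-(0 - radialHarmonic n (R₀ + 1))⁻¹)) :=
        (((tendsto_radialHarmonic_zero h3).sub_const _).inv₀ (by linarith)).neg
      have h6 := le_of_tendsto h4 (by
        filter_upwards [eventually_gt_atTop (R₀ + 1)] with ρ h using hlow ρ h)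
      have h7 : radialHarmonic n (R₀ + 1) * (radialHarmonic n (R₀ + 1))⁻¹ = 1 :=
        mul_inv_cancel₀ h5.ne
      rw [zero_sub, inv_neg, neg_neg] at h6
      nlinarith
    · rw [← hform _ _ _ (lt_add_one _) hf₁ r hr.1 hr.2.le]
      exact hf₁.nonneg H r ⟨hR₀.trans_lt hr.1, hr.2.le⟩
  · obtain ⟨f, φ, hf⟩ := hex R hR
    refine ⟨f, φ, hf, fun r hr => ?_, fun μ => ?_⟩
    · rw [hlen R f φ hR hf, ← asympProfile_lengthOf hn (hR₀.trans_lt hr.1) (hR₀.trans_lt hR)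
        (by ring)]
      exact hform R f φ hR hf r hr.1 hr.2.le
    · rw [hlen R f φ hR hf]
      exact minEnergy_lengthOf hn (hR₀.trans_lt hR) (by ring)

/-! ### Polar coordinates -/

/-- The unit sphere of `ℝⁿ`. -/
abbrev Sph (n : ℕ) : Type := Metric.sphere (0 : Sp n) 1

/-- The surface measure on the unit sphere. -/
noncomputable abbrev surf (n : ℕ) : Measure (Sph n) := (volume : Measure (Sp n)).toSphere

/-- The measure `r^{n-1} dr` on `(0, R)`. -/
noncomputable def radMeas (n : ℕ) (R : ℝ) : Measure ℝ :=
  (volume.restrict (Ioo 0 R)).withDensity fun r => ENNReal.ofReal (r ^ (n - 1))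

/-- Polar coordinates. -/
def polar {n : ℕ} (z : Sph n × ℝ) : Sp n := z.2 • (z.1 : Sp n)

theorem measurable_polar {n : ℕ} : Measurable (polar (n := n)) := by
  unfold polar
  fun_prop

theorem finrank_Sp (n : ℕ) : Module.finrank ℝ (Sp n) = n := by simp

theorem radMeas_eq_map (n : ℕ) (R : ℝ) : radMeas n R =
    ((Measure.volumeIoiPow (n - 1)).restrict {r | r.1 < R}).map Subtype.val := by
  have hm : MeasurableSet {r : Ioi (0 : ℝ) | r.1 < R} := measurable_subtype_coe measurableSet_Iio
  ext s hs
  rw [Measure.map_apply measurable_subtype_coe hs, Measure.restrict_apply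
    (measurable_subtype_coe hs), Measure.volumeIoiPow, withDensity_apply _
    ((measurable_subtype_coe hs).inter hm), radMeas, withDensity_apply _ hs,
    setLIntegral_subtype measurableSet_Ioi _ (fun a : ℝ => ENNReal.ofReal (a ^ (n - 1))),
    Measure.restrict_restrict hs]
  congr 2
  ext x
  constructor
  · rintro ⟨h1, h2, h3⟩
    exact ⟨⟨x, h2⟩, ⟨h1, h3⟩, rfl⟩
  · rintro ⟨y, ⟨h1, h2⟩, rfl⟩
    exact ⟨h1, y.2, h2⟩

instance (n : ℕ) (R : ℝ) : SFinite (radMeas n R) := by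
  unfold radMeas; infer_instance

/-- The polar homeomorphism describes only the complement of the origin, a null set because `n ≥ 1`;
the statement then restricts to the ball. -/
theorem measurePreserving_polar {n : ℕ} (hn : 1 ≤ n) (R : ℝ) :
    MeasurePreserving polar ((surf n).prod (radMeas n R)) (volume.restrict (ballR n R)) := by
  have : Nontrivial (Sp n) := by
    have : Nonempty (Fin n) := ⟨⟨0, hn⟩⟩
    infer_instance
  have h1 := ((volume : Measure (Sp n)).measurePreserving_homeomorphUnitSphereProd)
  have h2 : MeasurePreserving (homeomorphUnitSphereProd (Sp n)).symm
      ((surf n).prod (Measure.volumeIoiPow (n - 1)))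
      ((volume : Measure (Sp n)).comap ((↑) : ({0}ᶜ : Set (Sp n)) → Sp n)) := by
    have := MeasurePreserving.symm (homeomorphUnitSphereProd (Sp n)).toMeasurableEquiv h1
    simpa [finrank_Sp] using this
  have h3 : MeasurePreserving ((↑) : ({0}ᶜ : Set (Sp n)) → Sp n)
      ((volume : Measure (Sp n)).comap (↑)) volume := by
    have := measurePreserving_subtype_coe (μa := (volume : Measure (Sp n)))
      (measurableSet_singleton (0 : Sp n)).compl
    rwa [restrict_compl_singleton] at this
  have h4 := h3.comp h2
  have h5 := h4.restrict_preimage (s := ballR n R) Metric.isOpen_ball.measurableSet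
  have e1 : (((↑) : ({0}ᶜ : Set (Sp n)) → Sp n) ∘ (homeomorphUnitSphereProd (Sp n)).symm) ⁻¹'
      ballR n R = univ ×ˢ {r : Ioi (0 : ℝ) | r.1 < R} := by
    ext z
    have : (0 : ℝ) < z.2 := z.2.2
    simp [norm_smul, abs_of_pos this]
  rw [e1, ← Measure.prod_restrict, Measure.restrict_univ] at h5
  refine ⟨measurable_polar, ?_⟩
  have h6 : (surf n).prod (radMeas n R) = ((surf n).prod
      ((Measure.volumeIoiPow (n - 1)).restrict {r | r.1 < R})).map (Prod.map id Subtype.val) := by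
    rw [radMeas_eq_map, ← Measure.map_prod_map _ _ measurable_id measurable_subtype_coe,
      Measure.map_id]
  rw [h6, Measure.map_map measurable_polar (measurable_id.prodMap measurable_subtype_coe), ← h5.map_eq]
  rfl

theorem lintegral_radMeas (n : ℕ) (R : ℝ) (F : ℝ → ℝ≥0∞) :
    ∫⁻ r, F r ∂(radMeas n R) = ∫⁻ r in Ioo 0 R, ENNReal.ofReal (r ^ (n - 1)) * F r := by
  rw [radMeas, lintegral_withDensity_eq_lintegral_mul_non_measurable _ (by fun_prop)
    (Eventually.of_forall fun r => ENNReal.ofReal_lt_top)]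
  rfl

theorem aemeasurable_comp_polar {n : ℕ} (hn : 1 ≤ n) {R : ℝ} {F : Sp n → ℝ≥0∞}
    (hF : AEMeasurable F (volume.restrict (ballR n R))) :
    AEMeasurable (fun z => F (polar z)) ((surf n).prod (radMeas n R)) :=
  hF.comp_quasiMeasurePreserving (measurePreserving_polar hn R).quasiMeasurePreserving

theorem lintegral_polar {n : ℕ} (hn : 1 ≤ n) {R : ℝ} {F : Sp n → ℝ≥0∞}
    (hF : AEMeasurable F (volume.restrict (ballR n R))) :
    ∫⁻ x in ballR n R, F x = ∫⁻ w : Sph n, (∫⁻ r in Ioo 0 R,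
      ENNReal.ofReal (r ^ (n - 1)) * F (r • (w : Sp n))) ∂(surf n) := by
  have h := aemeasurable_comp_polar hn hF
  rw [← (measurePreserving_polar hn R).map_eq] at hF ⊢
  rw [lintegral_map' hF measurable_polar.aemeasurable, lintegral_prod _ h]
  simp_rw [lintegral_radMeas]
  rfl

theorem aemeasurable_lintegral_polar {n : ℕ} (hn : 1 ≤ n) {R : ℝ} {F : Sp n → ℝ≥0∞}
    (hF : AEMeasurable F (volume.restrict (ballR n R))) :
    AEMeasurable (fun w : Sph n => ∫⁻ r in Ioo 0 R,
      ENNReal.ofReal (r ^ (n - 1)) * F (r • (w : Sp n))) (surf n) := by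
  have h := (aemeasurable_comp_polar hn hF).lintegral_prod_right'
  simp_rw [lintegral_radMeas] at h
  exact h

/-- Allows functions of `r` that are only almost everywhere measurable, such as `v` and the
derivatives, to be composed with the norm. -/
theorem quasiMeasurePreserving_norm {n : ℕ} (hn : 1 ≤ n) (R : ℝ) :
    Measure.QuasiMeasurePreserving (fun x : Sp n => ‖x‖) (volume.restrict (ballR n R))
      (volume.restrict (Ioo 0 R)) := by
  refine ⟨measurable_norm, ?_⟩
  rw [← (measurePreserving_polar hn R).map_eq, Measure.map_map measurable_norm measurable_polar]
  have h1 : ((fun x : Sp n => ‖x‖) ∘ polar) =ᵐ[(surf n).prod (radMeas n R)] Prod.snd := by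
    have h2 : ∀ᵐ r ∂(radMeas n R), 0 < r := by
      refine (withDensity_absolutelyContinuous _ _).ae_le ?_
      filter_upwards [ae_restrict_mem measurableSet_Ioo] with r hr using hr.1
    have h3 : ∀ᵐ z ∂((surf n).prod (radMeas n R)), 0 < z.2 :=
      Measure.quasiMeasurePreserving_snd.ae h2
    filter_upwards [h3] with z hz
    simp [polar, norm_smul, abs_of_pos hz]
  rw [Measure.map_congr h1]
  exact Measure.quasiMeasurePreserving_snd.absolutelyContinuous.trans
    (withDensity_absolutelyContinuous _ _)

theorem surf_univ {n : ℕ} (hn : 1 ≤ n) : surf n univ = ENNReal.ofReal (sphereArea n) := by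
  have : Nonempty (Fin n) := ⟨⟨0, hn⟩⟩
  rw [Measure.toSphere_apply_univ, finrank_Sp, EuclideanSpace.volume_ball]
  have hn0 : (0 : ℝ) < n := by exact_mod_cast hn
  simp only [ENNReal.ofReal_one, one_pow, one_mul, Fintype.card_fin]
  rw [← ENNReal.ofReal_natCast, ← ENNReal.ofReal_mul hn0.le]
  congr 1
  unfold sphereArea
  rw [Real.Gamma_add_one (by positivity), Real.sqrt_eq_rpow, ← Real.rpow_natCast,
    ← Real.rpow_mul Real.pi_pos.le]
  have : Real.Gamma ((n : ℝ) / 2) ≠ 0 := (Real.Gamma_pos_of_pos (by positivity)).ne'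
  rw [show (1 : ℝ) / 2 * n = n / 2 by ring]
  field_simp

theorem sphereArea_pos {n : ℕ} (hn : 1 ≤ n) : 0 < sphereArea n := by
  have hn0 : (0 : ℝ) < n := by exact_mod_cast hn
  have : 0 < Real.Gamma ((n : ℝ) / 2) := Real.Gamma_pos_of_pos (by positivity)
  have := Real.pi_pos
  unfold sphereArea
  positivity

theorem lintegral_radial {n : ℕ} (hn : 1 ≤ n) {R : ℝ} {F : ℝ → ℝ≥0∞}
    (hF : AEMeasurable F (volume.restrict (Ioo 0 R))) :
    ∫⁻ x in ballR n R, F ‖x‖ = ENNReal.ofReal (sphereArea n) *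
      ∫⁻ r in Ioo 0 R, ENNReal.ofReal (r ^ (n - 1)) * F r := by
  rw [lintegral_polar hn (F := fun x => F ‖x‖)
    (hF.comp_quasiMeasurePreserving (quasiMeasurePreserving_norm hn R))]
  have : ∀ w : Sph n, ∫⁻ r in Ioo 0 R, ENNReal.ofReal (r ^ (n - 1)) * F ‖r • (w : Sp n)‖
      = ∫⁻ r in Ioo 0 R, ENNReal.ofReal (r ^ (n - 1)) * F r := fun w => by
    refine setLIntegral_congr_fun measurableSet_Ioo fun r hr => ?_
    simp [norm_smul, abs_of_pos hr.1]
  simp_rw [this]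
  rw [lintegral_const, surf_univ hn, mul_comm]

/-! ### Hardy-type bounds for the negative part of the potential -/

theorem integrable_rpow_inv_Ioo (θ : ℝ) {r : ℝ} (hr : 0 < r) (R : ℝ) :
    IntegrableOn (fun s : ℝ => (s ^ θ)⁻¹) (Ioo r R) := by
  have : ContinuousOn (fun s : ℝ => (s ^ θ)⁻¹) (Icc r R) := by
    refine ContinuousOn.inv₀ (fun s hs => ?_) fun s hs =>
      (Real.rpow_pos_of_pos (hr.trans_le hs.1) _).ne'
    exact (Real.continuousAt_rpow_const s θ (Or.inl (hr.trans_le hs.1).ne')).continuousWithinAt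
  exact this.integrableOn_Icc.mono_set Ioo_subset_Icc_self

theorem integrable_rpow_mul_sq {N : ℕ} {R θ : ℝ} {γ : ℝ → ℝ} {r : ℝ} (hr : 0 < r)
    (hs : IntegrableOn (fun r => r ^ N * γ r ^ 2) (Ioo 0 R)) :
    IntegrableOn (fun s => s ^ θ * γ s ^ 2) (Ioo r R) := by
  have hc : ContinuousOn (fun s : ℝ => s ^ θ * (s ^ N)⁻¹) (Icc r R) := by
    refine ContinuousOn.mul (fun s hs => ?_) (ContinuousOn.inv₀ (by fun_prop) fun s hs =>
      (pow_pos (hr.trans_le hs.1) _).ne')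
    exact (Real.continuousAt_rpow_const s θ (Or.inl (hr.trans_le hs.1).ne')).continuousWithinAt
  have h1 : IntegrableOn (fun r => r ^ N * γ r ^ 2) (Icc r R) := by
    rw [integrableOn_Icc_iff_integrableOn_Ioo]
    exact hs.mono_set (Ioo_subset_Ioo_left hr.le)
  refine ((h1.mul_continuousOn hc isCompact_Icc).mono_set Ioo_subset_Icc_self).congr_fun
    (fun s hs => ?_) measurableSet_Ioo
  have : 0 < s ^ N := pow_pos (hr.trans hs.1) _
  field_simp

/-- A weighted Hardy inequality. -/
theorem lintegral_weighted_hardy {N : ℕ} {R θ C : ℝ} {W κ γ : ℝ → ℝ}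
    (hWm : AEStronglyMeasurable W (volume.restrict (Ioo 0 R)))
    (hW : ∀ r ∈ Ioo 0 R, 0 ≤ W r)
    (hκm : Measurable κ)
    (hκ : ∀ r ∈ Ioo 0 R, ∫ s in Ioo r R, (s ^ θ)⁻¹ ≤ κ r)
    (hC : ∀ s ∈ Ioo 0 R, ∃ G : ℝ → ℝ, IntegrableOn G (Ioo 0 s) ∧
      (∀ r ∈ Ioo 0 s, W r * κ r ≤ G r) ∧ ∫ r in Ioo 0 s, G r ≤ C * s ^ ((N : ℝ) - θ))
    (hm : AEStronglyMeasurable γ (volume.restrict (Ioo 0 R)))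
    (hs : IntegrableOn (fun r => r ^ N * γ r ^ 2) (Ioo 0 R)) :
    ∫⁻ r in Ioo 0 R, ENNReal.ofReal (W r * (∫ s in r..R, γ s) ^ 2)
      ≤ ENNReal.ofReal (C * kin N R γ) := by
  have hκ0 : ∀ r ∈ Ioo 0 R, 0 ≤ κ r := fun r hr => le_trans
    (setIntegral_nonneg measurableSet_Ioo fun s hs => by
      have : 0 < s := hr.1.trans hs.1
      positivity) (hκ r hr)
  have hγm : AEMeasurable (fun s => ENNReal.ofReal (s ^ θ * γ s ^ 2)) (volume.restrict (Ioo 0 R)) :=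
    (((by fun_prop : Measurable fun s : ℝ => s ^ θ).aestronglyMeasurable.mul
      (hm.pow 2)).aemeasurable).ennreal_ofReal
  have hWκm : AEMeasurable (fun r => ENNReal.ofReal (W r * κ r)) (volume.restrict (Ioo 0 R)) :=
    (hWm.mul hκm.aestronglyMeasurable).aemeasurable.ennreal_ofReal
  calc ∫⁻ r in Ioo 0 R, ENNReal.ofReal (W r * (∫ s in r..R, γ s) ^ 2)
      ≤ ∫⁻ r in Ioo 0 R, (∫⁻ s in Ioo 0 R, (if r < s then
          ENNReal.ofReal (W r * κ r) * ENNReal.ofReal (s ^ θ * γ s ^ 2) else 0)) := by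
        refine setLIntegral_mono' measurableSet_Ioo fun r hr => ?_
        -- Cauchy–Schwarz with the auxiliary weight `s^θ`. After the order of integration is
        -- exchanged, the factor `s^(N-θ)` supplied by `hC` restores the kinetic weight `s^N`.
        have h1 : (∫ s in r..R, γ s) ^ 2 ≤ κ r * ∫ s in Ioo r R, s ^ θ * γ s ^ 2 := by
          rw [intervalIntegral_eq_Ioo hr.2.le]
          have hsub : Ioo r R ⊆ Ioo 0 R := Ioo_subset_Ioo_left hr.1.le
          have hk : ∀ᵐ s ∂(volume.restrict (Ioo r R)), 0 < s ^ θ := by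
            filter_upwards [ae_restrict_mem measurableSet_Ioo] with s hs
            exact Real.rpow_pos_of_pos (hr.1.trans hs.1) _
          refine (sq_integral_le_weighted hk (hm.mono_set hsub)
            (integrable_rpow_inv_Ioo θ hr.1 R) (integrable_rpow_mul_sq hr.1 hs)).trans ?_
          refine mul_le_mul_of_nonneg_right (hκ r hr) (integral_nonneg_of_ae ?_)
          filter_upwards [hk] with s hs using mul_nonneg hs.le (sq_nonneg _)
        have h2 : ∫⁻ s in Ioo 0 R, (if r < s then
            ENNReal.ofReal (W r * κ r) * ENNReal.ofReal (s ^ θ * γ s ^ 2) else 0)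
            = ENNReal.ofReal (W r * κ r) * ∫⁻ s in Ioo r R, ENNReal.ofReal (s ^ θ * γ s ^ 2) := by
          rw [← lintegral_const_mul' _ _ ENNReal.ofReal_ne_top,
            ← lintegral_indicator measurableSet_Ioo, ← lintegral_indicator measurableSet_Ioo]
          congr 1
          funext s
          have := hr.1
          simp only [indicator, mem_Ioo]
          by_cases h3 : r < s
          · have : 0 < s := this.trans h3
            simp [h3, this]
          · simp [h3]
        rw [h2, ← ofReal_integral_eq_lintegral_ofReal (integrable_rpow_mul_sq hr.1 hs),
          ← ENNReal.ofReal_mul (mul_nonneg (hW r hr) (hκ0 r hr))]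
        · refine ENNReal.ofReal_le_ofReal ?_
          rw [mul_assoc]
          exact mul_le_mul_of_nonneg_left h1 (hW r hr)
        · filter_upwards [ae_restrict_mem measurableSet_Ioo] with s hs
          have : 0 < s := hr.1.trans hs.1
          positivity
    _ = ∫⁻ s in Ioo 0 R, (∫⁻ r in Ioo 0 R, (if r < s then
          ENNReal.ofReal (W r * κ r) * ENNReal.ofReal (s ^ θ * γ s ^ 2) else 0)) := by
        refine lintegral_lintegral_swap ?_
        have h1 : AEMeasurable (fun z : ℝ × ℝ => ENNReal.ofReal (W z.1 * κ z.1) *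
            ENNReal.ofReal (z.2 ^ θ * γ z.2 ^ 2))
            ((volume.restrict (Ioo 0 R)).prod (volume.restrict (Ioo 0 R))) :=
          (hWκm.comp_quasiMeasurePreserving Measure.quasiMeasurePreserving_fst).mul
            (hγm.comp_quasiMeasurePreserving Measure.quasiMeasurePreserving_snd)
        have h2 : MeasurableSet {z : ℝ × ℝ | z.1 < z.2} := measurableSet_lt measurable_fst measurable_snd
        refine (h1.indicator h2).congr (Eventually.of_forall fun z => ?_)
        simp [Function.uncurry, indicator]
    _ ≤ ∫⁻ s in Ioo 0 R, ENNReal.ofReal (C * (s ^ N * γ s ^ 2)) := by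
        refine setLIntegral_mono' measurableSet_Ioo fun s hs' => ?_
        have h2 : ∫⁻ r in Ioo 0 R, (if r < s then
            ENNReal.ofReal (W r * κ r) * ENNReal.ofReal (s ^ θ * γ s ^ 2) else 0)
            = (∫⁻ r in Ioo 0 s, ENNReal.ofReal (W r * κ r)) * ENNReal.ofReal (s ^ θ * γ s ^ 2) := by
          rw [← lintegral_mul_const' _ _ ENNReal.ofReal_ne_top,
            ← lintegral_indicator measurableSet_Ioo, ← lintegral_indicator measurableSet_Ioo]
          congr 1
          funext r
          have := hs'.2
          simp only [indicator, mem_Ioo]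
          by_cases h3 : r < s
          · have : r < R := h3.trans this
            simp [h3, this]
          · simp [h3]
        obtain ⟨G, hGi, hG, hGs⟩ := hC s hs'
        have hG0 : ∀ r ∈ Ioo 0 s, 0 ≤ G r := fun r hr =>
          (mul_nonneg (hW r ⟨hr.1, hr.2.trans hs'.2⟩) (hκ0 r ⟨hr.1, hr.2.trans hs'.2⟩)).trans (hG r hr)
        have h3 : ∫⁻ r in Ioo 0 s, ENNReal.ofReal (W r * κ r)
            ≤ ENNReal.ofReal (C * s ^ ((N : ℝ) - θ)) := by
          refine (setLIntegral_mono' measurableSet_Ioo fun r hr =>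
            ENNReal.ofReal_le_ofReal (hG r hr)).trans ?_
          rw [← ofReal_integral_eq_lintegral_ofReal hGi]
          · exact ENNReal.ofReal_le_ofReal hGs
          · filter_upwards [ae_restrict_mem measurableSet_Ioo] with r hr using hG0 r hr
        have hint : 0 ≤ C * s ^ ((N : ℝ) - θ) :=
          (setIntegral_nonneg measurableSet_Ioo hG0).trans hGs
        rw [h2]
        refine (mul_le_mul_left h3 _).trans ?_
        rw [← ENNReal.ofReal_mul hint]
        refine ENNReal.ofReal_le_ofReal (le_of_eq ?_)
        have e : s ^ ((N : ℝ) - θ) * s ^ θ = s ^ N := by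
          rw [← Real.rpow_add hs'.1, sub_add_cancel, Real.rpow_natCast]
        linear_combination (C * γ s ^ 2) * e
    _ = ENNReal.ofReal (C * kin N R γ) := by
        rcases le_or_gt R 0 with hR | hR
        · simp [Ioo_eq_empty (not_lt.2 hR), kin]
        have hC0 : 0 ≤ C := by
          obtain ⟨G, hGi, hG, hGs⟩ := hC (R / 2) ⟨by linarith, by linarith⟩
          have h0 : 0 ≤ ∫ r in Ioo 0 (R / 2), G r :=
            setIntegral_nonneg measurableSet_Ioo fun r hr =>
              (mul_nonneg (hW r ⟨hr.1, hr.2.trans (by linarith)⟩)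
                (hκ0 r ⟨hr.1, hr.2.trans (by linarith)⟩)).trans (hG r hr)
          exact nonneg_of_mul_nonneg_left (h0.trans hGs) (Real.rpow_pos_of_pos (by linarith) _)
        rw [kin, ← integral_const_mul, ofReal_integral_eq_lintegral_ofReal (hs.const_mul C)]
        filter_upwards [ae_pow_pos N le_rfl R] with s h
        positivity

/-- The negative part of `V` is form bounded on `(0, R)` with constant `C`. -/
def NegBounded (N : ℕ) (V : ℝ → ℝ) (R C : ℝ) : Prop :=
  ∀ γ : ℝ → ℝ, AEStronglyMeasurable γ (volume.restrict (Ioo 0 R)) →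
    IntegrableOn (fun r => r ^ N * γ r ^ 2) (Ioo 0 R) →
    IntegrableOn (fun r => max (-V r) 0 * (∫ s in r..R, γ s) ^ 2) (Ioo 0 R) ∧
    ∫ r in Ioo 0 R, max (-V r) 0 * (∫ s in r..R, γ s) ^ 2 ≤ C * kin N R γ

theorem NegBounded.mono {N : ℕ} {V : ℝ → ℝ} {R C C' : ℝ} (h : NegBounded N V R C) (hC : C ≤ C') :
    NegBounded N V R C' := fun γ hm hs =>
  ⟨(h γ hm hs).1, (h γ hm hs).2.trans (mul_le_mul_of_nonneg_right hC (kin_nonneg _ _ _))⟩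

theorem negBounded_of_hardy {N : ℕ} {R θ C : ℝ} {V κ : ℝ → ℝ} (hC0 : 0 ≤ C)
    (hVm : AEStronglyMeasurable V (volume.restrict (Ioo 0 R)))
    (hκm : Measurable κ)
    (hκ : ∀ r ∈ Ioo 0 R, ∫ s in Ioo r R, (s ^ θ)⁻¹ ≤ κ r)
    (hC : ∀ s ∈ Ioo 0 R, ∃ G : ℝ → ℝ, IntegrableOn G (Ioo 0 s) ∧
      (∀ r ∈ Ioo 0 s, max (-V r) 0 * κ r ≤ G r) ∧
      ∫ r in Ioo 0 s, G r ≤ C * s ^ ((N : ℝ) - θ)) : NegBounded N V R C := by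
  intro γ hm hs
  have h1 := lintegral_weighted_hardy (W := fun r => max (-V r) 0)
    (hVm.neg.sup aestronglyMeasurable_const) (fun r _ => le_max_right _ _) hκm hκ hC hm hs
  have hmeas : AEStronglyMeasurable (fun r => max (-V r) 0 * (∫ s in r..R, γ s) ^ 2)
      (volume.restrict (Ioo 0 R)) :=
    (hVm.neg.sup aestronglyMeasurable_const).mul
      ((((continuousOn_primitive_of_kin hm hs).mono
        Ioo_subset_Ioc_self).aestronglyMeasurable measurableSet_Ioo).pow 2)
  have h0 : ∀ r, 0 ≤ max (-V r) 0 * (∫ s in r..R, γ s) ^ 2 := fun r => by positivity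
  have hi : IntegrableOn (fun r => max (-V r) 0 * (∫ s in r..R, γ s) ^ 2) (Ioo 0 R) := by
    refine ⟨hmeas, ?_⟩
    rw [hasFiniteIntegral_iff_ofReal (Eventually.of_forall h0)]
    exact h1.trans_lt ENNReal.ofReal_lt_top
  refine ⟨hi, ?_⟩
  rw [← ofReal_integral_eq_lintegral_ofReal hi (Eventually.of_forall h0),
    ENNReal.ofReal_le_ofReal_iff (mul_nonneg hC0 (kin_nonneg _ _ _))] at h1
  exact h1

/-- Below the threshold `l` the first term suffices; above it `x^(1-q) ≤ l^(1-q)`. It trades `v₋`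
for its integrable power, with `l` free to be adapted to scale. -/
theorem le_add_rpow_mul_rpow {x l q : ℝ} (hx : 0 ≤ x) (hl : 0 < l) (hq : 1 ≤ q) :
    x ≤ l + l ^ (1 - q) * x ^ q := by
  rcases le_or_gt x l with h | h
  · have : 0 ≤ l ^ (1 - q) * x ^ q := by positivity
    linarith
  · have hx0 : 0 < x := hl.trans h
    have h1 : x = x ^ (1 - q) * x ^ q := by
      rw [← Real.rpow_add hx0]; simp
    have h2 : x ^ (1 - q) ≤ l ^ (1 - q) :=
      Real.rpow_le_rpow_of_nonpos hl h.le (by linarith)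
    have h3 : x ^ (1 - q) * x ^ q ≤ l ^ (1 - q) * x ^ q :=
      mul_le_mul_of_nonneg_right h2 (by positivity)
    linarith

/-- The one-dimensional potential `r^{n-1} v(r) / (2 μ)`. -/
noncomputable def potV (n : ℕ) (μ : ℝ) (v : ℝ → ℝ) (r : ℝ) : ℝ := r ^ (n - 1) * v r / (2 * μ)

theorem max_neg_potV {n : ℕ} {μ : ℝ} (hμ : 0 < μ) (v : ℝ → ℝ) {r : ℝ} (hr : 0 < r) :
    max (-potV n μ v r) 0 = (r ^ (n - 1) / (2 * μ)) * max (-v r) 0 := by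
  have h : 0 ≤ r ^ (n - 1) / (2 * μ) := by positivity
  rw [mul_max_of_nonneg _ _ h, mul_zero]
  congr 1
  unfold potV
  ring

/-- In one dimension no auxiliary weight is needed: `(∫_r^R γ)²` is at most `R` times the kinetic
energy, and `v₋` is integrable. -/
theorem negBounded_one {μ : ℝ} (hμ : 0 < μ) {v : ℝ → ℝ}
    (hVm : AEStronglyMeasurable (potV 1 μ v) (volume.restrict (Ioi 0)))
    (hv : IntegrableOn (fun r => max (-v r) 0) (Ioi 0)) :
    ∃ M : ℝ, ∀ R, 0 < R → NegBounded 0 (potV 1 μ v) R (R * M) := by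
  set M := (2 * μ)⁻¹ * ∫ r in Ioi (0 : ℝ), max (-v r) 0 with hM
  have hM0 : 0 ≤ M := mul_nonneg (by positivity)
    (setIntegral_nonneg measurableSet_Ioi fun r _ => le_max_right _ _)
  refine ⟨M, fun R hR => negBounded_of_hardy (θ := 0) (κ := fun _ => R) (by positivity)
    (hVm.mono_set Ioo_subset_Ioi_self) measurable_const (fun r hr => ?_) fun s hs =>
    ⟨fun r => (R * (2 * μ)⁻¹) * max (-v r) 0, (hv.mono_set Ioo_subset_Ioi_self).const_mul _,
      fun r hr => ?_, ?_⟩⟩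
  · simp only [Real.rpow_zero, inv_one, setIntegral_const, smul_eq_mul, mul_one]
    rw [Real.volume_real_Ioo_of_le hr.2.le]
    linarith [hr.1]
  · rw [max_neg_potV hμ v hr.1]
    simp only [Nat.sub_self, pow_zero]
    apply le_of_eq
    field_simp
  · rw [integral_const_mul]
    have h1 : ∫ r in Ioo 0 s, max (-v r) 0 ≤ ∫ r in Ioi (0 : ℝ), max (-v r) 0 :=
      setIntegral_mono_set hv (Eventually.of_forall fun r => le_max_right _ _)
        Ioo_subset_Ioi_self.eventuallyLE
    simp only [CharP.cast_eq_zero, sub_zero, Real.rpow_zero, mul_one]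
    rw [hM, mul_assoc]
    refine mul_le_mul_of_nonneg_left (mul_le_mul_of_nonneg_left h1 (by positivity)) hR.le

/-- The weight `s^(1-δ)`, slightly weaker than the borderline `s`, avoids the logarithm. The extra
integrability `ε` compensates and leaves a positive power of `R` in the constant. -/
theorem negBounded_two {μ ε : ℝ} (hμ : 0 < μ) (hε : 0 < ε) {v : ℝ → ℝ}
    (hVm : AEStronglyMeasurable (potV 2 μ v) (volume.restrict (Ioi 0)))
    (hv : IntegrableOn (fun r => r * max (-v r) 0 ^ (1 + ε)) (Ioi 0)) :
    ∃ M δ : ℝ, 0 < δ ∧ ∀ R, 0 < R → NegBounded 1 (potV 2 μ v) R (R ^ δ * M) := by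
  set δ := 2 * ε / (1 + ε) with hδ
  have hδ0 : 0 < δ := by positivity
  set J := ∫ r in Ioi (0 : ℝ), r * max (-v r) 0 ^ (1 + ε) with hJ
  have hJ0 : 0 ≤ J := setIntegral_nonneg measurableSet_Ioi fun r hr => by
    have : 0 < r := hr
    positivity
  refine ⟨(2 * μ * δ)⁻¹ * (1 / 2 + J), δ, hδ0, fun R hR =>
    negBounded_of_hardy (θ := 1 - δ) (κ := fun _ => R ^ δ / δ) (by positivity)
    (hVm.mono_set Ioo_subset_Ioi_self) measurable_const (fun r hr => ?_) fun s hs => ?_⟩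
  · have h1 : ∀ s ∈ Ioo r R, (s ^ (1 - δ))⁻¹ = s ^ (δ - 1) := fun s hs => by
      rw [← Real.rpow_neg (hr.1.trans hs.1).le]; ring_nf
    rw [setIntegral_congr_fun measurableSet_Ioo h1, ← intervalIntegral_eq_Ioo hr.2.le,
      integral_rpow (Or.inl (by linarith)), sub_add_cancel]
    have : 0 ≤ r ^ δ := Real.rpow_nonneg hr.1.le _
    gcongr
    linarith
  · set a := 2 / (1 + ε) with ha
    -- This threshold balances the two terms: `l s² = l^(-ε) = s^δ`.
    set l := s ^ (-a) with hl
    have hl0 : 0 < l := Real.rpow_pos_of_pos hs.1 _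
    have hv' := hv.mono_set (Ioo_subset_Ioi_self : Ioo 0 s ⊆ Ioi 0)
    have hid : IntegrableOn (fun r : ℝ => r) (Ioo 0 s) :=
      (continuous_id.integrableOn_Icc (a := 0) (b := s)).mono_set Ioo_subset_Icc_self
    have hi : IntegrableOn (fun r => l * r + l ^ (-ε) * (r * max (-v r) 0 ^ (1 + ε))) (Ioo 0 s) :=
      (hid.const_mul l).add (hv'.const_mul _)
    refine ⟨fun r => (R ^ δ * (2 * μ * δ)⁻¹) * (l * r + l ^ (-ε) * (r * max (-v r) 0 ^ (1 + ε))),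
      hi.const_mul _, fun r hr => ?_, ?_⟩
    · rw [max_neg_potV hμ v hr.1]
      have h1 := le_add_rpow_mul_rpow (le_max_right (-v r) 0) hl0 (show 1 ≤ 1 + ε by linarith)
      rw [show 1 - (1 + ε) = -ε by ring] at h1
      have h2 := mul_le_mul_of_nonneg_left h1 (show 0 ≤ (R ^ δ * (2 * μ * δ)⁻¹) * r by
        have := hr.1; positivity)
      refine le_trans (le_of_eq ?_) (h2.trans (le_of_eq ?_))
      · norm_num
        field_simp
      · ring
    · rw [integral_const_mul, integral_add (hid.const_mul l) (hv'.const_mul _), integral_const_mul,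
        integral_const_mul]
      have h1 : ∫ r in Ioo 0 s, r * max (-v r) 0 ^ (1 + ε) ≤ J :=
        setIntegral_mono_set hv (by
          filter_upwards [ae_restrict_mem measurableSet_Ioi] with r hr
          have : 0 < r := hr
          positivity) Ioo_subset_Ioi_self.eventuallyLE
      have h2 : ∫ r in Ioo 0 s, r = s ^ 2 / 2 := by
        rw [← intervalIntegral_eq_Ioo hs.1.le, integral_id]; ring
      have e1 : l * s ^ 2 = s ^ δ := by
        rw [hl, ← Real.rpow_natCast, ← Real.rpow_add hs.1]
        congr 1
        rw [ha, hδ]; push_cast; field_simp; ring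
      have e2 : l ^ (-ε) = s ^ δ := by
        rw [hl, ← Real.rpow_mul hs.1.le]
        congr 1
        rw [ha, hδ]; field_simp
      have e3 : ((1 : ℕ) : ℝ) - (1 - δ) = δ := by push_cast; ring
      rw [h2, e2, e3]
      have h3 : l * (s ^ 2 / 2) + s ^ δ * ∫ r in Ioo 0 s, r * max (-v r) 0 ^ (1 + ε)
          ≤ s ^ δ * (1 / 2 + J) := by
        have := mul_le_mul_of_nonneg_left h1 (Real.rpow_nonneg hs.1.le δ)
        linarith
      refine (mul_le_mul_of_nonneg_left h3 (by positivity)).trans (le_of_eq ?_)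
      ring

/-- Split `v₋` at the critical Hardy level `ε r^(-2)`. The low part costs a multiple of `ε`, the
high part a multiple of the `L^(n/2)` integral over the ball of radius `R`. The exponent `3/2` lies
strictly between `1` and `n - 1`, so all the powers that occur are integrable where needed. -/
theorem negBounded_ge_three {n : ℕ} (hn : 3 ≤ n) {μ ε : ℝ} (hμ : 0 < μ) (hε : 0 < ε) {v : ℝ → ℝ}
    (hVm : AEStronglyMeasurable (potV n μ v) (volume.restrict (Ioi 0)))
    (hv : IntegrableOn (fun r => r ^ (n - 1) * max (-v r) 0 ^ ((n : ℝ) / 2)) (Ioi 0))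
    {R : ℝ} :
    NegBounded (n - 1) (potV n μ v) R (μ⁻¹ * (2 * ε + ε ^ (1 - (n : ℝ) / 2) *
      ∫ r in Ioo 0 R, r ^ (n - 1) * max (-v r) 0 ^ ((n : ℝ) / 2))) := by
  have hn' : (3 : ℝ) ≤ n := by exact_mod_cast hn
  set J := ∫ r in Ioo 0 R, r ^ (n - 1) * max (-v r) 0 ^ ((n : ℝ) / 2) with hJ
  have hJ0 : 0 ≤ J := setIntegral_nonneg measurableSet_Ioo fun r hr => by
    have : 0 < r := hr.1
    positivity
  refine negBounded_of_hardy (θ := 3 / 2) (κ := fun r => 2 * r ^ (-(1 / 2) : ℝ)) (by positivity)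
    (hVm.mono_set Ioo_subset_Ioi_self) (by fun_prop) (fun r hr => ?_) fun s hs => ?_
  · have h1 : ∀ s ∈ Ioo r R, (s ^ (3 / 2 : ℝ))⁻¹ = s ^ (-(3 / 2) : ℝ) := fun s hs => by
      rw [← Real.rpow_neg (hr.1.trans hs.1).le]
    have hR : 0 < R := hr.1.trans hr.2
    rw [setIntegral_congr_fun measurableSet_Ioo h1, ← intervalIntegral_eq_Ioo hr.2.le,
      integral_rpow (Or.inr ⟨by norm_num, by
        rw [uIcc_of_le hr.2.le]; exact fun h => absurd h.1 (not_le.2 hr.1)⟩)]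
    have : 0 ≤ R ^ (-(1 / 2) : ℝ) := Real.rpow_nonneg hR.le _
    rw [show (-(3 / 2) + 1 : ℝ) = -(1 / 2) by norm_num]
    linarith
  · have hv' := hv.mono_set (Ioo_subset_Ioi_self : Ioo 0 s ⊆ Ioi 0)
    have hexp : -1 < (n : ℝ) - 7 / 2 := by linarith
    have hpi : IntegrableOn (fun r : ℝ => r ^ ((n : ℝ) - 7 / 2)) (Ioo 0 s) :=
      (intervalIntegrable_iff_integrableOn_Ioo_of_le hs.1.le).1
        (intervalIntegral.intervalIntegrable_rpow' hexp)
    have hexp2 : (n : ℝ) - 7 / 2 + 1 = (n : ℝ) - 5 / 2 := by ring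
    have hn5 : 0 < (n : ℝ) - 5 / 2 := by linarith
    have hpint : ∫ r in Ioo 0 s, r ^ ((n : ℝ) - 7 / 2) ≤ 2 * s ^ ((n : ℝ) - 5 / 2) := by
      rw [← intervalIntegral_eq_Ioo hs.1.le, integral_rpow (Or.inl hexp), hexp2,
        Real.zero_rpow hn5.ne', sub_zero, div_le_iff₀ hn5]
      have : 0 < s ^ ((n : ℝ) - 5 / 2) := Real.rpow_pos_of_pos hs.1 _
      nlinarith
    have hi := (hpi.const_mul ε).add (hv'.const_mul (ε ^ (1 - (n : ℝ) / 2) * s ^ ((n : ℝ) - 5 / 2)))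
    refine ⟨_, hi.const_mul μ⁻¹, fun r hr => ?_, ?_⟩
    · have hr0 := hr.1
      rw [max_neg_potV hμ v hr0]
      have h1 := le_add_rpow_mul_rpow (l := ε * r ^ (-2 : ℝ)) (le_max_right (-v r) 0)
        (by positivity) (show 1 ≤ (n : ℝ) / 2 by linarith)
      rw [Real.mul_rpow hε.le (by positivity), ← Real.rpow_mul hr0.le] at h1
      have h2 := mul_le_mul_of_nonneg_left h1
        (show 0 ≤ μ⁻¹ * (r ^ (n - 1) * r ^ (-(1 / 2) : ℝ)) by positivity)
      refine le_trans (le_of_eq ?_) (h2.trans ?_)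
      · field_simp
      · simp only [Pi.add_apply]
        rw [mul_assoc]
        refine mul_le_mul_of_nonneg_left ?_ (by positivity)
        have e1 : r ^ (n - 1) * r ^ (-(1 / 2) : ℝ) * (ε * r ^ (-2 : ℝ))
            = ε * r ^ ((n : ℝ) - 7 / 2) := by
          rw [← Real.rpow_natCast, Nat.cast_sub (by omega)]
          have : (n : ℝ) - 7 / 2 = ((n : ℝ) - (1 : ℕ)) + (-(1 / 2) + -2) := by push_cast; ring
          rw [this, Real.rpow_add hr0, Real.rpow_add hr0]
          ring
        have e2 : r ^ (-(1 / 2) : ℝ) * r ^ ((-2 : ℝ) * (1 - (n : ℝ) / 2))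
            ≤ s ^ ((n : ℝ) - 5 / 2) := by
          rw [← Real.rpow_add hr0]
          refine le_trans (le_of_eq ?_) (Real.rpow_le_rpow hr0.le hr.2.le hn5.le)
          congr 1
          ring
        have h3 := mul_le_mul_of_nonneg_left e2
          (show 0 ≤ ε ^ (1 - (n : ℝ) / 2) * (r ^ (n - 1) * max (-v r) 0 ^ ((n : ℝ) / 2)) by
            positivity)
        rw [mul_add, e1]
        linarith
    · rw [integral_const_mul]
      simp only [Pi.add_apply]
      rw [integral_add (hpi.const_mul ε) (hv'.const_mul _), integral_const_mul,
        integral_const_mul]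
      have h1 : ∫ r in Ioo 0 s, r ^ (n - 1) * max (-v r) 0 ^ ((n : ℝ) / 2) ≤ J :=
        setIntegral_mono_set (hv.mono_set Ioo_subset_Ioi_self) (by
          filter_upwards [ae_restrict_mem measurableSet_Ioo] with r hr
          have : 0 < r := hr.1
          positivity) (Ioo_subset_Ioo_right hs.2.le).eventuallyLE
      have e3 : (((n - 1 : ℕ) : ℝ)) - 3 / 2 = (n : ℝ) - 5 / 2 := by
        rw [Nat.cast_sub (by omega)]; push_cast; ring
      rw [e3]
      have h2 := mul_le_mul_of_nonneg_left hpint hε.le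
      have h3 := mul_le_mul_of_nonneg_left h1 (show 0 ≤ ε ^ (1 - (n : ℝ) / 2) *
        s ^ ((n : ℝ) - 5 / 2) by have := hs.1; positivity)
      have h4 := mul_le_mul_of_nonneg_left (add_le_add h2 h3) (inv_nonneg.2 hμ.le)
      refine h4.trans (le_of_eq ?_)
      ring

/-! ### Weak gradients -/

section WeakGrad

variable {n : ℕ}

theorem enorm_integral_smul_le {α : Type*} [MeasurableSpace α] {m : Measure α} {f : α → ℝ}
    {g : α → ℂ} (hf : AEStronglyMeasurable f m) (hg : AEStronglyMeasurable g m) :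
    ‖∫ x, f x • g x ∂m‖ₑ ≤ eLpNorm f 2 m * eLpNorm g 2 m := by
  refine (enorm_integral_le_lintegral_enorm _).trans ?_
  have h1 : eLpNorm (f • g) 1 m ≤ eLpNorm f 2 m * eLpNorm g 2 m :=
    eLpNorm_smul_le_mul_eLpNorm (p := 2) (q := 2) (r := 1) hg hf
  rw [eLpNorm_one_eq_lintegral_enorm] at h1
  exact h1

theorem integrable_smul_of_memLp {α : Type*} [MeasurableSpace α] {m : Measure α} {f : α → ℝ}
    {g : α → ℂ} (hf : MemLp f 2 m) (hg : MemLp g 2 m) : Integrable (fun x => f x • g x) m :=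
  memLp_one_iff_integrable.1 (hg.smul (p := 2) (q := 2) (r := 1) hf)

theorem IsTestFun.memLp {F : Type*} [NormedAddCommGroup F] [NormedSpace ℝ F] {Ω : Set (Sp n)}
    {ψ : Sp n → F} (h : IsTestFun Ω ψ) (p : ℝ≥0∞) (m : Measure (Sp n)) [IsFiniteMeasureOnCompacts m] :
    MemLp ψ p m :=
  h.1.continuous.memLp_of_hasCompactSupport h.2.1

theorem contDiff_partialDeriv {F : Type*} [NormedAddCommGroup F] [NormedSpace ℝ F]
    {ψ : Sp n → F} (h : ContDiff ℝ ∞ ψ) (i : Fin n) : ContDiff ℝ ∞ (partialDeriv i ψ) := by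
  have h1 : ContDiff ℝ ∞ (fderiv ℝ ψ) := h.fderiv_right (m := ∞) (by simp)
  exact h1.clm_apply contDiff_const

theorem partialDeriv_eq_zero {F : Type*} [NormedAddCommGroup F] [NormedSpace ℝ F]
    {ψ : Sp n → F} {x : Sp n} (hx : x ∉ tsupport ψ) (i : Fin n) : partialDeriv i ψ x = 0 := by
  have : fderiv ℝ ψ x = 0 := by
    have h1 := support_fderiv_subset ℝ (f := ψ)
    by_contra h2
    exact hx (h1 h2)
  simp [partialDeriv, this]

theorem IsTestFun.partialDeriv {F : Type*} [NormedAddCommGroup F] [NormedSpace ℝ F]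
    {Ω : Set (Sp n)} {ψ : Sp n → F} (h : IsTestFun Ω ψ) (i : Fin n) :
    IsTestFun Ω (partialDeriv i ψ) := by
  have h1 : tsupport (ScatLen.partialDeriv i ψ) ⊆ tsupport ψ := by
    refine closure_minimal (fun x hx => ?_) (isClosed_tsupport ψ)
    by_contra h2
    exact hx (partialDeriv_eq_zero h2 i)
  exact ⟨contDiff_partialDeriv h.1 i, HasCompactSupport.of_support_subset_isCompact h.2.1
    (subset_closure.trans h1), h1.trans h.2.2⟩

theorem IsTestFun.eq_zero {F : Type*} [NormedAddCommGroup F] [NormedSpace ℝ F] {Ω : Set (Sp n)}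
    {ψ : Sp n → F} (h : IsTestFun Ω ψ) {x : Sp n} (hx : x ∉ Ω) : ψ x = 0 :=
  image_eq_zero_of_notMem_tsupport fun h' => hx (h.2.2 h')

theorem IsTestFun.setIntegral_eq {G : Type*} [NormedAddCommGroup G] [NormedSpace ℝ G]
    {Ω : Set (Sp n)} {ψ : Sp n → ℝ} (h : IsTestFun Ω ψ) (f : Sp n → G) :
    ∫ x in Ω, ψ x • f x = ∫ x, ψ x • f x :=
  setIntegral_eq_integral_of_forall_compl_eq_zero fun x hx => by rw [h.eq_zero hx, zero_smul]

theorem IsTestFun.integral_by_parts {Ω : Set (Sp n)} {χ : Sp n → ℝ} {ψ : Sp n → ℂ}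
    (h : IsTestFun Ω χ) (hψ : ContDiff ℝ ∞ ψ) (i : Fin n) :
    ∫ x in Ω, ScatLen.partialDeriv i χ x • ψ x = -∫ x in Ω, χ x • ScatLen.partialDeriv i ψ x := by
  rw [(h.partialDeriv i).setIntegral_eq, h.setIntegral_eq]
  have h1 := integral_smul_fderiv_eq_neg_fderiv_smul_of_integrable (μ := (volume : Measure (Sp n)))
    (f := χ) (g := ψ) (v := EuclideanSpace.single i (1 : ℝ)) ?_ ?_ ?_ ?_ ?_
  · rw [show (∫ x, χ x • ScatLen.partialDeriv i ψ x) = _ from h1, neg_neg]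
    rfl
  · exact ((((h.partialDeriv i).1.continuous.smul hψ.continuous)).integrable_of_hasCompactSupport
      ((h.partialDeriv i).2.1.smul_right))
  · exact ((h.1.continuous.smul (contDiff_partialDeriv hψ i).continuous)).integrable_of_hasCompactSupport
      (h.2.1.smul_right)
  · exact (h.1.continuous.smul hψ.continuous).integrable_of_hasCompactSupport (h.2.1.smul_right)
  · exact fun x _ => h.1.differentiable (by simp) x
  · exact fun x _ => hψ.differentiable (by simp) x

theorem continuous_classicalGrad {ψ : Sp n → ℂ} (hψ : ContDiff ℝ ∞ ψ) :
    Continuous (classicalGrad ψ) :=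
  (PiLp.continuous_toLp 2 _).comp
    (continuous_pi fun i => (contDiff_partialDeriv hψ i).continuous)

theorem eLpNorm_component_le {m : Measure (Sp n)} (G : Sp n → EuclideanSpace ℂ (Fin n)) (i : Fin n) :
    eLpNorm (fun x => G x i) 2 m ≤ eLpNorm G 2 m :=
  eLpNorm_mono fun x => PiLp.norm_apply_le (G x) i

theorem aestronglyMeasurable_component {m : Measure (Sp n)} {G : Sp n → EuclideanSpace ℂ (Fin n)}
    (h : AEStronglyMeasurable G m) (i : Fin n) : AEStronglyMeasurable (fun x => G x i) m :=
  (by fun_prop : Continuous fun y : EuclideanSpace ℂ (Fin n) => y i).comp_aestronglyMeasurable h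

theorem memLp_component {m : Measure (Sp n)} {G : Sp n → EuclideanSpace ℂ (Fin n)}
    (h : MemLp G 2 m) (i : Fin n) : MemLp (fun x => G x i) 2 m :=
  ⟨aestronglyMeasurable_component h.1 i, (eLpNorm_component_le G i).trans_lt h.2⟩

/-- Limits in `L²` of smooth functions and of their gradients. -/
theorem hasWeakGrad_of_approx {Ω : Set (Sp n)} {φ : Sp n → ℂ}
    {G : Sp n → EuclideanSpace ℂ (Fin n)} (hφ : MemLp φ 2 (volume.restrict Ω))
    (hG : MemLp G 2 (volume.restrict Ω))
    (h : ∀ ε : ℝ≥0∞, 0 < ε → ∃ ψ : Sp n → ℂ, ContDiff ℝ ∞ ψ ∧ MemLp ψ 2 (volume.restrict Ω) ∧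
      MemLp (classicalGrad ψ) 2 (volume.restrict Ω) ∧
      eLpNorm (fun x => φ x - ψ x) 2 (volume.restrict Ω) ≤ ε ∧
      eLpNorm (fun x => G x - classicalGrad ψ x) 2 (volume.restrict Ω) ≤ ε) :
    HasWeakGrad Ω φ G := by
  refine ⟨hG, fun χ hχ i => ?_⟩
  rw [← sub_eq_zero, sub_neg_eq_add, ← enorm_eq_zero]
  have hχ1 := hχ.memLp 2 (volume.restrict Ω)
  have hχ2 := (hχ.partialDeriv i).memLp 2 (volume.restrict Ω)
  set C := eLpNorm (ScatLen.partialDeriv i χ) 2 (volume.restrict Ω)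
    + eLpNorm χ 2 (volume.restrict Ω) with hC
  have hC' : C ≠ ⊤ := ENNReal.add_ne_top.2 ⟨hχ2.2.ne, hχ1.2.ne⟩
  have key : ∀ ε : ℝ≥0∞, 0 < ε → ‖(∫ x in Ω, ScatLen.partialDeriv i χ x • φ x)
      + ∫ x in Ω, χ x • G x i‖ₑ ≤ C * ε := by
    intro ε hε
    obtain ⟨ψ, hψ, hψ2, hψ3, h1, h2⟩ := h ε hε
    have hGi := memLp_component hG i
    have hψi := memLp_component hψ3 i
    have e : (∫ x in Ω, ScatLen.partialDeriv i χ x • φ x) + ∫ x in Ω, χ x • G x i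
        = (∫ x in Ω, ScatLen.partialDeriv i χ x • (φ x - ψ x))
          + ∫ x in Ω, χ x • (G x i - classicalGrad ψ x i) := by
      simp_rw [smul_sub]
      rw [integral_sub (integrable_smul_of_memLp hχ2 hφ) (integrable_smul_of_memLp hχ2 hψ2),
        integral_sub (integrable_smul_of_memLp hχ1 hGi) (integrable_smul_of_memLp hχ1 hψi),
        hχ.integral_by_parts hψ i]
      simp only [classicalGrad]
      ring
    rw [e, hC, add_mul]
    refine (enorm_add_le _ _).trans (add_le_add ?_ ?_)
    · refine (enorm_integral_smul_le hχ2.1 (hφ.1.sub hψ2.1)).trans ?_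
      gcongr
      exact h1
    · refine (enorm_integral_smul_le hχ1.1 (hGi.1.sub hψi.1)).trans ?_
      gcongr
      exact (eLpNorm_component_le (fun x => G x - classicalGrad ψ x) i).trans h2
  refine le_antisymm (ENNReal.le_of_forall_pos_le_add fun ε hε _ => ?_) zero_le
  rw [zero_add]
  have hε' : (0 : ℝ≥0∞) < ε := by exact_mod_cast hε
  have hC1 : C + 1 ≠ ⊤ := ENNReal.add_ne_top.2 ⟨hC', by simp⟩
  refine (key (ε / (C + 1)) (ENNReal.div_pos hε'.ne' hC1)).trans ?_
  rw [mul_comm]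
  calc (ε : ℝ≥0∞) / (C + 1) * C ≤ ε / (C + 1) * (C + 1) := by gcongr; exact le_self_add
    _ = ε := ENNReal.div_mul_cancel (by simp) hC1

/-- The fundamental lemma of the calculus of variations, component by component. It frees all later
statements from the particular choice made in `weakGrad`. -/
theorem HasWeakGrad.ae_unique {Ω : Set (Sp n)} (hΩ : IsOpen Ω) {φ : Sp n → ℂ}
    {G G' : Sp n → EuclideanSpace ℂ (Fin n)} (h : HasWeakGrad Ω φ G) (h' : HasWeakGrad Ω φ G') :
    G =ᵐ[volume.restrict Ω] G' := by
  have hi : ∀ i, ∀ᵐ x ∂(volume.restrict Ω), G x i - G' x i = 0 := by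
    intro i
    have h1 := (memLp_component h.1 i).sub (memLp_component h'.1 i)
    have hl : LocallyIntegrableOn (fun x => G x i - G' x i) Ω volume :=
      locallyIntegrableOn_of_locallyIntegrable_restrict (h1.locallyIntegrable (by norm_num))
    rw [ae_restrict_iff' hΩ.measurableSet]
    refine hΩ.ae_eq_zero_of_integral_contDiff_smul_eq_zero hl fun g hg hg1 hg2 => ?_
    have ht : IsTestFun Ω g := ⟨hg, hg1, hg2⟩
    rw [← ht.setIntegral_eq]
    simp_rw [smul_sub]
    have hgm := ht.memLp 2 (volume.restrict Ω)
    rw [integral_sub (integrable_smul_of_memLp hgm (memLp_component h.1 i))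
      (integrable_smul_of_memLp hgm (memLp_component h'.1 i))]
    have e1 := h.2 g ht i
    have e2 := h'.2 g ht i
    rw [sub_eq_zero, ← neg_inj, ← e1, ← e2]
  filter_upwards [ae_all_iff.2 hi] with x hx
  ext i
  exact sub_eq_zero.1 (hx i)

theorem MemH1.hasWeakGrad {Ω : Set (Sp n)} {φ : Sp n → ℂ} (h : MemH1 Ω φ) :
    HasWeakGrad Ω φ (weakGrad Ω φ) := by
  unfold weakGrad
  rw [dif_pos h.2]
  exact h.2.choose_spec

theorem HasWeakGrad.weakGrad_ae {Ω : Set (Sp n)} (hΩ : IsOpen Ω) {φ : Sp n → ℂ}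
    {G : Sp n → EuclideanSpace ℂ (Fin n)} (hφ : MemLp φ 2 (volume.restrict Ω))
    (h : HasWeakGrad Ω φ G) : weakGrad Ω φ =ᵐ[volume.restrict Ω] G :=
  (MemH1.hasWeakGrad ⟨hφ, G, h⟩).ae_unique hΩ h

theorem integral_partialDeriv_smul_const {Ω : Set (Sp n)} {χ : Sp n → ℝ} (h : IsTestFun Ω χ)
    (i : Fin n) (c : ℂ) : ∫ x in Ω, ScatLen.partialDeriv i χ x • c = 0 := by
  rw [h.integral_by_parts (ψ := fun _ => c) contDiff_const i]
  simp [ScatLen.partialDeriv]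

theorem HasWeakGrad.add_const {Ω : Set (Sp n)} {φ : Sp n → ℂ}
    {G : Sp n → EuclideanSpace ℂ (Fin n)} (hφ : MemLp φ 2 (volume.restrict Ω))
    (h : HasWeakGrad Ω φ G) (c : ℂ) : HasWeakGrad Ω (fun x => φ x + c) G := by
  refine ⟨h.1, fun χ hχ i => ?_⟩
  have hχ2 := (hχ.partialDeriv i).memLp 2 (volume.restrict Ω)
  simp_rw [smul_add]
  rw [integral_add (integrable_smul_of_memLp hχ2 hφ), integral_partialDeriv_smul_const hχ,
    add_zero, h.2 χ hχ i]
  have := (hχ.partialDeriv i).1.continuous.smul (continuous_const (y := c))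
  exact (this.integrable_of_hasCompactSupport ((hχ.partialDeriv i).2.1.smul_right)).integrableOn

end WeakGrad

/-! ### Radial functions -/

section Radial

variable {n : ℕ}

instance (n : ℕ) (R : ℝ) : IsFiniteMeasure (radMeas n R) := by
  refine isFiniteMeasure_withDensity_ofReal ?_
  have : IntegrableOn (fun r : ℝ => r ^ (n - 1)) (Icc 0 R) :=
    (by fun_prop : Continuous fun r : ℝ => r ^ (n - 1)).continuousOn.integrableOn_Icc
  exact (this.mono_set Ioo_subset_Icc_self).2

theorem radMeas_compl (n : ℕ) (R : ℝ) : radMeas n R (Ioo 0 R)ᶜ = 0 := by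
  refine withDensity_absolutelyContinuous _ _ ?_
  rw [Measure.restrict_apply measurableSet_Ioo.compl]
  simp

theorem eLpNorm_two_sq {α : Type*} [MeasurableSpace α] {F : Type*} [NormedAddCommGroup F]
    {m : Measure α} (f : α → F) : eLpNorm f 2 m ^ 2 = ∫⁻ a, ‖f a‖ₑ ^ 2 ∂m := by
  have := eLpNorm_nnreal_pow_eq_lintegral (f := f) (μ := m) (p := 2) (by norm_num)
  simpa using this

theorem enorm_sq_ofReal (x : ℝ) : ‖x‖ₑ ^ 2 = ENNReal.ofReal (x ^ 2) := by
  rw [← ofReal_norm, ← ENNReal.ofReal_pow (norm_nonneg _), Real.norm_eq_abs, sq_abs]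

theorem lintegral_kin {R : ℝ} {γ : ℝ → ℝ} {N : ℕ}
    (hs : IntegrableOn (fun r => r ^ N * γ r ^ 2) (Ioo 0 R)) :
    ∫⁻ r in Ioo 0 R, ENNReal.ofReal (r ^ N) * ENNReal.ofReal (γ r ^ 2)
      = ENNReal.ofReal (kin N R γ) := by
  rw [kin, ofReal_integral_eq_lintegral_ofReal hs]
  · refine setLIntegral_congr_fun measurableSet_Ioo fun r hr => ?_
    rw [ENNReal.ofReal_mul (pow_nonneg hr.1.le _)]
  · filter_upwards [ae_restrict_mem measurableSet_Ioo] with r hr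
    have := hr.1.le
    positivity

theorem eLpNorm_radMeas_sq {R : ℝ} {γ : ℝ → ℝ}
    (hs : IntegrableOn (fun r => r ^ (n - 1) * γ r ^ 2) (Ioo 0 R)) :
    eLpNorm γ 2 (radMeas n R) ^ 2 = ENNReal.ofReal (kin (n - 1) R γ) := by
  rw [eLpNorm_two_sq, lintegral_radMeas, ← lintegral_kin hs]
  simp_rw [enorm_sq_ofReal]

theorem memLp_radMeas {R : ℝ} {γ : ℝ → ℝ}
    (hm : AEStronglyMeasurable γ (volume.restrict (Ioo 0 R)))
    (hs : IntegrableOn (fun r => r ^ (n - 1) * γ r ^ 2) (Ioo 0 R)) : MemLp γ 2 (radMeas n R) := by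
  refine ⟨hm.mono_ac (withDensity_absolutelyContinuous _ _), ?_⟩
  have h := eLpNorm_radMeas_sq hs
  by_contra h1
  rw [not_lt, top_le_iff] at h1
  rw [h1] at h
  simp at h

/-- First approximate on the line by a smooth `g` of compact support, then multiply by a cutoff that
is `1` on a compact `K ⊆ (a, b)` of almost full measure. Since `g` is bounded, what is cut away is
small in `L²`. -/
theorem exists_smooth_approx {m : Measure ℝ} [IsFiniteMeasure m] {a b : ℝ}
    (h0 : m (Ioo a b)ᶜ = 0) {γ : ℝ → ℝ} (hγ : MemLp γ 2 m) {ε : ℝ≥0∞} (hε : 0 < ε) :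
    ∃ η : ℝ → ℝ, ContDiff ℝ ∞ η ∧ HasCompactSupport η ∧ tsupport η ⊆ Ioo a b ∧
      eLpNorm (fun r => γ r - η r) 2 m ≤ ε := by
  wlog hε1 : ε ≠ ⊤ generalizing ε
  · obtain ⟨η, h1, h2, h3, h4⟩ := this zero_lt_one ENNReal.one_ne_top
    refine ⟨η, h1, h2, h3, ?_⟩
    rw [not_not.1 hε1]
    exact le_top
  have hε2 : 0 < ε.toReal / 2 := half_pos (ENNReal.toReal_pos hε.ne' hε1)
  obtain ⟨g, hgc, hgs, hg⟩ := hγ.exist_eLpNorm_sub_le (by norm_num) (by norm_num) hε2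
  obtain ⟨M, hM⟩ := hgc.exists_bound_of_continuous hgs.continuous
  have hM0 : 0 ≤ M := (norm_nonneg _).trans (hM 0)
  obtain ⟨η₀, hη₀, hind⟩ := exists_eLpNorm_indicator_le (μ := m) (p := 2) (by norm_num) M
    (ENNReal.ofReal_pos.2 hε2).ne'
  obtain ⟨K, hK, hKc, hKm⟩ := measurableSet_Ioo.exists_isCompact_sdiff_lt (μ := m) (A := Ioo a b)
    (measure_ne_top _ _) (ENNReal.coe_pos.2 hη₀).ne'
  obtain ⟨L, hLc, hKL, hL⟩ := exists_compact_between hKc isOpen_Ioo hK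
  obtain ⟨χ, hχ0, hχ1, hχ⟩ := exists_contMDiffMap_zero_one_of_isClosed (n := (⊤ : ℕ∞))
    (modelWithCornersSelf ℝ ℝ) (s := (interior L)ᶜ) (t := K) isOpen_interior.isClosed_compl
    hKc.isClosed (by rwa [disjoint_compl_left_iff_subset])
  have hsupp : tsupport (fun r => χ r * g r) ⊆ L := by
    refine closure_minimal (fun r hr => ?_) hLc.isClosed
    by_contra h
    have : χ r = 0 := hχ0 fun h' => h (interior_subset h')
    simp [this] at hr
  refine ⟨fun r => χ r * g r, χ.contMDiff.contDiff.mul hgs,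
    HasCompactSupport.intro hLc fun r hr =>
      image_eq_zero_of_notMem_tsupport (f := fun r => χ r * g r) fun h => hr (hsupp h),
    hsupp.trans hL, ?_⟩
  have e : (fun r => γ r - χ r * g r) = (γ - g) + fun r => (1 - χ r) * g r := by
    ext r; simp; ring
  have hχc : Continuous fun r => (1 - χ r) * g r :=
    (continuous_const.sub χ.contMDiff.contDiff.continuous).mul hgs.continuous
  rw [e]
  refine (eLpNorm_add_le (hγ.1.sub hgs.continuous.aestronglyMeasurable) hχc.aestronglyMeasurable
    (by norm_num)).trans ?_
  have h2 : eLpNorm (fun r => (1 - χ r) * g r) 2 m ≤ ENNReal.ofReal (ε.toReal / 2) := by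
    refine le_trans (eLpNorm_mono fun r => ?_) (hind Kᶜ ?_)
    · by_cases hr : r ∈ K
      · have : χ r = 1 := hχ1 hr
        simp [this, hr]
      · rw [indicator_of_mem hr, norm_mul, Real.norm_of_nonneg hM0]
        refine (mul_le_of_le_one_left (norm_nonneg _) ?_).trans (hM r)
        rw [Real.norm_eq_abs, abs_le]
        have := hχ r
        constructor <;> linarith [this.1, this.2]
    · have : Kᶜ ⊆ (Ioo a b)ᶜ ∪ (Ioo a b \ K) := fun r hr => by
        by_cases h : r ∈ Ioo a b
        · exact Or.inr ⟨h, hr⟩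
        · exact Or.inl h
      refine (measure_mono this).trans ((measure_union_le _ _).trans ?_)
      rw [h0, zero_add]
      exact hKm.le
  refine (add_le_add hg h2).trans ?_
  rw [← ENNReal.ofReal_add hε2.le hε2.le, add_halves, ENNReal.ofReal_toReal hε1]

/-- The radial vector field `γ(|x|) x / |x|`. -/
noncomputable def radGrad (γ : ℝ → ℝ) (x : Sp n) : EuclideanSpace ℂ (Fin n) :=
  WithLp.toLp 2 fun i => ((γ ‖x‖ * (x i / ‖x‖) : ℝ) : ℂ)

theorem norm_radGrad (γ : ℝ → ℝ) {x : Sp n} (hx : x ≠ 0) : ‖radGrad γ x‖ = |γ ‖x‖| := by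
  have h0 : ‖x‖ ≠ 0 := norm_ne_zero_iff.2 hx
  rw [← sq_eq_sq₀ (norm_nonneg _) (abs_nonneg _), EuclideanSpace.norm_sq_eq]
  simp only [radGrad, Complex.norm_real, Real.norm_eq_abs, sq_abs, mul_pow, div_pow]
  rw [← Finset.mul_sum, ← Finset.sum_div]
  have : ∑ i, x i ^ 2 = ‖x‖ ^ 2 := by
    rw [EuclideanSpace.norm_sq_eq]; simp
  rw [this, div_self (pow_ne_zero 2 h0), mul_one]

theorem norm_radGrad_le (γ : ℝ → ℝ) (x : Sp n) : ‖radGrad γ x‖ ≤ |γ ‖x‖| := by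
  by_cases hx : x = 0
  · subst hx
    have : radGrad γ (0 : Sp n) = 0 := by
      ext i; simp [radGrad]
    rw [this, norm_zero]
    exact abs_nonneg _
  · exact (norm_radGrad γ hx).le

theorem radGrad_sub (γ η : ℝ → ℝ) (x : Sp n) :
    radGrad γ x - radGrad η x = radGrad (fun r => γ r - η r) x := by
  ext i; simp [radGrad]; ring

/-- The radial function with radial derivative `γ` that vanishes for `|x| ≥ R`. -/
noncomputable def radLift (R : ℝ) (γ : ℝ → ℝ) (x : Sp n) : ℂ :=
  ((-∫ s in Ioo ‖x‖ R, γ s : ℝ) : ℂ)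

theorem radLift_eq_zero {R : ℝ} (γ : ℝ → ℝ) {x : Sp n} (hx : x ∉ ballR n R) :
    radLift R γ x = 0 := by
  have : R ≤ ‖x‖ := by simpa using hx
  simp [radLift, Ioo_eq_empty_of_le this]

theorem radLift_eq {R : ℝ} (γ : ℝ → ℝ) {x : Sp n} (hx : ‖x‖ ≤ R) :
    radLift R γ x = ((-∫ s in ‖x‖..R, γ s : ℝ) : ℂ) := by
  rw [radLift, intervalIntegral_eq_Ioo hx]

theorem aestronglyMeasurable_primitive {N : ℕ} {R : ℝ} {γ : ℝ → ℝ}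
    (hm : AEStronglyMeasurable γ (volume.restrict (Ioo 0 R)))
    (hs : IntegrableOn (fun r => r ^ N * γ r ^ 2) (Ioo 0 R)) :
    AEStronglyMeasurable (fun r => ∫ s in Ioo r R, γ s) (volume.restrict (Ioo 0 R)) := by
  have h := ((continuousOn_primitive_of_kin hm hs).mono Ioo_subset_Ioc_self).aestronglyMeasurable
    (μ := volume) measurableSet_Ioo
  refine h.congr ?_
  filter_upwards [ae_restrict_mem measurableSet_Ioo] with r hr
  rw [intervalIntegral_eq_Ioo hr.2.le]

theorem aestronglyMeasurable_radLift (hn : 1 ≤ n) {N : ℕ} {R : ℝ} {γ : ℝ → ℝ}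
    (hm : AEStronglyMeasurable γ (volume.restrict (Ioo 0 R)))
    (hs : IntegrableOn (fun r => r ^ N * γ r ^ 2) (Ioo 0 R)) :
    AEStronglyMeasurable (radLift R γ : Sp n → ℂ) (volume.restrict (ballR n R)) :=
  Complex.continuous_ofReal.comp_aestronglyMeasurable
    ((aestronglyMeasurable_primitive hm hs).comp_quasiMeasurePreserving
      (quasiMeasurePreserving_norm hn R)).neg

theorem aestronglyMeasurable_radGrad (hn : 1 ≤ n) {R : ℝ} {γ : ℝ → ℝ}
    (hm : AEStronglyMeasurable γ (volume.restrict (Ioo 0 R))) :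
    AEStronglyMeasurable (radGrad γ : Sp n → EuclideanSpace ℂ (Fin n))
      (volume.restrict (ballR n R)) := by
  have h1 := hm.comp_quasiMeasurePreserving (quasiMeasurePreserving_norm hn R)
  have h2 : AEMeasurable (fun x : Sp n => fun i => ((γ ‖x‖ * (x i / ‖x‖) : ℝ) : ℂ))
      (volume.restrict (ballR n R)) := by
    refine aemeasurable_pi_lambda _ fun i => ?_
    refine Complex.measurable_ofReal.comp_aemeasurable (h1.aemeasurable.mul ?_)
    have : Measurable fun x : Sp n => x i / ‖x‖ :=
      (by fun_prop : Measurable fun x : Sp n => x i).div measurable_norm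
    exact this.aemeasurable
  exact ((PiLp.continuous_toLp 2 _).measurable.comp_aemeasurable h2).aestronglyMeasurable

theorem eLpNorm_radGrad_sq_le (hn : 1 ≤ n) {R : ℝ} {γ : ℝ → ℝ}
    (hm : AEStronglyMeasurable γ (volume.restrict (Ioo 0 R)))
    (hs : IntegrableOn (fun r => r ^ (n - 1) * γ r ^ 2) (Ioo 0 R)) :
    eLpNorm (radGrad γ : Sp n → _) 2 (volume.restrict (ballR n R)) ^ 2
      ≤ ENNReal.ofReal (sphereArea n) * ENNReal.ofReal (kin (n - 1) R γ) := by
  have h1 : eLpNorm (radGrad γ : Sp n → _) 2 (volume.restrict (ballR n R)) ≤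
      eLpNorm (fun x : Sp n => γ ‖x‖) 2 (volume.restrict (ballR n R)) :=
    eLpNorm_mono fun x => norm_radGrad_le γ x
  refine (pow_le_pow_left₀ zero_le h1 2).trans (le_of_eq ?_)
  rw [eLpNorm_two_sq, ← lintegral_kin hs, ← lintegral_radial hn
    ((hm.aemeasurable.pow_const 2).ennreal_ofReal)]
  simp_rw [enorm_sq_ofReal]

theorem pow_mul_sq_primitive_le {N : ℕ} {R r : ℝ} {γ : ℝ → ℝ}
    (hm : AEStronglyMeasurable γ (volume.restrict (Ioo 0 R)))
    (hs : IntegrableOn (fun r => r ^ N * γ r ^ 2) (Ioo 0 R)) (hr : r ∈ Ioo 0 R) :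
    r ^ N * (∫ s in Ioo r R, γ s) ^ 2 ≤ R * kin N R γ := by
  have h1 := sq_intervalIntegral_le_kin hr.1 hr.2.le hm hs
  rw [intervalIntegral_eq_Ioo hr.2.le] at h1
  have h2 : ∫ s in Ioo r R, (s ^ N)⁻¹ ≤ (r ^ N)⁻¹ * R := by
    have : ∫ s in Ioo r R, (s ^ N)⁻¹ ≤ ∫ s in Ioo r R, (r ^ N)⁻¹ := by
      refine setIntegral_mono_on (integrableOn_inv_pow N hr.1 R) (by simp) measurableSet_Ioo
        fun s hs => ?_
      have := hr.1
      gcongr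
      exact hs.1.le
    refine this.trans ?_
    rw [setIntegral_const, smul_eq_mul, mul_comm]
    have h0 := hr.1
    gcongr
    simp [measureReal_def, hr.2.le, hr.1.le]
  have h0 := kin_nonneg N R γ
  have hp : 0 < r ^ N := pow_pos hr.1 N
  calc r ^ N * (∫ s in Ioo r R, γ s) ^ 2 ≤ r ^ N * ((r ^ N)⁻¹ * R * kin N R γ) := by
        gcongr
        exact h1.trans (by gcongr)
    _ = R * kin N R γ := by field_simp

theorem eLpNorm_radLift_sq_le (hn : 1 ≤ n) {R : ℝ} (hR : 0 ≤ R) {γ : ℝ → ℝ}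
    (hm : AEStronglyMeasurable γ (volume.restrict (Ioo 0 R)))
    (hs : IntegrableOn (fun r => r ^ (n - 1) * γ r ^ 2) (Ioo 0 R)) :
    eLpNorm (radLift R γ : Sp n → ℂ) 2 (volume.restrict (ballR n R)) ^ 2
      ≤ ENNReal.ofReal (sphereArea n) * ENNReal.ofReal (R ^ 2 * kin (n - 1) R γ) := by
  have h1 : ∀ x : Sp n, ‖radLift R γ x‖ₑ ^ 2 = ENNReal.ofReal ((∫ s in Ioo ‖x‖ R, γ s) ^ 2) := by
    intro x
    rw [← ofReal_norm, ← ENNReal.ofReal_pow (norm_nonneg _), radLift, Complex.norm_real,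
      Real.norm_eq_abs, sq_abs, neg_sq]
  rw [eLpNorm_two_sq]
  simp_rw [h1]
  rw [lintegral_radial hn (F := fun r => ENNReal.ofReal ((∫ s in Ioo r R, γ s) ^ 2))
    (((aestronglyMeasurable_primitive hm hs).aemeasurable.pow_const 2).ennreal_ofReal)]
  gcongr
  calc _ ≤ ∫⁻ r in Ioo 0 R, ENNReal.ofReal (R * kin (n - 1) R γ) := by
        refine setLIntegral_mono measurable_const fun r hr => ?_
        rw [← ENNReal.ofReal_mul (pow_nonneg hr.1.le _)]
        exact ENNReal.ofReal_le_ofReal (pow_mul_sq_primitive_le hm hs hr)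
    _ = _ := by
        rw [setLIntegral_const, Real.volume_Ioo, sub_zero,
          ← ENNReal.ofReal_mul (mul_nonneg hR (kin_nonneg _ _ _))]
        ring_nf

theorem radLift_sub {N : ℕ} {R : ℝ} {γ η : ℝ → ℝ}
    (hm : AEStronglyMeasurable γ (volume.restrict (Ioo 0 R)))
    (hs : IntegrableOn (fun r => r ^ N * γ r ^ 2) (Ioo 0 R)) (hη : Continuous η) {x : Sp n}
    (hx : x ≠ 0) : radLift R γ x - radLift R η x = radLift R (fun r => γ r - η r) x := by
  simp only [radLift]
  rw [integral_sub (integrableOn_Ioo_of_kin (norm_pos_iff.2 hx) hm hs)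
    ((hη.continuousOn.integrableOn_Icc).mono_set Ioo_subset_Icc_self)]
  push_cast
  ring

theorem radLift_smooth_eq {R : ℝ} {η : ℝ → ℝ} (hs : tsupport η ⊆ Ioo 0 R) (x : Sp n) :
    radLift R η x = ((∫ s in R..‖x‖, η s : ℝ) : ℂ) := by
  rcases le_total ‖x‖ R with h | h
  · rw [radLift_eq η h, intervalIntegral.integral_symm ‖x‖ R]
  · rw [radLift, Ioo_eq_empty_of_le h, setIntegral_empty, neg_zero,
      intervalIntegral.integral_of_le h,
      setIntegral_eq_zero_of_forall_eq_zero fun s hs' => image_eq_zero_of_notMem_tsupport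
        fun h' => absurd (hs h').2 (not_lt.2 hs'.1.le)]

theorem hasFDerivAt_norm {x : Sp n} (hx : x ≠ 0) :
    HasFDerivAt (fun y : Sp n => ‖y‖) (‖x‖⁻¹ • innerSL ℝ x) x := by
  have h := ((hasStrictFDerivAt_norm_sq x).hasFDerivAt.sqrt
    (pow_ne_zero 2 (norm_ne_zero_iff.2 hx)))
  have h0 : 0 < ‖x‖ := norm_pos_iff.2 hx
  simp only [Real.sqrt_sq (norm_nonneg _)] at h
  have e : (1 / (2 * ‖x‖)) • 2 • innerSL ℝ x = ‖x‖⁻¹ • innerSL ℝ x := by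
    rw [← Nat.cast_smul_eq_nsmul ℝ, smul_smul]
    congr 1
    push_cast
    field_simp
  rwa [e] at h

/-- A derivative supported inside `(0, R)` makes the lift constant near the origin, where the norm
is not smooth, and zero near the sphere. -/
theorem radLift_test {R : ℝ} {η : ℝ → ℝ} (hη : ContDiff ℝ ∞ η) (hs : tsupport η ⊆ Ioo 0 R) :
    IsTestFun (ballR n R) (radLift R η : Sp n → ℂ) ∧
      classicalGrad (radLift R η : Sp n → ℂ) = radGrad η := by
  set P : ℝ → ℝ := fun t => ∫ s in R..t, η s with hP
  have hPd : ∀ t, HasDerivAt P (η t) t := fun t =>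
    (hη.continuous.integral_hasStrictDerivAt R t).hasDerivAt
  have hPs : ContDiff ℝ ∞ P := by
    rw [contDiff_infty_iff_deriv]
    refine ⟨fun t => (hPd t).differentiableAt, ?_⟩
    rwa [show deriv P = η from funext fun t => (hPd t).deriv]
  have hL : (radLift R η : Sp n → ℂ) = fun x => ((P ‖x‖ : ℝ) : ℂ) :=
    funext fun x => radLift_smooth_eq hs x
  obtain ⟨δ, hδ, hδ0⟩ := Metric.mem_nhds_iff.1 ((isClosed_tsupport η).isOpen_compl.mem_nhds
    (show (0 : ℝ) ∈ (tsupport η)ᶜ from fun h => lt_irrefl _ (hs h).1))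
  obtain ⟨ρ, hρ, hρR⟩ := Metric.mem_nhds_iff.1 ((isClosed_tsupport η).isOpen_compl.mem_nhds
    (show R ∈ (tsupport η)ᶜ from fun h => lt_irrefl _ (hs h).2))
  have hnear : (radLift R η : Sp n → ℂ) =ᶠ[𝓝 0] fun _ => ((P 0 : ℝ) : ℂ) := by
    rw [hL]
    filter_upwards [Metric.ball_mem_nhds (0 : Sp n) hδ] with x hx
    have hx' : ‖x‖ < δ := by simpa using hx
    have : ∫ s in (0 : ℝ)..‖x‖, η s = 0 := by
      rw [intervalIntegral.integral_of_le (norm_nonneg _)]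
      refine setIntegral_eq_zero_of_forall_eq_zero fun s hs' =>
        image_eq_zero_of_notMem_tsupport (hδ0 ?_)
      rw [Metric.mem_ball, dist_zero_right, Real.norm_of_nonneg hs'.1.le]
      exact hs'.2.trans_lt hx'
    have h2 := intervalIntegral.integral_add_adjacent_intervals (hη.continuous.intervalIntegrable (μ := volume) R 0)
      (hη.continuous.intervalIntegrable 0 ‖x‖)
    rw [this, add_zero] at h2
    rw [hP]; simp only; rw [h2]
  have hsmooth : ContDiff ℝ ∞ (radLift R η : Sp n → ℂ) := by
    rw [contDiff_iff_contDiffAt]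
    intro x
    by_cases hx : x = 0
    · subst hx
      exact contDiffAt_const.congr_of_eventuallyEq hnear
    · rw [hL]
      exact Complex.ofRealCLM.contDiff.contDiffAt.comp x
        (hPs.contDiffAt.comp x (contDiffAt_norm ℝ hx))
  have hsub : tsupport (radLift R η : Sp n → ℂ) ⊆ Metric.closedBall 0 (R - ρ) := by
    refine closure_minimal (fun x hx => ?_) Metric.isClosed_closedBall
    by_contra h
    have h' : R - ρ < ‖x‖ := by simpa using h
    refine hx ?_
    by_cases hb : x ∈ ballR n R
    · rw [radLift, setIntegral_eq_zero_of_forall_eq_zero fun s hs' =>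
        image_eq_zero_of_notMem_tsupport (hρR ?_)]
      · simp
      · rw [Metric.mem_ball, Real.dist_eq, abs_lt]
        constructor <;> linarith [hs'.1, hs'.2]
    · exact radLift_eq_zero η hb
  refine ⟨⟨hsmooth, HasCompactSupport.intro (isCompact_closedBall 0 (R - ρ)) fun x hx =>
    image_eq_zero_of_notMem_tsupport fun h => hx (hsub h),
    hsub.trans (Metric.closedBall_subset_ball (by linarith))⟩, ?_⟩
  ext x i
  by_cases hx : x = 0
  · subst hx
    simp [classicalGrad, partialDeriv, hnear.fderiv_eq, radGrad]
  · have h1 := ((Complex.ofRealCLM.hasFDerivAt).comp x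
      ((hPd ‖x‖).comp_hasFDerivAt x (hasFDerivAt_norm hx)))
    have h2 : fderiv ℝ (radLift R η : Sp n → ℂ) x =
        Complex.ofRealCLM.comp (η ‖x‖ • ‖x‖⁻¹ • innerSL ℝ x) := by
      rw [hL]; exact h1.fderiv
    simp only [classicalGrad, partialDeriv, h2, radGrad]
    simp [EuclideanSpace.inner_single_right]
    left
    ring

/-- Approximate only the derivative, in `L²(r^(n-1) dr)`: both the lift and its gradient depend on
it linearly and boundedly. This yields membership in `H¹₀` and the weak gradient on any set at the
same time. -/
theorem exists_testFun_radLift (hn : 1 ≤ n) {R : ℝ} (hR : 0 ≤ R) {γ : ℝ → ℝ}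
    (hm : AEStronglyMeasurable γ (volume.restrict (Ioo 0 R)))
    (hs : IntegrableOn (fun r => r ^ (n - 1) * γ r ^ 2) (Ioo 0 R)) {ε : ℝ≥0∞} (hε : 0 < ε) :
    ∃ ψ : Sp n → ℂ, IsTestFun (ballR n R) ψ ∧
      eLpNorm (fun x => radLift R γ x - ψ x) 2 volume ≤ ε ∧
      eLpNorm (fun x => (ballR n R).indicator (radGrad γ) x - classicalGrad ψ x) 2 volume ≤ ε := by
  -- One constant for both bounds: the squared norms of lift and gradient are at most `R²`,
  -- respectively `1`, times `sphereArea n` times the kinetic energy.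
  set K := ENNReal.ofReal (sphereArea n) * ENNReal.ofReal (1 + R ^ 2) with hK
  have hK1 : 1 + K ≠ ⊤ :=
    ENNReal.add_ne_top.2 ⟨by simp, ENNReal.mul_ne_top ENNReal.ofReal_ne_top ENNReal.ofReal_ne_top⟩
  obtain ⟨η, h1, h2, h3, h4⟩ := exists_smooth_approx (radMeas_compl n R) (memLp_radMeas hm hs)
    (ENNReal.div_pos hε.ne' hK1)
  obtain ⟨ht, hg⟩ := radLift_test (n := n) h1 h3
  have hηs : IntegrableOn (fun r => r ^ (n - 1) * η r ^ 2) (Ioo 0 R) :=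
    ((by have := h1.continuous; fun_prop : Continuous fun r => r ^ (n - 1) * η r ^ 2).continuousOn.integrableOn_Icc).mono_set
      Ioo_subset_Icc_self
  have hdm : AEStronglyMeasurable (fun r => γ r - η r) (volume.restrict (Ioo 0 R)) :=
    hm.sub h1.continuous.aestronglyMeasurable
  have hds : IntegrableOn (fun r => r ^ (n - 1) * (γ r - η r) ^ 2) (Ioo 0 R) := by
    have := integrable_weighted_sq_add (m := volume.restrict (Ioo 0 R)) (W := fun r => r ^ (n - 1))
      (x := γ) (y := fun r => -η r) ?_ ?_ hs (by simp only [neg_sq]; exact hηs)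
    · simp only [sub_eq_add_neg]; exact this
    · filter_upwards [ae_pow_pos (n - 1) le_rfl R] with r hr using hr.le
    · exact (by fun_prop : Continuous fun r : ℝ => r ^ (n - 1)).aestronglyMeasurable.mul
        (hm.mul h1.continuous.neg.aestronglyMeasurable)
  have hsq : ENNReal.ofReal (kin (n - 1) R fun r => γ r - η r) ≤ (ε / (1 + K)) ^ 2 := by
    rw [← eLpNorm_radMeas_sq hds]
    gcongr
  have hfin : ∀ y : ℝ≥0∞, y ^ 2 ≤ K * ENNReal.ofReal (kin (n - 1) R fun r => γ r - η r) → y ≤ ε := by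
    intro y hy
    have h5 : y ^ 2 ≤ ε ^ 2 := calc
      y ^ 2 ≤ (1 + K) ^ 2 * (ε / (1 + K)) ^ 2 := by
        refine hy.trans (mul_le_mul' ?_ hsq)
        calc K ≤ 1 + K := le_add_self
          _ = (1 + K) * 1 := (mul_one _).symm
          _ ≤ (1 + K) * (1 + K) := by gcongr; exact le_self_add
          _ = (1 + K) ^ 2 := (sq _).symm
      _ = ε ^ 2 := by
        rw [← mul_pow, ENNReal.mul_div_cancel (by simp) hK1]
    exact (ENNReal.pow_le_pow_left_iff two_ne_zero).1 h5
  have hsph : Nonempty (Fin n) := ⟨⟨0, hn⟩⟩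
  have hne : ∀ᵐ x : Sp n, x ≠ 0 := by
    simp [ae_iff]
  refine ⟨radLift R η, ht, hfin _ ?_, hfin _ ?_⟩
  · have e : eLpNorm (fun x : Sp n => radLift R γ x - radLift R η x) 2 volume
        = eLpNorm (radLift R fun r => γ r - η r : Sp n → ℂ) 2 (volume.restrict (ballR n R)) := by
      rw [← eLpNorm_indicator_eq_eLpNorm_restrict Metric.isOpen_ball.measurableSet]
      refine eLpNorm_congr_ae ?_
      filter_upwards [hne] with x hx
      rw [radLift_sub hm hs h1.continuous hx]
      by_cases hb : x ∈ ballR n R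
      · rw [indicator_of_mem hb]
      · rw [indicator_of_notMem hb, radLift_eq_zero _ hb]
    rw [e]
    refine (eLpNorm_radLift_sq_le hn hR hdm hds).trans ?_
    rw [hK, mul_assoc, ← ENNReal.ofReal_mul (show (0 : ℝ) ≤ 1 + R ^ 2 by positivity)]
    gcongr
    · exact kin_nonneg _ _ _
    · linarith
  · have e : eLpNorm (fun x : Sp n => (ballR n R).indicator (radGrad γ) x - radGrad η x) 2 volume
        = eLpNorm (radGrad fun r => γ r - η r : Sp n → _) 2 (volume.restrict (ballR n R)) := by
      rw [← eLpNorm_indicator_eq_eLpNorm_restrict Metric.isOpen_ball.measurableSet]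
      congr 1
      ext1 x
      by_cases hb : x ∈ ballR n R
      · rw [indicator_of_mem hb, indicator_of_mem hb, radGrad_sub]
      · have : η ‖x‖ = 0 := image_eq_zero_of_notMem_tsupport fun h => hb (by simpa using (h3 h).2)
        rw [indicator_of_notMem hb, indicator_of_notMem hb, zero_sub, neg_eq_zero]
        ext i
        simp [radGrad, this]
    rw [hg, e]
    refine (eLpNorm_radGrad_sq_le hn hdm hds).trans ?_
    rw [hK, mul_assoc, ← ENNReal.ofReal_mul (show (0 : ℝ) ≤ 1 + R ^ 2 by positivity)]
    gcongr
    nlinarith [kin_nonneg (n - 1) R fun r => γ r - η r, sq_nonneg R,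
      mul_nonneg (sq_nonneg R) (kin_nonneg (n - 1) R fun r => γ r - η r)]

theorem hasWeakGrad_radLift (hn : 1 ≤ n) {R : ℝ} (hR : 0 ≤ R) {γ : ℝ → ℝ}
    (hm : AEStronglyMeasurable γ (volume.restrict (Ioo 0 R)))
    (hs : IntegrableOn (fun r => r ^ (n - 1) * γ r ^ 2) (Ioo 0 R)) (Ω : Set (Sp n)) :
    MemLp (radLift R γ : Sp n → ℂ) 2 (volume.restrict Ω) ∧
      HasWeakGrad Ω (radLift R γ) ((ballR n R).indicator (radGrad γ)) := by
  have hb : MeasurableSet (ballR n R) := Metric.isOpen_ball.measurableSet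
  have e1 : (radLift R γ : Sp n → ℂ) = (ballR n R).indicator (radLift R γ) :=
    funext fun x => by
      by_cases h : x ∈ ballR n R
      · rw [indicator_of_mem h]
      · rw [indicator_of_notMem h, radLift_eq_zero γ h]
  have h1 : MemLp (radLift R γ : Sp n → ℂ) 2 volume := by
    rw [e1, memLp_indicator_iff_restrict hb]
    refine ⟨aestronglyMeasurable_radLift hn hm hs, ?_⟩
    have := (eLpNorm_radLift_sq_le hn hR hm hs).trans_lt
      (ENNReal.mul_lt_top ENNReal.ofReal_lt_top ENNReal.ofReal_lt_top)
    by_contra h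
    rw [not_lt, top_le_iff] at h
    simp [h] at this
  have h2 : MemLp ((ballR n R).indicator (radGrad γ)) 2 (volume : Measure (Sp n)) := by
    rw [memLp_indicator_iff_restrict hb]
    refine ⟨aestronglyMeasurable_radGrad hn hm, ?_⟩
    have := (eLpNorm_radGrad_sq_le hn hm hs).trans_lt
      (ENNReal.mul_lt_top ENNReal.ofReal_lt_top ENNReal.ofReal_lt_top)
    by_contra h
    rw [not_lt, top_le_iff] at h
    simp [h] at this
  refine ⟨h1.restrict Ω, hasWeakGrad_of_approx (h1.restrict Ω) (h2.restrict Ω) fun ε hε => ?_⟩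
  obtain ⟨ψ, hψ, h3, h4⟩ := exists_testFun_radLift hn hR hm hs hε
  have hc : HasCompactSupport (classicalGrad ψ) := by
    refine HasCompactSupport.of_support_subset_isCompact hψ.2.1 fun x hx => ?_
    by_contra h
    refine hx ?_
    ext i
    exact partialDeriv_eq_zero h i
  exact ⟨ψ, hψ.1, hψ.memLp 2 _, (continuous_classicalGrad hψ.1).memLp_of_hasCompactSupport hc,
    (eLpNorm_mono_measure _ Measure.restrict_le_self).trans h3,
    (eLpNorm_mono_measure _ Measure.restrict_le_self).trans h4⟩

theorem weakGrad_radLift (hn : 1 ≤ n) {R : ℝ} (hR : 0 ≤ R) {γ : ℝ → ℝ}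
    (hm : AEStronglyMeasurable γ (volume.restrict (Ioo 0 R)))
    (hs : IntegrableOn (fun r => r ^ (n - 1) * γ r ^ 2) (Ioo 0 R)) {Ω : Set (Sp n)}
    (hΩ : IsOpen Ω) : weakGrad Ω (radLift R γ) =ᵐ[volume.restrict Ω]
      (ballR n R).indicator (radGrad γ) :=
  (hasWeakGrad_radLift hn hR hm hs Ω).2.weakGrad_ae hΩ (hasWeakGrad_radLift hn hR hm hs Ω).1

theorem memH10_radLift (hn : 1 ≤ n) {R : ℝ} (hR : 0 ≤ R) {γ : ℝ → ℝ}
    (hm : AEStronglyMeasurable γ (volume.restrict (Ioo 0 R)))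
    (hs : IntegrableOn (fun r => r ^ (n - 1) * γ r ^ 2) (Ioo 0 R)) :
    MemH10 (ballR n R) (radLift R γ : Sp n → ℂ) := by
  obtain ⟨h1, h2⟩ := hasWeakGrad_radLift hn hR hm hs (ballR n R)
  refine ⟨⟨h1, _, h2⟩, fun ε hε => ?_⟩
  obtain ⟨ψ, hψ, h3, h4⟩ := exists_testFun_radLift hn hR hm hs hε
  refine ⟨ψ, hψ, (eLpNorm_mono_measure _ Measure.restrict_le_self).trans h3,
    le_trans (le_of_eq ?_)
      ((eLpNorm_mono_measure _ (Measure.restrict_le_self (s := ballR n R))).trans h4)⟩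
  refine eLpNorm_congr_ae ?_
  filter_upwards [weakGrad_radLift hn hR hm hs (Ω := ballR n R) Metric.isOpen_ball] with x hx
  rw [hx]

end Radial

/-! ### The radial potential -/

section Potential

variable {n : ℕ} {μ : ℝ} {v : ℝ → ℝ}

theorem integrable_comp_norm_iff (hn : 1 ≤ n) {F : ℝ → ℝ} :
    Integrable (fun x : Sp n => F ‖x‖) ↔ IntegrableOn (fun r => r ^ (n - 1) * F r) (Ioi 0) := by
  have : Nonempty (Fin n) := ⟨⟨0, hn⟩⟩
  have h := integrable_fun_norm_addHaar (volume : Measure (Sp n)) (f := F)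
  rw [finrank_Sp] at h
  simpa only [smul_eq_mul] using h

/-- The closed annulus with radii `s` and `R` is a compact set that avoids the origin; polar
coordinates turn integrability there into integrability of `r^(n-1) v`. -/
theorem integrableOn_potV (hn : 1 ≤ n) (μ : ℝ)
    (hloc : LocallyIntegrableOn (fun x : Sp n => v ‖x‖) {x | x ≠ 0} volume) (s R : ℝ)
    (hs : 0 < s) : IntegrableOn (potV n μ v) (Ioo s R) := by
  have hc : IsCompact (Metric.closedBall (0 : Sp n) R ∩ {x | s ≤ ‖x‖}) :=
    (isCompact_closedBall _ _).inter_right (isClosed_le continuous_const continuous_norm)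
  have h1 := hloc.integrableOn_compact_subset (fun x hx => by
    have := hs.trans_le hx.2
    exact norm_pos_iff.1 this) hc
  rw [← integrable_indicator_iff hc.measurableSet] at h1
  have e : (Metric.closedBall (0 : Sp n) R ∩ {x | s ≤ ‖x‖}).indicator (fun x : Sp n => v ‖x‖)
      = fun x => (Icc s R).indicator v ‖x‖ := by
    ext x
    by_cases h : x ∈ Metric.closedBall (0 : Sp n) R ∩ {x | s ≤ ‖x‖}
    · have h' : ‖x‖ ∈ Icc s R := ⟨h.2, by simpa using h.1⟩
      rw [indicator_of_mem h, indicator_of_mem h']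
    · rw [indicator_of_notMem h, indicator_of_notMem fun h' => h ⟨by simpa using h'.2, h'.1⟩]
  rw [e, integrable_comp_norm_iff hn] at h1
  have h2 := (h1.mono_set (fun r hr => hs.trans hr.1 : Ioo s R ⊆ Ioi 0)).div_const (2 * μ)
  refine IntegrableOn.congr_fun h2 (fun r hr => ?_) measurableSet_Ioo
  simp only [potV]
  rw [indicator_of_mem (Ioo_subset_Icc_self hr)]

theorem aestronglyMeasurable_potV (hn : 1 ≤ n) (μ : ℝ)
    (hloc : LocallyIntegrableOn (fun x : Sp n => v ‖x‖) {x | x ≠ 0} volume) :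
    AEStronglyMeasurable (potV n μ v) (volume.restrict (Ioi 0)) := by
  have e : Ioi (0 : ℝ) = ⋃ k : ℕ, Ioo (1 / ((k : ℝ) + 1)) k := by
    ext r
    simp only [mem_iUnion, mem_Ioo, mem_Ioi]
    constructor
    · intro hr
      obtain ⟨k, hk⟩ := exists_nat_one_div_lt hr
      obtain ⟨l, hl⟩ := exists_nat_gt r
      refine ⟨max k l, ?_, hl.trans_le (by exact_mod_cast le_max_right k l)⟩
      refine lt_of_le_of_lt ?_ hk
      gcongr
      exact le_max_left k l
    · rintro ⟨k, hk, -⟩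
      exact lt_trans (by positivity) hk
  rw [e, aestronglyMeasurable_iUnion_iff]
  exact fun k => (integrableOn_potV hn μ hloc _ _ (by positivity)).aestronglyMeasurable

theorem aestronglyMeasurable_of_potV (hμ : 0 < μ)
    (h : AEStronglyMeasurable (potV n μ v) (volume.restrict (Ioi 0))) :
    AEStronglyMeasurable v (volume.restrict (Ioi 0)) := by
  have h1 : AEStronglyMeasurable (fun r : ℝ => 2 * μ * (r ^ (n - 1))⁻¹) (volume.restrict (Ioi 0)) :=
    (by fun_prop : Measurable fun r : ℝ => 2 * μ * (r ^ (n - 1))⁻¹).aestronglyMeasurable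
  refine (h1.mul h).congr ?_
  filter_upwards [ae_restrict_mem measurableSet_Ioi] with r hr
  have : r ^ (n - 1) ≠ 0 := pow_ne_zero _ (ne_of_gt hr)
  simp only [Pi.mul_apply, potV]
  field_simp

theorem exists_negBounded (hn : 1 ≤ n) (hμ : 0 < μ)
    (hloc : LocallyIntegrableOn (fun x : Sp n => v ‖x‖) {x | x ≠ 0} volume)
    (hneg : NegPartCondition n v) :
    (∀ R, 0 < R → ∃ C, NegBounded (n - 1) (potV n μ v) R C) ∧
      ∃ R, 0 < R ∧ ∀ R', 0 < R' → R' ≤ R → NegBounded (n - 1) (potV n μ v) R' (1 / 2) := by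
  have hVm := aestronglyMeasurable_potV hn μ hloc
  rcases (show n = 1 ∨ n = 2 ∨ 3 ≤ n by omega) with rfl | rfl | h3
  · have h := (integrable_comp_norm_iff le_rfl (F := fun r => max (-v r) 0)).1
      (memLp_one_iff_integrable.1 (hneg.1 rfl))
    obtain ⟨M, hM⟩ := negBounded_one hμ hVm (by simpa using h)
    refine ⟨fun R hR => ⟨_, hM R hR⟩, 1 / (2 * (|M| + 1)), by positivity, fun R' h0 hR' =>
      (hM R' h0).mono ?_⟩
    calc R' * M ≤ R' * (|M| + 1) := by gcongr; linarith [le_abs_self M]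
      _ ≤ 1 / (2 * (|M| + 1)) * (|M| + 1) := by gcongr
      _ = 1 / 2 := by field_simp
  · obtain ⟨ε, hε, hm⟩ := hneg.2.1 rfl
    have h1 := hm.integrable_norm_rpow (by simp; linarith) (by simp)
    rw [ENNReal.toReal_ofReal (by linarith)] at h1
    have h := (integrable_comp_norm_iff hn (F := fun r => ‖max (-v r) 0‖ ^ (1 + ε))).1 h1
    obtain ⟨M, δ, hδ, hM⟩ := negBounded_two hμ hε hVm (by
      refine h.congr (Eventually.of_forall fun r => ?_)
      simp [abs_of_nonneg])
    refine ⟨fun R hR => ⟨_, hM R hR⟩, (1 / (2 * (|M| + 1))) ^ δ⁻¹, by positivity, fun R' h0 hR' =>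
      (hM R' h0).mono ?_⟩
    calc R' ^ δ * M ≤ R' ^ δ * (|M| + 1) := by gcongr; linarith [le_abs_self M]
      _ ≤ ((1 / (2 * (|M| + 1))) ^ δ⁻¹) ^ δ * (|M| + 1) := by gcongr
      _ = 1 / 2 := by
        rw [← Real.rpow_mul (by positivity), inv_mul_cancel₀ hδ.ne', Real.rpow_one]
        field_simp
  · have hm := hneg.2.2 h3
    have h3' : (0 : ℝ) < n := by exact_mod_cast hn
    have h1 := hm.integrable_norm_rpow (by simp; linarith) (by simp)
    rw [ENNReal.toReal_ofReal (by linarith)] at h1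
    have h := (integrable_comp_norm_iff hn (F := fun r => ‖max (-v r) 0‖ ^ ((n : ℝ) / 2))).1 h1
    have hv : IntegrableOn (fun r => r ^ (n - 1) * max (-v r) 0 ^ ((n : ℝ) / 2)) (Ioi 0) := by
      refine h.congr (Eventually.of_forall fun r => ?_)
      simp [abs_of_nonneg]
    have hb := fun (ε : ℝ) (hε : 0 < ε) (R : ℝ) => negBounded_ge_three h3 hμ hε hVm hv (R := R)
    refine ⟨fun R _ => ⟨_, hb 1 one_pos R⟩, ?_⟩
    -- With this `ε` the low part contributes `1/4`; the radius is then taken so small that the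
    -- `L^(n/2)` integral is below `μ / (4 D)`, for another `1/4`.
    set ε := μ / 8 with hε
    have hε0 : 0 < ε := by positivity
    set D := ε ^ (1 - (n : ℝ) / 2) with hD
    have hD0 : 0 < D := Real.rpow_pos_of_pos hε0 _
    have ht : Tendsto (fun R : ℝ => ∫ r in Ioo 0 R, r ^ (n - 1) * max (-v r) 0 ^ ((n : ℝ) / 2)
        ∂(volume.restrict (Ioi 0))) (𝓝[>] 0) (𝓝 0) := by
      refine hv.tendsto_setIntegral_nhds_zero ?_
      refine tendsto_of_tendsto_of_tendsto_of_le_of_le tendsto_const_nhds ?_ (fun _ => zero_le)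
        (fun R => (Measure.restrict_apply_le _ _).trans_eq Real.volume_Ioo)
      have : Tendsto (fun R : ℝ => ENNReal.ofReal (R - 0)) (𝓝 0) (𝓝 (ENNReal.ofReal (0 - 0))) :=
        ENNReal.tendsto_ofReal (tendsto_id.sub_const 0)
      simp only [sub_zero, ENNReal.ofReal_zero] at this ⊢
      exact this.mono_left nhdsWithin_le_nhds
    have hev := (ht.eventually_lt_const (show (0 : ℝ) < μ / (4 * D) by positivity)).and
      self_mem_nhdsWithin
    obtain ⟨R, hR, hR0⟩ := hev.exists
    rw [Measure.restrict_restrict measurableSet_Ioo,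
      inter_eq_self_of_subset_left Ioo_subset_Ioi_self] at hR
    refine ⟨R, hR0, fun R' _ hR' => (hb ε hε0 R').mono ?_⟩
    have hmono : ∫ r in Ioo 0 R', r ^ (n - 1) * max (-v r) 0 ^ ((n : ℝ) / 2) ≤
        ∫ r in Ioo 0 R, r ^ (n - 1) * max (-v r) 0 ^ ((n : ℝ) / 2) :=
      setIntegral_mono_set (hv.mono_set Ioo_subset_Ioi_self) (by
        filter_upwards [ae_restrict_mem measurableSet_Ioo] with r hr
        have : 0 < r := hr.1
        positivity) (Ioo_subset_Ioo_right hR').eventuallyLE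
    rw [← hD]
    calc μ⁻¹ * (2 * ε + D * ∫ r in Ioo 0 R', r ^ (n - 1) * max (-v r) 0 ^ ((n : ℝ) / 2))
        ≤ μ⁻¹ * (2 * ε + D * (μ / (4 * D))) := by
          gcongr
          exact hmono.trans hR.le
      _ = 1 / 2 := by
          rw [hε]
          field_simp
          norm_num

theorem potV_pos_part (hμ : 0 < μ) (v : ℝ → ℝ) {r : ℝ} (hr : 0 < r) :
    max (potV n μ v r) 0 = (r ^ (n - 1) / (2 * μ)) * max (v r) 0 := by
  have h : 0 ≤ r ^ (n - 1) / (2 * μ) := by positivity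
  rw [mul_max_of_nonneg _ _ h, mul_zero, potV]
  congr 1
  ring

/-- The energy of a radial function, in terms of the form on the half line. -/
theorem energy_radial (hn : 1 ≤ n) (hμ : 0 < μ) {R : ℝ}
    (hV : AEStronglyMeasurable (potV n μ v) (volume.restrict (Ioi 0))) {g γ : ℝ → ℝ}
    (hg : FiniteEnergy (n - 1) (potV n μ v) R g γ) {Ω : Set (Sp n)}
    (hb : ballR n R ⊆ Ω) {φ : Sp n → ℂ}
    (h1 : ∀ᵐ x ∂(volume.restrict Ω),
      (x ∈ ballR n R → ‖weakGrad Ω φ x‖ = |γ ‖x‖| ∧ ‖φ x‖ = |g ‖x‖|) ∧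
      (x ∉ ballR n R → weakGrad Ω φ x = 0 ∧ φ x = 0)) :
    energy Ω μ v φ =
      ((μ * formB (n - 1) (potV n μ v) R g γ g γ * sphereArea n : ℝ) : EReal) := by
  have hs := sphereArea_pos hn
  have hbm : MeasurableSet (ballR n R) := Metric.isOpen_ball.measurableSet
  have hVR : AEStronglyMeasurable (potV n μ v) (volume.restrict (Ioo 0 R)) :=
    hV.mono_measure (Measure.restrict_mono Ioo_subset_Ioi_self le_rfl)
  have hvm : AEMeasurable v (volume.restrict (Ioo 0 R)) :=
    ((aestronglyMeasurable_of_potV hμ hV).mono_measure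
      (Measure.restrict_mono Ioo_subset_Ioi_self le_rfl)).aemeasurable
  have hγm := hg.meas.aemeasurable
  have hgm := hg.meas_fun.aemeasurable
  have key : ∀ (F : ℝ → ℝ) (E : Sp n → ℝ), (AEMeasurable F (volume.restrict (Ioo 0 R))) →
      (IntegrableOn (fun r => r ^ (n - 1) * F r) (Ioo 0 R)) → (∀ r ∈ Ioo 0 R, 0 ≤ F r) →
      (∀ᵐ x ∂(volume.restrict Ω), (x ∈ ballR n R → E x = F ‖x‖) ∧ (x ∉ ballR n R → E x = 0)) →
      ∫⁻ x in Ω, ENNReal.ofReal (E x)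
        = ENNReal.ofReal (sphereArea n * ∫ r in Ioo 0 R, r ^ (n - 1) * F r) := by
    intro F E hF hFi hF0 hE
    have e1 : ∫⁻ x in Ω, ENNReal.ofReal (E x)
        = ∫⁻ x in Ω, (ballR n R).indicator (fun x => ENNReal.ofReal (F ‖x‖)) x := by
      refine lintegral_congr_ae ?_
      filter_upwards [hE] with x hx
      by_cases hxb : x ∈ ballR n R
      · rw [indicator_of_mem hxb, hx.1 hxb]
      · rw [indicator_of_notMem hxb, hx.2 hxb, ENNReal.ofReal_zero]
    rw [e1, lintegral_indicator hbm, Measure.restrict_restrict hbm, inter_eq_self_of_subset_left hb,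
      lintegral_radial hn (F := fun r => ENNReal.ofReal (F r)) hF.ennreal_ofReal,
      ENNReal.ofReal_mul hs.le, ofReal_integral_eq_lintegral_ofReal hFi]
    · congr 1
      refine setLIntegral_congr_fun measurableSet_Ioo fun r hr => ?_
      rw [ENNReal.ofReal_mul (pow_nonneg hr.1.le _)]
    · filter_upwards [ae_restrict_mem measurableSet_Ioo] with r hr
      exact mul_nonneg (pow_nonneg hr.1.le _) (hF0 r hr)
  have hpi := hg.pos_integrable hVR
  have hni := hg.neg_integrable hVR
  have eP : EqOn (fun r => μ * (r ^ (n - 1) * γ r ^ 2 + max (potV n μ v r) 0 * g r ^ 2))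
      (fun r => r ^ (n - 1) * (μ * γ r ^ 2 + 1 / 2 * max (v r) 0 * g r ^ 2)) (Ioo 0 R) := by
    intro r hr
    simp only
    rw [potV_pos_part hμ v hr.1]
    field_simp
  have eN : EqOn (fun r => μ * (max (-potV n μ v r) 0 * g r ^ 2))
      (fun r => r ^ (n - 1) * (1 / 2 * max (-v r) 0 * g r ^ 2)) (Ioo 0 R) := by
    intro r hr
    simp only
    rw [max_neg_potV hμ v hr.1]
    field_simp
  have iP := (IntegrableOn.congr_fun ((hg.sq.add hpi).const_mul μ) eP measurableSet_Ioo)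
  have iN := (IntegrableOn.congr_fun (hni.const_mul μ) eN measurableSet_Ioo)
  rw [energy, key (fun r => μ * γ r ^ 2 + 1 / 2 * max (v r) 0 * g r ^ 2) _
      (by fun_prop) iP (fun r _ => by positivity) ?_,
    key (fun r => 1 / 2 * max (-v r) 0 * g r ^ 2) _
      (by fun_prop) iN (fun r _ => by positivity) ?_,
    ← setIntegral_congr_fun measurableSet_Ioo eP, ← setIntegral_congr_fun measurableSet_Ioo eN,
    integral_const_mul, integral_const_mul, integral_add hg.sq hpi]
  · have hk := kin_nonneg (n - 1) R γ
    have hp : 0 ≤ ∫ r in Ioo 0 R, max (potV n μ v r) 0 * g r ^ 2 :=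
      integral_nonneg fun r => by positivity
    have hm : 0 ≤ ∫ r in Ioo 0 R, max (-potV n μ v r) 0 * g r ^ 2 :=
      integral_nonneg fun r => by positivity
    rw [hg.formB_self_eq hVR, EReal.coe_ennreal_ofReal, EReal.coe_ennreal_ofReal,
      max_eq_left (by change 0 ≤ sphereArea n * (μ * (kin (n - 1) R γ + _)); positivity),
      max_eq_left (by positivity), ← EReal.coe_sub]
    congr 1
    simp only [kin]
    ring
  · filter_upwards [h1] with x hx
    refine ⟨fun hxb => ?_, fun hxb => ?_⟩
    · rw [(hx.1 hxb).2, sq_abs]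
    · rw [(hx.2 hxb).2]; simp
  · filter_upwards [h1] with x hx
    refine ⟨fun hxb => ?_, fun hxb => ?_⟩
    · rw [(hx.1 hxb).1, (hx.1 hxb).2, sq_abs, sq_abs]
    · rw [(hx.2 hxb).1, (hx.2 hxb).2]; simp

theorem ae_ne_zero (hn : 1 ≤ n) (Ω : Set (Sp n)) : ∀ᵐ x ∂(volume.restrict Ω), x ≠ 0 := by
  have hsph : Nonempty (Fin n) := ⟨⟨0, hn⟩⟩
  refine ae_restrict_of_ae ?_
  simp [ae_iff]

/-- For nonnegativity, a function with `g(R) = 0` is lifted to a radial function on `ℝⁿ` that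
vanishes outside the ball. The lift belongs to `H¹(ℝⁿ)`, and its energy is a positive multiple of
the form. -/
theorem radialPotential_potV (hn : 1 ≤ n) (hμ : 0 < μ)
    (hloc : LocallyIntegrableOn (fun x : Sp n => v ‖x‖) {x | x ≠ 0} volume)
    (hneg : NegPartCondition n v) (hbound : NoNegativeBoundStates n μ v) :
    RadialPotential (n - 1) (potV n μ v) where
  meas := aestronglyMeasurable_potV hn μ hloc
  int s R hs := integrableOn_potV hn μ hloc s R hs
  neg R hR := (exists_negBounded hn hμ hloc hneg).1 R hR
  neg_small := by
    obtain ⟨R, hR, h⟩ := (exists_negBounded hn hμ hloc hneg).2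
    exact ⟨R, hR, fun R' h0 hR' γ h1 h2 => (h R' h0 hR' γ h1 h2).2⟩
  nonneg R g γ hR hg h0 := by
    obtain ⟨h1, h2⟩ := hasWeakGrad_radLift hn hR.le hg.meas hg.sq univ
    have h3 := hbound (radLift R γ) ⟨h1, _, h2⟩
    rw [energy_radial hn hμ (aestronglyMeasurable_potV hn μ hloc) hg
      (subset_univ _)] at h3
    · rw [EReal.coe_nonneg] at h3
      have hs := sphereArea_pos hn
      by_contra h
      push Not at h
      have : μ * formB (n - 1) (potV n μ v) R g γ g γ * sphereArea n < 0 :=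
        mul_neg_of_neg_of_pos (mul_neg_of_pos_of_neg hμ h) hs
      linarith
    · filter_upwards [weakGrad_radLift hn hR.le hg.meas hg.sq isOpen_univ, ae_ne_zero hn univ]
        with x hx hx0
      rw [hx]
      refine ⟨fun hb => ?_, fun hb => ?_⟩
      · have hxR : ‖x‖ < R := by simpa using hb
        rw [indicator_of_mem hb, norm_radGrad _ hx0, radLift_eq γ hxR.le, Complex.norm_real,
          Real.norm_eq_abs, hg.prim ‖x‖ ⟨norm_pos_iff.2 hx0, hxR.le⟩, h0, zero_sub]
        exact ⟨rfl, rfl⟩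
      · rw [indicator_of_notMem hb, radLift_eq_zero γ hb]
        exact ⟨rfl, rfl⟩

end Potential

/-! ### Inequalities on a ray -/

section Ray

variable {N : ℕ} {V : ℝ → ℝ} {R : ℝ}

theorem integrable_sq_sub {γ η : ℝ → ℝ}
    (hγ : AEStronglyMeasurable γ (volume.restrict (Ioo 0 R)))
    (hη : AEStronglyMeasurable η (volume.restrict (Ioo 0 R)))
    (hγs : IntegrableOn (fun r => r ^ N * γ r ^ 2) (Ioo 0 R))
    (hηs : IntegrableOn (fun r => r ^ N * η r ^ 2) (Ioo 0 R)) :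
    IntegrableOn (fun r => r ^ N * (γ r - η r) ^ 2) (Ioo 0 R) := by
  have := integrable_weighted_sq_add (m := volume.restrict (Ioo 0 R)) (W := fun r => r ^ N)
    (x := γ) (y := fun r => -η r) ?_ ?_ hγs (by simp only [neg_sq]; exact hηs)
  · simp only [sub_eq_add_neg]; exact this
  · filter_upwards [ae_pow_pos N le_rfl R] with r hr using hr.le
  · exact (by fun_prop : Continuous fun r : ℝ => r ^ N).aestronglyMeasurable.mul (hγ.mul hη.neg)

/-- The relation `p = -∫ q` survives in the limit, since the integral from `r` to `R` is bounded in
the weighted norm by the kinetic energy. This gives absolute continuity along a ray without a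
separate theory of Sobolev functions on lines. -/
theorem ae_eq_primitive_of_approx {U Γ : ℝ → ℝ}
    (hU : AEStronglyMeasurable U (volume.restrict (Ioo 0 R)))
    (hΓ : AEStronglyMeasurable Γ (volume.restrict (Ioo 0 R)))
    (hΓs : IntegrableOn (fun r => r ^ N * Γ r ^ 2) (Ioo 0 R))
    (h : ∀ ε : ℝ≥0∞, 0 < ε → ∃ p q : ℝ → ℝ, Continuous q ∧
      (∀ r ∈ Ioo 0 R, p r = -∫ s in Ioo r R, q s) ∧
      (∫⁻ r in Ioo 0 R, ENNReal.ofReal (r ^ N) * ENNReal.ofReal ((U r - p r) ^ 2)) +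
        (∫⁻ r in Ioo 0 R, ENNReal.ofReal (r ^ N) * ENNReal.ofReal ((Γ r - q r) ^ 2)) ≤ ε) :
    ∀ᵐ r ∂(volume.restrict (Ioo 0 R)), U r = -∫ s in Ioo r R, Γ s := by
  rcases le_or_gt R 0 with hR | hR
  · simp [Ioo_eq_empty_of_le hR]
  set X : ℝ → ℝ := fun r => U r + ∫ s in Ioo r R, Γ s with hX
  have hXm : AEMeasurable X (volume.restrict (Ioo 0 R)) :=
    (hU.add (aestronglyMeasurable_primitive hΓ hΓs)).aemeasurable
  have hbd : ∀ ε : ℝ≥0∞, 0 < ε → ∫⁻ r in Ioo 0 R, ENNReal.ofReal (r ^ N) * ENNReal.ofReal (X r ^ 2)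
      ≤ ENNReal.ofReal (2 + 2 * R ^ 2) * ε := by
    intro ε hε
    obtain ⟨p, q, hq, hpq, hle⟩ := h ε hε
    have hqs : IntegrableOn (fun r => r ^ N * q r ^ 2) (Ioo 0 R) :=
      ((by fun_prop : Continuous fun r => r ^ N * q r ^ 2).continuousOn.integrableOn_Icc).mono_set
        Ioo_subset_Icc_self
    have hds := integrable_sq_sub hΓ hq.aestronglyMeasurable hΓs hqs
    have hdm := hΓ.sub (hq.aestronglyMeasurable (μ := volume.restrict (Ioo 0 R)))
    have hk := lintegral_kin hds
    have h1 : ∀ r ∈ Ioo 0 R, ENNReal.ofReal (r ^ N) * ENNReal.ofReal (X r ^ 2) ≤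
        2 * (ENNReal.ofReal (r ^ N) * ENNReal.ofReal ((U r - p r) ^ 2)) +
        ENNReal.ofReal (2 * R * kin N R fun r => Γ r - q r) := by
      intro r hr
      have hrN : 0 ≤ r ^ N := pow_nonneg hr.1.le N
      have h2 := pow_mul_sq_primitive_le hdm hds hr
      have h3 : X r = (U r - p r) + ∫ s in Ioo r R, (Γ s - q s) := by
        rw [integral_sub (integrableOn_Ioo_of_kin hr.1 hΓ hΓs)
          (hq.continuousOn.integrableOn_Icc.mono_set Ioo_subset_Icc_self), hpq r hr, hX]
        ring
      rw [← ENNReal.ofReal_mul hrN, ← ENNReal.ofReal_mul hrN,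
        ← ENNReal.ofReal_ofNat, ← ENNReal.ofReal_mul (by norm_num),
        ← ENNReal.ofReal_add (by positivity)
          (mul_nonneg (by linarith [hr.1, hr.2]) (kin_nonneg _ _ _))]
      refine ENNReal.ofReal_le_ofReal ?_
      rw [h3]
      have h4 := add_sq_le (a := U r - p r) (b := ∫ s in Ioo r R, (Γ s - q s))
      have h2' : r ^ N * (∫ s in Ioo r R, (Γ s - q s)) ^ 2 ≤ R * kin N R fun r => Γ r - q r := h2
      have h5 := mul_le_mul_of_nonneg_left h4 hrN
      linarith
    calc ∫⁻ r in Ioo 0 R, ENNReal.ofReal (r ^ N) * ENNReal.ofReal (X r ^ 2)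
        ≤ ∫⁻ r in Ioo 0 R, (2 * (ENNReal.ofReal (r ^ N) * ENNReal.ofReal ((U r - p r) ^ 2)) +
          ENNReal.ofReal (2 * R * kin N R fun r => Γ r - q r)) :=
          setLIntegral_mono' measurableSet_Ioo h1
      _ = 2 * (∫⁻ r in Ioo 0 R, ENNReal.ofReal (r ^ N) * ENNReal.ofReal ((U r - p r) ^ 2)) +
          ENNReal.ofReal (2 * R ^ 2) * ENNReal.ofReal (kin N R fun r => Γ r - q r) := by
          rw [lintegral_add_right _ measurable_const, lintegral_const_mul' _ _ (by simp),
            setLIntegral_const, Real.volume_Ioo, sub_zero, ← ENNReal.ofReal_mul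
            (mul_nonneg (by linarith) (kin_nonneg _ _ _)), ← ENNReal.ofReal_mul (by positivity)]
          ring_nf
      _ ≤ ENNReal.ofReal (2 + 2 * R ^ 2) * (∫⁻ r in Ioo 0 R, ENNReal.ofReal (r ^ N) *
            ENNReal.ofReal ((U r - p r) ^ 2)) +
          ENNReal.ofReal (2 + 2 * R ^ 2) * ENNReal.ofReal (kin N R fun r => Γ r - q r) := by
          gcongr
          · rw [← ENNReal.ofReal_ofNat]
            exact ENNReal.ofReal_le_ofReal (by nlinarith [sq_nonneg R])
          · linarith
      _ ≤ _ := by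
          rw [← mul_add, ← hk]
          gcongr
  have hzero : ∫⁻ r in Ioo 0 R, ENNReal.ofReal (r ^ N) * ENNReal.ofReal (X r ^ 2) = 0 := by
    have hK : ENNReal.ofReal (2 + 2 * R ^ 2) ≠ 0 := by
      rw [ne_eq, ENNReal.ofReal_eq_zero, not_le]; positivity
    refine le_antisymm (ENNReal.le_of_forall_pos_le_add fun ε hε _ => ?_) zero_le
    have hε' : (0 : ℝ≥0∞) < ε := by exact_mod_cast hε
    refine (hbd (ε / ENNReal.ofReal (2 + 2 * R ^ 2))
      (ENNReal.div_pos hε'.ne' ENNReal.ofReal_ne_top)).trans ?_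
    rw [ENNReal.mul_div_cancel hK ENNReal.ofReal_ne_top, zero_add]
  rw [lintegral_eq_zero_iff' (by fun_prop)] at hzero
  filter_upwards [hzero, ae_pow_pos N le_rfl R] with r hr hp
  have h1 : ENNReal.ofReal (r ^ N) * ENNReal.ofReal (X r ^ 2) = 0 := hr
  rw [mul_eq_zero, ENNReal.ofReal_eq_zero, ENNReal.ofReal_eq_zero] at h1
  rcases h1 with h1 | h1
  · linarith
  · have : X r = 0 := pow_eq_zero_iff two_ne_zero |>.1 (le_antisymm h1 (sq_nonneg _))
    rw [hX] at this
    simp only at this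
    linarith

theorem ofReal_integral_add {α : Type*} [MeasurableSpace α] {m : Measure α} {A B : α → ℝ}
    (hA : Integrable A m) (hB : Integrable B m) (h0 : ∀ᵐ a ∂m, 0 ≤ A a + B a) :
    ENNReal.ofReal ((∫ a, A a ∂m) + ∫ a, B a ∂m) = ∫⁻ a, ENNReal.ofReal (A a + B a) ∂m := by
  rw [← integral_add hA hB]
  exact ofReal_integral_eq_lintegral_ofReal (hA.add hB) h0

/-- The form bound applies only to functions that vanish at `R`, so `k f` is subtracted first; `f`
itself has finite negative potential energy. -/
theorem ray_neg_bound (H : RadialPotential N V) (hR : 0 < R) {f φ : ℝ → ℝ}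
    (hf : FiniteEnergy N V R f φ) (hf1 : f R = 1) :
    ∃ K : ℝ, 0 ≤ K ∧ ∀ (k : ℝ) (γ : ℝ → ℝ), AEStronglyMeasurable γ (volume.restrict (Ioo 0 R)) →
      IntegrableOn (fun r => r ^ N * γ r ^ 2) (Ioo 0 R) →
      IntegrableOn (fun r => max (-V r) 0 * (k - ∫ s in r..R, γ s) ^ 2) (Ioo 0 R) ∧
      ∫ r in Ioo 0 R, max (-V r) 0 * (k - ∫ s in r..R, γ s) ^ 2 ≤ K * (k ^ 2 + kin N R γ) := by
  obtain ⟨C, hC⟩ := H.neg R hR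
  have hVm := H.meas_Ioo R
  have hVn : AEStronglyMeasurable (fun r => max (-V r) 0) (volume.restrict (Ioo 0 R)) :=
    hVm.neg.sup aestronglyMeasurable_const
  have hFi := hf.neg_integrable hVm
  have hF0 : 0 ≤ ∫ r in Ioo 0 R, max (-V r) 0 * f r ^ 2 := integral_nonneg fun r => by positivity
  have hk0 := kin_nonneg N R φ
  refine ⟨4 * |C| + 4 * |C| * kin N R φ + 2 * ∫ r in Ioo 0 R, max (-V r) 0 * f r ^ 2,
    by positivity, fun k γ hm hs => ?_⟩
  have hγ0 := kin_nonneg N R γ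
  have hdm : AEStronglyMeasurable (fun r => 1 * γ r + -k * φ r) (volume.restrict (Ioo 0 R)) :=
    (hm.const_mul 1).add (hf.meas.const_mul (-k))
  have hpm : AEStronglyMeasurable (fun r => r ^ N * (γ r * φ r)) (volume.restrict (Ioo 0 R)) :=
    (by fun_prop : Continuous fun r : ℝ => r ^ N).aestronglyMeasurable.mul (hm.mul hf.meas)
  have hds : IntegrableOn (fun r => r ^ N * (1 * γ r + -k * φ r) ^ 2) (Ioo 0 R) := by
    have h1 : IntegrableOn (fun r => r ^ N * (k * φ r) ^ 2) (Ioo 0 R) := by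
      refine (hf.sq.const_mul (k ^ 2)).congr (Eventually.of_forall fun r => ?_)
      simp only
      ring
    refine (integrable_sq_sub hm (hf.meas.const_mul k) hs h1).congr
      (Eventually.of_forall fun r => ?_)
    simp only
    ring
  obtain ⟨h1, h2⟩ := hC _ hdm hds
  have h3 := kin_comb_le hpm hs hf.sq 1 (-k)
  have hle : ∀ r ∈ Ioo 0 R, max (-V r) 0 * (k - ∫ s in r..R, γ s) ^ 2 ≤
      2 * (max (-V r) 0 * (∫ s in r..R, (1 * γ s + -k * φ s)) ^ 2) +
        2 * k ^ 2 * (max (-V r) 0 * f r ^ 2) := by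
    intro r hr
    have e : ∫ s in r..R, (1 * γ s + -k * φ s) = (∫ s in r..R, γ s) - k * (1 - f r) := by
      rw [intervalIntegral.integral_add
        ((intervalIntegrable_of_kin hr.1 hR hr.2.le le_rfl hm hs).const_mul 1)
        ((intervalIntegrable_of_kin hr.1 hR hr.2.le le_rfl hf.meas hf.sq).const_mul (-k)),
        intervalIntegral.integral_const_mul, intervalIntegral.integral_const_mul,
        hf.prim r ⟨hr.1, hr.2.le⟩, hf1]
      ring
    rw [e]
    have hv : 0 ≤ max (-V r) 0 := le_max_right _ _
    have h4 := mul_le_mul_of_nonneg_left (add_sq_le (a := -((∫ s in r..R, γ s) - k * (1 - f r)))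
      (b := k * f r)) hv
    have e2 : -((∫ s in r..R, γ s) - k * (1 - f r)) + k * f r = k - ∫ s in r..R, γ s := by ring
    rw [e2] at h4
    nlinarith [h4]
  have hi := (h1.const_mul 2).add (hFi.const_mul (2 * k ^ 2))
  have hI : IntegrableOn (fun r => max (-V r) 0 * (k - ∫ s in r..R, γ s) ^ 2) (Ioo 0 R) := by
    refine Integrable.mono' hi (hVn.mul ((aestronglyMeasurable_const.sub
      ((continuousOn_primitive_of_kin hm hs).mono Ioo_subset_Ioc_self |>.aestronglyMeasurable
        measurableSet_Ioo)).pow 2)) ?_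
    filter_upwards [ae_restrict_mem measurableSet_Ioo] with r hr
    rw [Real.norm_of_nonneg (by positivity)]
    exact hle r hr
  refine ⟨hI, (setIntegral_mono_on hI hi measurableSet_Ioo hle).trans ?_⟩
  simp only [Pi.add_apply]
  rw [integral_add (h1.const_mul 2) (hFi.const_mul _), integral_const_mul, integral_const_mul]
  have h5 : C * kin N R (fun r => 1 * γ r + -k * φ r) ≤
      |C| * (2 * kin N R γ + 2 * k ^ 2 * kin N R φ) :=
    mul_le_mul (le_abs_self C) (by nlinarith [h3]) (kin_nonneg _ _ _) (abs_nonneg C)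
  have h6 := mul_nonneg (mul_nonneg (abs_nonneg C) hk0) hγ0
  have h7 := mul_nonneg hF0 hγ0
  have h8 := mul_nonneg (abs_nonneg C) (sq_nonneg k)
  linarith

/-- The orthogonal splitting gives the excess as the form of `g - k f`, and coercivity bounds it
below by kinetic energy. The estimate `r^N w² ≤ R · kin`, integrated over `(0, R)`, converts this
into a weighted `L²` distance and accounts for the constant `c / R²`. -/
theorem ray_lower_bound (H : RadialPotential N V) (hR : 0 < R) {f φ : ℝ → ℝ}
    (hf : IsWeakSol N V R f φ) :
    ∃ c : ℝ, 0 < c ∧ ∀ (k : ℝ) (γ : ℝ → ℝ), AEStronglyMeasurable γ (volume.restrict (Ioo 0 R)) →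
      IntegrableOn (fun r => r ^ N * γ r ^ 2) (Ioo 0 R) →
      IntegrableOn (fun r => max (V r) 0 * (k - ∫ s in r..R, γ s) ^ 2) (Ioo 0 R) →
      IntegrableOn (fun r => max (-V r) 0 * (k - ∫ s in r..R, γ s) ^ 2) (Ioo 0 R) →
      IntegrableOn (fun r => r ^ N * ((k - ∫ s in r..R, γ s) - k * f r) ^ 2) (Ioo 0 R) ∧
      k ^ 2 * formB N V R f φ f φ +
        c * (∫ r in Ioo 0 R, r ^ N * ((k - ∫ s in r..R, γ s) - k * f r) ^ 2) ≤
      kin N R γ + (∫ r in Ioo 0 R, max (V r) 0 * (k - ∫ s in r..R, γ s) ^ 2)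
        - ∫ r in Ioo 0 R, max (-V r) 0 * (k - ∫ s in r..R, γ s) ^ 2 := by
  obtain ⟨c, hc, hco⟩ := H.coercive hR
  have hVm := H.meas_Ioo R
  refine ⟨c / R ^ 2, by positivity, fun k γ hm hs hp hn => ?_⟩
  have hg : FiniteEnergy N V R (fun r => k - ∫ s in r..R, γ s) γ :=
    FiniteEnergy.of_primitive hm hs (integrable_pot_of_pos_neg hp hn)
  have hgR : (fun r => k - ∫ s in r..R, γ s) R = k := by simp
  have h1 := hf.form_split H hg
  rw [hg.formB_self_eq hVm] at h1
  simp only at hgR h1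
  rw [hgR] at h1
  have hw := hg.comb hVm hf.fe 1 (-k)
  have hwR : 1 * (k - ∫ s in R..R, γ s) + -k * f R = 0 := by simp [hf.one]
  have h2 := hco _ _ hw hwR
  have hb : ∀ r ∈ Ioo 0 R, r ^ N * ((k - ∫ s in r..R, γ s) - k * f r) ^ 2 ≤
      R * kin N R (fun r => 1 * γ r + -k * φ r) := by
    intro r hr
    have h3 := pow_mul_sq_primitive_le hw.meas hw.sq hr
    have h4 := hw.prim r ⟨hr.1, hr.2.le⟩
    rw [hwR, zero_sub] at h4
    rw [← intervalIntegral_eq_Ioo hr.2.le, ← neg_sq, ← h4] at h3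
    refine le_trans (le_of_eq ?_) h3
    ring
  have hI : IntegrableOn (fun r => r ^ N * ((k - ∫ s in r..R, γ s) - k * f r) ^ 2) (Ioo 0 R) := by
    refine Integrable.mono' (integrable_const (R * kin N R (fun r => 1 * γ r + -k * φ r))) ?_ ?_
    · exact (by fun_prop : Continuous fun r : ℝ => r ^ N).aestronglyMeasurable.mul
        ((hg.meas_fun.sub (hf.fe.meas_fun.const_mul k)).pow 2)
    · filter_upwards [ae_restrict_mem measurableSet_Ioo] with r hr
      rw [Real.norm_of_nonneg (mul_nonneg (pow_nonneg hr.1.le _) (sq_nonneg _))]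
      exact hb r hr
  have h5 : ∫ r in Ioo 0 R, r ^ N * ((k - ∫ s in r..R, γ s) - k * f r) ^ 2 ≤
      R ^ 2 * kin N R (fun r => 1 * γ r + -k * φ r) := by
    refine (setIntegral_mono_on hI (integrable_const _) measurableSet_Ioo hb).trans (le_of_eq ?_)
    have hv : volume.real (Ioo 0 R) = R := by simp [measureReal_def, hR.le]
    rw [setIntegral_const, smul_eq_mul, hv]
    ring
  refine ⟨hI, ?_⟩
  rw [h1]
  have h6 : c / R ^ 2 * (∫ r in Ioo 0 R, r ^ N * ((k - ∫ s in r..R, γ s) - k * f r) ^ 2)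
      ≤ c * kin N R (fun r => 1 * γ r + -k * φ r) := by
    calc _ ≤ c / R ^ 2 * (R ^ 2 * kin N R (fun r => 1 * γ r + -k * φ r)) := by gcongr
      _ = _ := by field_simp
  linarith

/-- The real part has boundary value `1` and is compared with `f`; the imaginary part has boundary
value `0` and is compared with `0`. The form of `f`, whose sign is not fixed, is split into its
positive part on the left and its negative part on the right, so that nothing is subtracted in
`ℝ≥0∞` and infinite energies are allowed. -/
theorem ray_inequality (H : RadialPotential N V) (hR : 0 < R) {f φ : ℝ → ℝ}
    (hf : IsWeakSol N V R f φ) :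
    ∃ c K : ℝ, 0 < c ∧ 0 ≤ K ∧ ∀ (γ₁ γ₂ : ℝ → ℝ),
      AEStronglyMeasurable γ₁ (volume.restrict (Ioo 0 R)) →
      IntegrableOn (fun r => r ^ N * γ₁ r ^ 2) (Ioo 0 R) →
      AEStronglyMeasurable γ₂ (volume.restrict (Ioo 0 R)) →
      IntegrableOn (fun r => r ^ N * γ₂ r ^ 2) (Ioo 0 R) →
      (∫⁻ r in Ioo 0 R, ENNReal.ofReal
        (max (-V r) 0 * ((1 - ∫ s in r..R, γ₁ s) ^ 2 + (0 - ∫ s in r..R, γ₂ s) ^ 2))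
        ≤ ENNReal.ofReal (K * (1 + (kin N R γ₁ + kin N R γ₂)))) ∧
      (∫⁻ r in Ioo 0 R, ENNReal.ofReal
        (max (-V r) 0 * ((1 - ∫ s in r..R, γ₁ s) ^ 2 + (0 - ∫ s in r..R, γ₂ s) ^ 2))) +
        ENNReal.ofReal (formB N V R f φ f φ) +
        ENNReal.ofReal c * (∫⁻ r in Ioo 0 R, ENNReal.ofReal
          (r ^ N * (((1 - ∫ s in r..R, γ₁ s) - f r) ^ 2 + (0 - ∫ s in r..R, γ₂ s) ^ 2))) ≤
      (∫⁻ r in Ioo 0 R, ENNReal.ofReal (r ^ N * (γ₁ r ^ 2 + γ₂ r ^ 2) +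
        max (V r) 0 * ((1 - ∫ s in r..R, γ₁ s) ^ 2 + (0 - ∫ s in r..R, γ₂ s) ^ 2))) +
        ENNReal.ofReal (-formB N V R f φ f φ) := by
  obtain ⟨K, hK, hneg⟩ := ray_neg_bound H hR hf.fe hf.one
  obtain ⟨c, hc, hlow⟩ := ray_lower_bound H hR hf
  refine ⟨c, K, hc, hK, fun γ₁ γ₂ hm₁ hs₁ hm₂ hs₂ => ?_⟩
  obtain ⟨n1, b1⟩ := hneg 1 γ₁ hm₁ hs₁
  obtain ⟨n2, b2⟩ := hneg 0 γ₂ hm₂ hs₂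
  set g₁ : ℝ → ℝ := fun r => 1 - ∫ s in r..R, γ₁ s with hg₁
  set g₂ : ℝ → ℝ := fun r => 0 - ∫ s in r..R, γ₂ s with hg₂
  have hVm := H.meas_Ioo R
  have hVp : AEStronglyMeasurable (fun r => max (V r) 0) (volume.restrict (Ioo 0 R)) :=
    hVm.sup aestronglyMeasurable_const
  have hg₁m : AEStronglyMeasurable g₁ (volume.restrict (Ioo 0 R)) :=
    aestronglyMeasurable_const.sub ((continuousOn_primitive_of_kin hm₁ hs₁).mono
      Ioo_subset_Ioc_self |>.aestronglyMeasurable measurableSet_Ioo)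
  have hg₂m : AEStronglyMeasurable g₂ (volume.restrict (Ioo 0 R)) :=
    aestronglyMeasurable_const.sub ((continuousOn_primitive_of_kin hm₂ hs₂).mono
      Ioo_subset_Ioc_self |>.aestronglyMeasurable measurableSet_Ioo)
  have hrm : AEStronglyMeasurable (fun r : ℝ => r ^ N) (volume.restrict (Ioo 0 R)) :=
    (by fun_prop : Continuous fun r : ℝ => r ^ N).aestronglyMeasurable
  have hN : ∫⁻ r in Ioo 0 R, ENNReal.ofReal (max (-V r) 0 * (g₁ r ^ 2 + g₂ r ^ 2))
      = ENNReal.ofReal ((∫ r in Ioo 0 R, max (-V r) 0 * g₁ r ^ 2) +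
        ∫ r in Ioo 0 R, max (-V r) 0 * g₂ r ^ 2) := by
    rw [ofReal_integral_add n1 n2 (Eventually.of_forall fun r => by positivity)]
    simp_rw [mul_add]
    rfl
  change (∫⁻ r in Ioo 0 R, ENNReal.ofReal (max (-V r) 0 * (g₁ r ^ 2 + g₂ r ^ 2)) ≤ _) ∧
    (∫⁻ r in Ioo 0 R, ENNReal.ofReal (max (-V r) 0 * (g₁ r ^ 2 + g₂ r ^ 2))) +
    ENNReal.ofReal (formB N V R f φ f φ) + ENNReal.ofReal c * (∫⁻ r in Ioo 0 R, ENNReal.ofReal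
          (r ^ N * ((g₁ r - f r) ^ 2 + g₂ r ^ 2))) ≤
      (∫⁻ r in Ioo 0 R, ENNReal.ofReal (r ^ N * (γ₁ r ^ 2 + γ₂ r ^ 2) +
        max (V r) 0 * (g₁ r ^ 2 + g₂ r ^ 2))) + ENNReal.ofReal (-formB N V R f φ f φ)
  rw [hN]
  refine ⟨ENNReal.ofReal_le_ofReal (by nlinarith [b1, b2]), ?_⟩
  by_cases htop : (∫⁻ r in Ioo 0 R, ENNReal.ofReal (r ^ N * (γ₁ r ^ 2 + γ₂ r ^ 2) +
        max (V r) 0 * (g₁ r ^ 2 + g₂ r ^ 2))) = ⊤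
  · rw [htop, top_add]; exact le_top
  have hTm : AEStronglyMeasurable (fun r => r ^ N * (γ₁ r ^ 2 + γ₂ r ^ 2) +
        max (V r) 0 * (g₁ r ^ 2 + g₂ r ^ 2)) (volume.restrict (Ioo 0 R)) :=
    (hrm.mul ((hm₁.pow 2).add (hm₂.pow 2))).add (hVp.mul ((hg₁m.pow 2).add (hg₂m.pow 2)))
  have hT0 : 0 ≤ᵐ[volume.restrict (Ioo 0 R)] (fun r => r ^ N * (γ₁ r ^ 2 + γ₂ r ^ 2) +
        max (V r) 0 * (g₁ r ^ 2 + g₂ r ^ 2)) := by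
    filter_upwards [ae_pow_pos N le_rfl R] with r hr
    simp only [Pi.zero_apply]
    positivity
  have hT : Integrable (fun r => r ^ N * (γ₁ r ^ 2 + γ₂ r ^ 2) +
        max (V r) 0 * (g₁ r ^ 2 + g₂ r ^ 2)) (volume.restrict (Ioo 0 R)) := by
    refine ⟨hTm, ?_⟩
    rw [hasFiniteIntegral_iff_ofReal hT0]
    exact lt_top_iff_ne_top.2 htop
  have hpos : ∀ {g : ℝ → ℝ}, AEStronglyMeasurable g (volume.restrict (Ioo 0 R)) →
      (∀ r, g r ^ 2 ≤ g₁ r ^ 2 + g₂ r ^ 2) →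
      IntegrableOn (fun r => max (V r) 0 * g r ^ 2) (Ioo 0 R) := by
    intro g hg hle
    refine Integrable.mono' hT (hVp.mul (hg.pow 2)) ?_
    filter_upwards [ae_pow_pos N le_rfl R] with r hr
    rw [Real.norm_of_nonneg (by positivity)]
    have h1 := mul_le_mul_of_nonneg_left (hle r) (le_max_right (V r) 0)
    have h2 : 0 ≤ r ^ N * (γ₁ r ^ 2 + γ₂ r ^ 2) := by positivity
    linarith
  have p1 := hpos hg₁m fun r => le_add_of_nonneg_right (sq_nonneg _)
  have p2 := hpos hg₂m fun r => le_add_of_nonneg_left (sq_nonneg _)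
  obtain ⟨i1, l1⟩ := hlow 1 γ₁ hm₁ hs₁ p1 n1
  obtain ⟨i2, l2⟩ := hlow 0 γ₂ hm₂ hs₂ p2 n2
  have eD : ∫⁻ r in Ioo 0 R, ENNReal.ofReal (r ^ N * ((g₁ r - f r) ^ 2 + g₂ r ^ 2)) =
      ENNReal.ofReal ((∫ r in Ioo 0 R, r ^ N * (g₁ r - 1 * f r) ^ 2) +
        ∫ r in Ioo 0 R, r ^ N * (g₂ r - 0 * f r) ^ 2) := by
    rw [ofReal_integral_add i1 i2]
    · refine lintegral_congr fun r => ?_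
      congr 1
      simp only [hg₁, hg₂]
      ring
    · filter_upwards [ae_pow_pos N le_rfl R] with r hr
      positivity
  have eT : ∫⁻ r in Ioo 0 R, ENNReal.ofReal (r ^ N * (γ₁ r ^ 2 + γ₂ r ^ 2) +
        max (V r) 0 * (g₁ r ^ 2 + g₂ r ^ 2)) = ENNReal.ofReal (kin N R γ₁ + kin N R γ₂ +
        ((∫ r in Ioo 0 R, max (V r) 0 * g₁ r ^ 2) + ∫ r in Ioo 0 R, max (V r) 0 * g₂ r ^ 2)) := by
    rw [← ofReal_integral_eq_lintegral_ofReal hT hT0]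
    congr 1
    have a1 := integral_add hs₁ hs₂
    have a2 := integral_add p1 p2
    have a3 := integral_add (hs₁.add hs₂) (p1.add p2)
    simp only [Pi.add_apply] at a3
    rw [kin, kin, ← a1, ← a2, ← a3]
    refine integral_congr_ae (Eventually.of_forall fun r => ?_)
    ring
  rw [eD, eT]
  set e := formB N V R f φ f φ
  have d1 : 0 ≤ ∫ r in Ioo 0 R, r ^ N * (g₁ r - 1 * f r) ^ 2 := by
    refine setIntegral_nonneg measurableSet_Ioo fun r hr => ?_
    have := hr.1.le
    positivity
  have d2 : 0 ≤ ∫ r in Ioo 0 R, r ^ N * (g₂ r - 0 * f r) ^ 2 := by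
    refine setIntegral_nonneg measurableSet_Ioo fun r hr => ?_
    have := hr.1.le
    positivity
  have q1 : 0 ≤ ∫ r in Ioo 0 R, max (-V r) 0 * g₁ r ^ 2 := integral_nonneg fun r => by positivity
  have q2 : 0 ≤ ∫ r in Ioo 0 R, max (-V r) 0 * g₂ r ^ 2 := integral_nonneg fun r => by positivity
  have q3 : 0 ≤ ∫ r in Ioo 0 R, max (V r) 0 * g₁ r ^ 2 := integral_nonneg fun r => by positivity
  have q4 : 0 ≤ ∫ r in Ioo 0 R, max (V r) 0 * g₂ r ^ 2 := integral_nonneg fun r => by positivity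
  have k1 := kin_nonneg N R γ₁
  have k2 := kin_nonneg N R γ₂
  rw [← ENNReal.ofReal_mul hc.le]
  rcases le_total 0 e with he | he
  · rw [ENNReal.ofReal_of_nonpos (show -e ≤ 0 by linarith), add_zero,
      ← ENNReal.ofReal_add (by positivity) he, ← ENNReal.ofReal_add (by positivity) (by positivity)]
    exact ENNReal.ofReal_le_ofReal (by linarith)
  · rw [ENNReal.ofReal_of_nonpos he, add_zero, ← ENNReal.ofReal_add (by positivity) (by positivity),
      ← ENNReal.ofReal_add (by positivity) (by linarith)]
    exact ENNReal.ofReal_le_ofReal (by linarith)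

end Ray

/-! ### Sobolev functions on rays -/

section Rays

variable {n : ℕ} {R : ℝ}

/-- The weight `r^(n-1)` is positive on `(0, R)`, so `radMeas` and Lebesgue measure have the same
null sets there. -/
theorem aestronglyMeasurable_ray (hn : 1 ≤ n) {E : Type*} [TopologicalSpace E]
    {F : Sp n → E} (hF : AEStronglyMeasurable F (volume.restrict (ballR n R))) :
    ∀ᵐ w : Sph n ∂(surf n), AEStronglyMeasurable (fun r : ℝ => F (r • (w : Sp n)))
      (volume.restrict (Ioo 0 R)) := by
  have h1 : AEStronglyMeasurable (fun z => F (polar z)) ((surf n).prod (radMeas n R)) :=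
    hF.comp_quasiMeasurePreserving (measurePreserving_polar hn R).quasiMeasurePreserving
  filter_upwards [h1.prodMk_left] with w hw
  refine hw.mono_ac (withDensity_absolutelyContinuous' (by fun_prop) ?_)
  filter_upwards [ae_pow_pos (n - 1) le_rfl R] with r hr
  exact (ENNReal.ofReal_pos.2 hr).ne'

/-- The radial component in the direction `w`. -/
noncomputable def radialComp (w : Sp n) (z : EuclideanSpace ℂ (Fin n)) : ℂ :=
  ∑ i, (w i : ℂ) * z i

theorem radialComp_sub (w : Sp n) (z z' : EuclideanSpace ℂ (Fin n)) :
    radialComp w z - radialComp w z' = radialComp w (z - z') := by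
  simp [radialComp, mul_sub, Finset.sum_sub_distrib]

theorem norm_radialComp_le (w : Sph n) (z : EuclideanSpace ℂ (Fin n)) :
    ‖radialComp w z‖ ≤ ‖z‖ := by
  set W : EuclideanSpace ℂ (Fin n) := WithLp.toLp 2 fun i => ((w : Sp n) i : ℂ) with hW
  have h1 : radialComp w z = inner ℂ W z := by
    simp [radialComp, hW, PiLp.inner_apply, mul_comm]
  have h2 : ‖W‖ = 1 := by
    have : ‖(w : Sp n)‖ = 1 := norm_eq_of_mem_sphere w
    rw [← this, EuclideanSpace.norm_eq, EuclideanSpace.norm_eq]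
    simp [hW]
  rw [h1]
  simpa [h2] using norm_inner_le_norm (𝕜 := ℂ) W z

theorem continuous_radialComp (w : Sp n) : Continuous (radialComp w) := by
  unfold radialComp
  fun_prop

theorem hasDerivAt_ray {ψ : Sp n → ℂ} (hψ : ContDiff ℝ ∞ ψ) (w : Sp n) (r : ℝ) :
    HasDerivAt (fun s : ℝ => ψ (s • w)) (radialComp w (classicalGrad ψ (r • w))) r := by
  have h1 : HasFDerivAt ψ (fderiv ℝ ψ (r • w)) (r • w) :=
    (hψ.differentiable (by simp) _).hasFDerivAt
  have h2 : HasDerivAt (fun s : ℝ => s • w) w r := by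
    simpa using (hasDerivAt_id r).smul_const w
  have h3 := h1.comp_hasDerivAt r h2
  have e : w = ∑ i, w i • EuclideanSpace.single i (1 : ℝ) := by
    have := (EuclideanSpace.basisFun (Fin n) ℝ).sum_repr w
    simpa using this.symm
  have e2 : fderiv ℝ ψ (r • w) w = radialComp w (classicalGrad ψ (r • w)) := by
    have h4 := congrArg (fderiv ℝ ψ (r • w)) e
    rw [map_sum] at h4
    rw [h4]
    simp [radialComp, classicalGrad, partialDeriv]
  rwa [e2] at h3

/-- Test functions vanish on the sphere, so along a ray each is the primitive of its radial
derivative that vanishes at `R`; `ae_eq_primitive_of_approx` passes this to the limit. The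
functional `L` stands for the real or the imaginary part. -/
theorem ray_component (w : Sph n) (L : ℂ →L[ℝ] ℝ) (hL : ∀ z, |L z| ≤ ‖z‖)
    {u : Sp n → ℂ} {G : Sp n → EuclideanSpace ℂ (Fin n)}
    (hu : AEStronglyMeasurable (fun r : ℝ => u (r • (w : Sp n))) (volume.restrict (Ioo 0 R)))
    (hG : AEStronglyMeasurable (fun r : ℝ => G (r • (w : Sp n))) (volume.restrict (Ioo 0 R)))
    (hGf : ∫⁻ r in Ioo 0 R, ENNReal.ofReal (r ^ (n - 1)) * ‖G (r • (w : Sp n))‖ₑ ^ 2 ≠ ⊤)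
    {ψ : ℕ → Sp n → ℂ} (hψ : ∀ k, IsTestFun (ballR n R) (ψ k))
    (ht : Tendsto (fun k => ∫⁻ r in Ioo 0 R, ENNReal.ofReal (r ^ (n - 1)) *
      (‖u (r • (w : Sp n)) - ψ k (r • (w : Sp n))‖ₑ ^ 2 +
        ‖G (r • (w : Sp n)) - classicalGrad (ψ k) (r • (w : Sp n))‖ₑ ^ 2)) atTop (𝓝 0)) :
    AEStronglyMeasurable (fun r => L (radialComp w (G (r • (w : Sp n)))))
        (volume.restrict (Ioo 0 R)) ∧
      IntegrableOn (fun r => r ^ (n - 1) * L (radialComp w (G (r • (w : Sp n)))) ^ 2) (Ioo 0 R) ∧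
      ∀ᵐ r ∂(volume.restrict (Ioo 0 R)), L (u (r • (w : Sp n))) =
        -∫ s in Ioo r R, L (radialComp w (G (s • (w : Sp n)))) := by
  have hLz : ∀ z : ℂ, ENNReal.ofReal (L z ^ 2) ≤ ‖z‖ₑ ^ 2 := fun z => by
    rw [← ofReal_norm, ← ENNReal.ofReal_pow (norm_nonneg _)]
    exact ENNReal.ofReal_le_ofReal (sq_le_sq.2 (by rw [abs_norm]; exact hL z))
  have hLr : ∀ z : EuclideanSpace ℂ (Fin n), ENNReal.ofReal (L (radialComp w z) ^ 2) ≤ ‖z‖ₑ ^ 2 :=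
    fun z => (hLz _).trans (pow_le_pow_left₀ zero_le (by
      rw [← ofReal_norm, ← ofReal_norm]
      exact ENNReal.ofReal_le_ofReal (norm_radialComp_le w z)) 2)
  have hγm : AEStronglyMeasurable (fun r => L (radialComp w (G (r • (w : Sp n)))))
      (volume.restrict (Ioo 0 R)) :=
    (L.continuous.comp (continuous_radialComp (w : Sp n))).comp_aestronglyMeasurable hG
  have hrm : AEStronglyMeasurable (fun r : ℝ => r ^ (n - 1)) (volume.restrict (Ioo 0 R)) :=
    (by fun_prop : Continuous fun r : ℝ => r ^ (n - 1)).aestronglyMeasurable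
  have hγs : IntegrableOn (fun r => r ^ (n - 1) * L (radialComp w (G (r • (w : Sp n)))) ^ 2)
      (Ioo 0 R) := by
    refine ⟨hrm.mul (hγm.pow 2), ?_⟩
    rw [hasFiniteIntegral_iff_ofReal]
    · refine lt_of_le_of_lt ?_ (lt_top_iff_ne_top.2 hGf)
      refine setLIntegral_mono' measurableSet_Ioo fun r hr => ?_
      rw [ENNReal.ofReal_mul (pow_nonneg hr.1.le _)]
      gcongr
      exact hLr _
    · filter_upwards [ae_pow_pos (n - 1) le_rfl R] with r hr
      simp only [Pi.zero_apply]
      positivity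
  refine ⟨hγm, hγs, ae_eq_primitive_of_approx (N := n - 1)
    (L.continuous.comp_aestronglyMeasurable hu) hγm hγs fun ε hε => ?_⟩
  obtain ⟨k, hk⟩ := (ht.eventually_lt_const hε).exists
  have hray : Continuous fun r : ℝ => r • (w : Sp n) := by fun_prop
  have hqc : Continuous fun r : ℝ => L (radialComp w (classicalGrad (ψ k) (r • (w : Sp n)))) :=
    L.continuous.comp ((continuous_radialComp (w : Sp n)).comp
      ((continuous_classicalGrad (hψ k).1).comp hray))
  refine ⟨fun r => L (ψ k (r • (w : Sp n))),
    fun r => L (radialComp w (classicalGrad (ψ k) (r • (w : Sp n)))), hqc, fun r hr => ?_, ?_⟩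
  · have h1 := intervalIntegral.integral_eq_sub_of_hasDerivAt (a := r) (b := R)
      (fun s _ => L.hasFDerivAt.comp_hasDerivAt s (hasDerivAt_ray (hψ k).1 (w : Sp n) s))
      (hqc.intervalIntegrable _ _)
    rw [intervalIntegral_eq_Ioo hr.2.le] at h1
    have hw : ‖(w : Sp n)‖ = 1 := norm_eq_of_mem_sphere w
    have h0 : ψ k (R • (w : Sp n)) = 0 := (hψ k).eq_zero (by
      simp [norm_smul, hw, le_abs_self])
    simp only [Function.comp_apply] at h1
    rw [h1, h0, map_zero]
    ring
  · have hA : AEMeasurable (fun r => ENNReal.ofReal (r ^ (n - 1)) *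
        ‖u (r • (w : Sp n)) - ψ k (r • (w : Sp n))‖ₑ ^ 2) (volume.restrict (Ioo 0 R)) := by
      have h1 := (hu.sub ((hψ k).1.continuous.comp hray).aestronglyMeasurable).enorm
      exact (by fun_prop : Measurable fun r : ℝ => ENNReal.ofReal (r ^ (n - 1))).aemeasurable.mul
        (h1.pow_const 2)
    refine le_trans ?_ hk.le
    simp_rw [mul_add]
    rw [lintegral_add_left' hA]
    refine add_le_add (lintegral_mono fun r => ?_) (lintegral_mono fun r => ?_)
    · rw [← map_sub]
      gcongr
      exact hLz _
    · rw [← map_sub, radialComp_sub]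
      gcongr
      exact hLr _

/-- The geometric rate makes the sum of the squared errors finite. By Tonelli the sum over `k` is
then finite on almost every ray, so one sequence converges on all these rays without passing to
subsequences. -/
theorem ae_tendsto_ray (hn : 1 ≤ n) {u : Sp n → ℂ} {G : Sp n → EuclideanSpace ℂ (Fin n)}
    (hu : AEStronglyMeasurable u (volume.restrict (ballR n R)))
    (hG : AEStronglyMeasurable G (volume.restrict (ballR n R))) {ψ : ℕ → Sp n → ℂ}
    (hψ : ∀ k, ContDiff ℝ ∞ (ψ k))
    (h1 : ∀ k, eLpNorm (fun x => u x - ψ k x) 2 (volume.restrict (ballR n R)) ≤ 2⁻¹ ^ k)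
    (h2 : ∀ k, eLpNorm (fun x => G x - classicalGrad (ψ k) x) 2 (volume.restrict (ballR n R))
      ≤ 2⁻¹ ^ k) :
    ∀ᵐ w : Sph n ∂(surf n), Tendsto (fun k => ∫⁻ r in Ioo 0 R, ENNReal.ofReal (r ^ (n - 1)) *
      (‖u (r • (w : Sp n)) - ψ k (r • (w : Sp n))‖ₑ ^ 2 +
        ‖G (r • (w : Sp n)) - classicalGrad (ψ k) (r • (w : Sp n))‖ₑ ^ 2)) atTop (𝓝 0) := by
  have hAm : ∀ k, AEMeasurable (fun x => ‖u x - ψ k x‖ₑ ^ 2)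
      (volume.restrict (ballR n R)) := fun k =>
    (hu.sub (hψ k).continuous.aestronglyMeasurable).enorm.pow_const 2
  have hFm : ∀ k, AEMeasurable (fun x => ‖u x - ψ k x‖ₑ ^ 2 +
      ‖G x - classicalGrad (ψ k) x‖ₑ ^ 2) (volume.restrict (ballR n R)) := fun k =>
    (hAm k).add
      ((hG.sub (continuous_classicalGrad (hψ k)).aestronglyMeasurable).enorm.pow_const 2)
  have hFi : ∀ k, ∫⁻ x in ballR n R, (‖u x - ψ k x‖ₑ ^ 2 +
      ‖G x - classicalGrad (ψ k) x‖ₑ ^ 2) ≤ 2 * (2⁻¹ : ℝ≥0∞) ^ k := by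
    intro k
    have hle : ((2⁻¹ : ℝ≥0∞) ^ k) ^ 2 ≤ (2⁻¹ : ℝ≥0∞) ^ k := by
      rw [sq]
      refine mul_le_of_le_one_left' (pow_le_one₀ zero_le ?_)
      exact ENNReal.inv_le_one.2 (by norm_num)
    rw [lintegral_add_left' (hAm k), two_mul]
    refine add_le_add ?_ ?_
    · refine le_trans ?_ hle
      have := pow_le_pow_left₀ zero_le (h1 k) 2
      rwa [eLpNorm_two_sq] at this
    · refine le_trans ?_ hle
      have := pow_le_pow_left₀ zero_le (h2 k) 2
      rwa [eLpNorm_two_sq] at this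
  have hsum : ∑' k, ∫⁻ x in ballR n R, (‖u x - ψ k x‖ₑ ^ 2 +
      ‖G x - classicalGrad (ψ k) x‖ₑ ^ 2) ≠ ⊤ := by
    refine ne_top_of_le_ne_top ?_ (ENNReal.tsum_le_tsum hFi)
    rw [ENNReal.tsum_mul_left, ENNReal.tsum_geometric]
    refine ENNReal.mul_ne_top (by simp) (ENNReal.inv_ne_top.2 ?_)
    simp
  have hPm := fun k => aemeasurable_lintegral_polar hn (hFm k)
  have e : ∑' k, ∫⁻ x in ballR n R, (‖u x - ψ k x‖ₑ ^ 2 + ‖G x - classicalGrad (ψ k) x‖ₑ ^ 2)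
      = ∫⁻ w : Sph n, ∑' k, (∫⁻ r in Ioo 0 R, ENNReal.ofReal (r ^ (n - 1)) *
      (‖u (r • (w : Sp n)) - ψ k (r • (w : Sp n))‖ₑ ^ 2 +
        ‖G (r • (w : Sp n)) - classicalGrad (ψ k) (r • (w : Sp n))‖ₑ ^ 2)) ∂(surf n) := by
    rw [lintegral_tsum hPm]
    exact tsum_congr fun k => lintegral_polar hn (hFm k)
  rw [e] at hsum
  filter_upwards [ae_lt_top' (AEMeasurable.tsum hPm) hsum] with w hw
  exact ENNReal.tendsto_atTop_zero_of_tsum_ne_top hw.ne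

theorem exists_ray_derivative (w : Sph n) {u : Sp n → ℂ} {G : Sp n → EuclideanSpace ℂ (Fin n)}
    (hu : AEStronglyMeasurable (fun r : ℝ => u (r • (w : Sp n))) (volume.restrict (Ioo 0 R)))
    (hG : AEStronglyMeasurable (fun r : ℝ => G (r • (w : Sp n))) (volume.restrict (Ioo 0 R)))
    (hGf : ∫⁻ r in Ioo 0 R, ENNReal.ofReal (r ^ (n - 1)) * ‖G (r • (w : Sp n))‖ₑ ^ 2 ≠ ⊤)
    {ψ : ℕ → Sp n → ℂ} (hψ : ∀ k, IsTestFun (ballR n R) (ψ k))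
    (ht : Tendsto (fun k => ∫⁻ r in Ioo 0 R, ENNReal.ofReal (r ^ (n - 1)) *
      (‖u (r • (w : Sp n)) - ψ k (r • (w : Sp n))‖ₑ ^ 2 +
        ‖G (r • (w : Sp n)) - classicalGrad (ψ k) (r • (w : Sp n))‖ₑ ^ 2)) atTop (𝓝 0)) :
    ∃ γ₁ γ₂ : ℝ → ℝ,
      AEStronglyMeasurable γ₁ (volume.restrict (Ioo 0 R)) ∧
      IntegrableOn (fun r => r ^ (n - 1) * γ₁ r ^ 2) (Ioo 0 R) ∧
      AEStronglyMeasurable γ₂ (volume.restrict (Ioo 0 R)) ∧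
      IntegrableOn (fun r => r ^ (n - 1) * γ₂ r ^ 2) (Ioo 0 R) ∧
      (∀ r, γ₁ r ^ 2 + γ₂ r ^ 2 ≤ ‖G (r • (w : Sp n))‖ ^ 2) ∧
      ∀ᵐ r ∂(volume.restrict (Ioo 0 R)), (u (r • (w : Sp n))).re = -∫ s in r..R, γ₁ s ∧
        (u (r • (w : Sp n))).im = -∫ s in r..R, γ₂ s := by
  have h1 := ray_component w Complex.reCLM Complex.abs_re_le_norm hu hG hGf hψ ht
  have h2 := ray_component w Complex.imCLM Complex.abs_im_le_norm hu hG hGf hψ ht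
  refine ⟨_, _, h1.1, h1.2.1, h2.1, h2.2.1, fun r => ?_, ?_⟩
  · have h3 := Complex.sq_norm (radialComp w (G (r • (w : Sp n))))
    rw [Complex.normSq_apply] at h3
    have h4 := pow_le_pow_left₀ (norm_nonneg _) (norm_radialComp_le w (G (r • (w : Sp n)))) 2
    rw [h3] at h4
    refine le_trans (le_of_eq ?_) h4
    rw [Complex.reCLM_apply, Complex.imCLM_apply]
    ring
  · filter_upwards [h1.2.2, h2.2.2, ae_restrict_mem measurableSet_Ioo] with r hr1 hr2 hr
    rw [intervalIntegral_eq_Ioo hr.2.le, intervalIntegral_eq_Ioo hr.2.le]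
    exact ⟨hr1, hr2⟩

theorem Admissible.ray (hn : 1 ≤ n) {φ : Sp n → ℂ} (h : Admissible R φ) :
    ∀ᵐ w : Sph n ∂(surf n), ∃ γ₁ γ₂ : ℝ → ℝ,
      AEStronglyMeasurable γ₁ (volume.restrict (Ioo 0 R)) ∧
      IntegrableOn (fun r => r ^ (n - 1) * γ₁ r ^ 2) (Ioo 0 R) ∧
      AEStronglyMeasurable γ₂ (volume.restrict (Ioo 0 R)) ∧
      IntegrableOn (fun r => r ^ (n - 1) * γ₂ r ^ 2) (Ioo 0 R) ∧
      (∀ r, γ₁ r ^ 2 + γ₂ r ^ 2 ≤ ‖weakGrad (ballR n R) φ (r • (w : Sp n))‖ ^ 2) ∧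
      ∀ᵐ r ∂(volume.restrict (Ioo 0 R)), (φ (r • (w : Sp n))).re = 1 - ∫ s in r..R, γ₁ s ∧
        (φ (r • (w : Sp n))).im = 0 - ∫ s in r..R, γ₂ s := by
  obtain ⟨hφ, hu, happ⟩ := h
  have hG : HasWeakGrad (ballR n R) φ (weakGrad (ballR n R) φ) := hφ.hasWeakGrad
  -- The gradients of `φ` and of `φ - 1` are chosen independently; uniqueness identifies them almost
  -- everywhere.
  have hGu : weakGrad (ballR n R) (fun x => φ x - 1) =ᵐ[volume.restrict (ballR n R)]
      weakGrad (ballR n R) φ := by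
    refine HasWeakGrad.weakGrad_ae Metric.isOpen_ball hu.1 ?_
    simpa [sub_eq_add_neg] using HasWeakGrad.add_const hφ.1 hG (-1)
  generalize weakGrad (ballR n R) φ = G at hG hGu ⊢
  have hφu : ∀ x, φ x = (fun x => φ x - 1) x + 1 := fun x => by ring
  generalize (fun x => φ x - 1) = u at hu happ hGu hφu
  choose ψ hψ h1 h2 using fun k : ℕ => happ ((2⁻¹ : ℝ≥0∞) ^ k) (ENNReal.pow_pos (by simp) k)
  have h2' : ∀ k, eLpNorm (fun x => G x - classicalGrad (ψ k) x) 2 (volume.restrict (ballR n R))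
      ≤ 2⁻¹ ^ k := fun k => by
    refine le_trans (le_of_eq (eLpNorm_congr_ae ?_)) (h2 k)
    filter_upwards [hGu] with x hx
    rw [hx]
  have hGm : AEMeasurable (fun x => ‖G x‖ₑ ^ 2) (volume.restrict (ballR n R)) :=
    hG.1.1.enorm.pow_const 2
  have hGi : ∫⁻ x in ballR n R, ‖G x‖ₑ ^ 2 ≠ ⊤ := by
    rw [← eLpNorm_two_sq]
    exact ENNReal.pow_ne_top hG.1.2.ne
  rw [lintegral_polar hn hGm] at hGi
  filter_upwards [ae_tendsto_ray hn hu.1.1 hG.1.1 (fun k => (hψ k).1) h1 h2',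
    ae_lt_top' (aemeasurable_lintegral_polar hn hGm) hGi, aestronglyMeasurable_ray hn hu.1.1,
    aestronglyMeasurable_ray hn hG.1.1] with w ht hw2 hw3 hw4
  obtain ⟨γ₁, γ₂, a1, a2, b1, b2, hle, hae⟩ := exists_ray_derivative w hw3 hw4 hw2.ne hψ ht
  refine ⟨γ₁, γ₂, a1, a2, b1, b2, hle, ?_⟩
  filter_upwards [hae] with r hr
  rw [hφu, Complex.add_re, Complex.add_im, hr.1, hr.2, Complex.one_re, Complex.one_im]
  constructor <;> ring

end Rays

/-! ### Minimality and uniqueness -/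

section Minimality

variable {n : ℕ} {μ : ℝ} {v : ℝ → ℝ} {R : ℝ}

theorem ofReal_mul_lintegral {α : Type*} [MeasurableSpace α] {m : Measure α} {c : ℝ} (hc : 0 ≤ c)
    (F : α → ℝ) : ENNReal.ofReal c * ∫⁻ a, ENNReal.ofReal (F a) ∂m
      = ∫⁻ a, ENNReal.ofReal (c * F a) ∂m := by
  rw [← lintegral_const_mul' _ _ ENNReal.ofReal_ne_top]
  simp_rw [ENNReal.ofReal_mul hc]

theorem lintegral_ray_congr {N : ℕ} {F G : ℝ → ℝ}
    (h : ∀ᵐ r ∂(volume.restrict (Ioo 0 R)), 0 < r → r ^ N * F r = G r) :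
    ∫⁻ r in Ioo 0 R, ENNReal.ofReal (r ^ N) * ENNReal.ofReal (F r)
      = ∫⁻ r in Ioo 0 R, ENNReal.ofReal (G r) := by
  refine lintegral_congr_ae ?_
  filter_upwards [h, ae_restrict_mem measurableSet_Ioo] with r hr hr0
  rw [← ENNReal.ofReal_mul (pow_nonneg hr0.1.le _), hr hr0.1]

theorem lintegral_ray_mono {N : ℕ} {F G : ℝ → ℝ}
    (h : ∀ᵐ r ∂(volume.restrict (Ioo 0 R)), 0 < r → G r ≤ r ^ N * F r) :
    ∫⁻ r in Ioo 0 R, ENNReal.ofReal (G r)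
      ≤ ∫⁻ r in Ioo 0 R, ENNReal.ofReal (r ^ N) * ENNReal.ofReal (F r) := by
  refine lintegral_mono_ae ?_
  filter_upwards [h, ae_restrict_mem measurableSet_Ioo] with r hr hr0
  rw [← ENNReal.ofReal_mul (pow_nonneg hr0.1.le _)]
  exact ENNReal.ofReal_le_ofReal (hr hr0.1)

/-- The tangential part of the gradient is simply discarded, so no angular averaging or
rearrangement is needed. -/
theorem admissible_ray_inequality (hn : 1 ≤ n) (hμ : 0 < μ)
    (H : RadialPotential (n - 1) (potV n μ v)) (hR : 0 < R) {f φ : ℝ → ℝ}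
    (hf : IsWeakSol (n - 1) (potV n μ v) R f φ) :
    ∃ c K : ℝ, 0 < c ∧ 0 ≤ K ∧ ∀ χ : Sp n → ℂ, Admissible R χ → ∀ᵐ w : Sph n ∂(surf n),
      (∫⁻ r in Ioo 0 R, ENNReal.ofReal (r ^ (n - 1)) * ENNReal.ofReal
        (1 / 2 * max (-v ‖r • (w : Sp n)‖) 0 * ‖χ (r • (w : Sp n))‖ ^ 2)) ≤
        ENNReal.ofReal K * (1 + ∫⁻ r in Ioo 0 R, ENNReal.ofReal (r ^ (n - 1)) *
          ‖weakGrad (ballR n R) χ (r • (w : Sp n))‖ₑ ^ 2) ∧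
      (∫⁻ r in Ioo 0 R, ENNReal.ofReal (r ^ (n - 1)) * ENNReal.ofReal
        (1 / 2 * max (-v ‖r • (w : Sp n)‖) 0 * ‖χ (r • (w : Sp n))‖ ^ 2)) +
        ENNReal.ofReal (μ * formB (n - 1) (potV n μ v) R f φ f φ) +
        ENNReal.ofReal c * (∫⁻ r in Ioo 0 R, ENNReal.ofReal (r ^ (n - 1)) * ENNReal.ofReal
          (‖χ (r • (w : Sp n)) - (f ‖r • (w : Sp n)‖ : ℂ)‖ ^ 2)) ≤
      (∫⁻ r in Ioo 0 R, ENNReal.ofReal (r ^ (n - 1)) * ENNReal.ofReal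
        (μ * ‖weakGrad (ballR n R) χ (r • (w : Sp n))‖ ^ 2 +
          1 / 2 * max (v ‖r • (w : Sp n)‖) 0 * ‖χ (r • (w : Sp n))‖ ^ 2)) +
        ENNReal.ofReal (-(μ * formB (n - 1) (potV n μ v) R f φ f φ)) := by
  obtain ⟨c, K, hc, hK, hmain⟩ := ray_inequality H hR hf
  refine ⟨μ * c, μ * K, by positivity, by positivity, fun χ hχ => ?_⟩
  filter_upwards [hχ.ray hn] with w ⟨γ₁, γ₂, hm₁, hs₁, hm₂, hs₂, hle, hae⟩
  obtain ⟨hb, hmin⟩ := hmain γ₁ γ₂ hm₁ hs₁ hm₂ hs₂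
  generalize weakGrad (ballR n R) χ = G at hle ⊢
  have hw : ‖(w : Sp n)‖ = 1 := norm_eq_of_mem_sphere w
  have hnorm : ∀ r : ℝ, 0 < r → ‖r • (w : Sp n)‖ = r := fun r hr => by
    rw [norm_smul, hw, mul_one, Real.norm_of_nonneg hr.le]
  have hχsq : ∀ z : ℂ, ‖z‖ ^ 2 = z.re ^ 2 + z.im ^ 2 := fun z => by
    rw [Complex.sq_norm, Complex.normSq_apply]; ring
  have eB : ∫⁻ r in Ioo 0 R, ENNReal.ofReal (r ^ (n - 1)) * ENNReal.ofReal
        (1 / 2 * max (-v ‖r • (w : Sp n)‖) 0 * ‖χ (r • (w : Sp n))‖ ^ 2) =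
      ENNReal.ofReal μ * ∫⁻ r in Ioo 0 R, ENNReal.ofReal (max (-potV n μ v r) 0 *
        ((1 - ∫ s in r..R, γ₁ s) ^ 2 + (0 - ∫ s in r..R, γ₂ s) ^ 2)) := by
    rw [ofReal_mul_lintegral hμ.le]
    refine lintegral_ray_congr ?_
    filter_upwards [hae] with r hr hr0
    rw [hχsq, hr.1, hr.2, hnorm r hr0, max_neg_potV hμ v hr0]
    field_simp
  have eD : ∫⁻ r in Ioo 0 R, ENNReal.ofReal (r ^ (n - 1)) * ENNReal.ofReal
          (‖χ (r • (w : Sp n)) - (f ‖r • (w : Sp n)‖ : ℂ)‖ ^ 2) =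
      ∫⁻ r in Ioo 0 R, ENNReal.ofReal (r ^ (n - 1) *
        (((1 - ∫ s in r..R, γ₁ s) - f r) ^ 2 + (0 - ∫ s in r..R, γ₂ s) ^ 2)) := by
    refine lintegral_ray_congr ?_
    filter_upwards [hae] with r hr hr0
    rw [hχsq, Complex.sub_re, Complex.sub_im, hr.1, hr.2, hnorm r hr0, Complex.ofReal_re,
      Complex.ofReal_im, sub_zero]
  have eA : ENNReal.ofReal μ * (∫⁻ r in Ioo 0 R, ENNReal.ofReal
        (r ^ (n - 1) * (γ₁ r ^ 2 + γ₂ r ^ 2) + max (potV n μ v r) 0 *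
          ((1 - ∫ s in r..R, γ₁ s) ^ 2 + (0 - ∫ s in r..R, γ₂ s) ^ 2))) ≤
      ∫⁻ r in Ioo 0 R, ENNReal.ofReal (r ^ (n - 1)) * ENNReal.ofReal
        (μ * ‖G (r • (w : Sp n))‖ ^ 2 +
          1 / 2 * max (v ‖r • (w : Sp n)‖) 0 * ‖χ (r • (w : Sp n))‖ ^ 2) := by
    rw [ofReal_mul_lintegral hμ.le]
    refine lintegral_ray_mono ?_
    filter_upwards [hae] with r hr hr0
    rw [hχsq (χ _), hr.1, hr.2, hnorm r hr0, potV_pos_part hμ v hr0]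
    have hp : 0 ≤ μ * r ^ (n - 1) := by positivity
    have h1 := mul_le_mul_of_nonneg_left (hle r) hp
    have e : ∀ X : ℝ, μ * (r ^ (n - 1) * (γ₁ r ^ 2 + γ₂ r ^ 2) +
        r ^ (n - 1) / (2 * μ) * max (v r) 0 * X) =
        μ * r ^ (n - 1) * (γ₁ r ^ 2 + γ₂ r ^ 2) + r ^ (n - 1) * (1 / 2 * max (v r) 0 * X) := by
      intro X; field_simp
    rw [e]
    linarith
  constructor
  · rw [eB, ENNReal.ofReal_mul hμ.le, mul_assoc]
    gcongr
    refine hb.trans ?_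
    have k1 := kin_nonneg (n - 1) R γ₁
    have k2 := kin_nonneg (n - 1) R γ₂
    rw [ENNReal.ofReal_mul hK, ENNReal.ofReal_add zero_le_one (by positivity), ENNReal.ofReal_one]
    gcongr
    rw [kin, kin, ofReal_integral_add hs₁ hs₂]
    · refine setLIntegral_mono' measurableSet_Ioo fun r hr => ?_
      rw [← mul_add, ENNReal.ofReal_mul (pow_nonneg hr.1.le _), ← ofReal_norm,
        ← ENNReal.ofReal_pow (norm_nonneg _)]
      gcongr
      exact hle r
    · filter_upwards [ae_pow_pos (n - 1) le_rfl R] with r hr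
      positivity
  · have h1 := mul_le_mul_right hmin (ENNReal.ofReal μ)
    rw [mul_add, mul_add, mul_add, ← eB, ← eD, ← mul_assoc, ← ENNReal.ofReal_mul hμ.le,
      ← ENNReal.ofReal_mul hμ.le, ← ENNReal.ofReal_mul hμ.le, mul_neg] at h1
    exact h1.trans (by gcongr)

theorem lintegral_combine {α : Type*} [MeasurableSpace α] {m : Measure α} {A B D : α → ℝ≥0∞}
    {a b c : ℝ≥0∞} (hA : AEMeasurable A m) (hB : AEMeasurable B m) (hc : c ≠ ⊤)
    (h : ∀ᵐ x ∂m, B x + a + c * D x ≤ A x + b) :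
    (∫⁻ x, B x ∂m) + (∫⁻ _, a ∂m) + c * (∫⁻ x, D x ∂m) ≤ (∫⁻ x, A x ∂m) + ∫⁻ _, b ∂m := by
  have hBa : AEMeasurable (fun x => B x + a) m := hB.add aemeasurable_const
  rw [← lintegral_add_left' hB, ← lintegral_const_mul' _ _ hc, ← lintegral_add_left' hBa,
    ← lintegral_add_left' hA]
  exact lintegral_mono_ae h

/-- The ray inequality integrated over the sphere. Finiteness of the negative part ensures that the
energy is never a difference of two infinities; the `L²` term with coefficient `c` serves
uniqueness. -/
theorem energy_deficit (hn : 1 ≤ n) (hμ : 0 < μ)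
    (H : RadialPotential (n - 1) (potV n μ v)) (hR : 0 < R) {f φ : ℝ → ℝ}
    (hf : IsWeakSol (n - 1) (potV n μ v) R f φ) :
    ∃ c : ℝ, 0 < c ∧ ∀ χ : Sp n → ℂ, Admissible R χ →
      (∫⁻ x in ballR n R, ENNReal.ofReal (1 / 2 * max (-v ‖x‖) 0 * ‖χ x‖ ^ 2)) ≠ ⊤ ∧
      (∫⁻ x in ballR n R, ENNReal.ofReal (1 / 2 * max (-v ‖x‖) 0 * ‖χ x‖ ^ 2)) +
        ENNReal.ofReal (μ * formB (n - 1) (potV n μ v) R f φ f φ * sphereArea n) +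
        ENNReal.ofReal c * (∫⁻ x in ballR n R, ENNReal.ofReal (‖χ x - (f ‖x‖ : ℂ)‖ ^ 2)) ≤
      (∫⁻ x in ballR n R, ENNReal.ofReal (μ * ‖weakGrad (ballR n R) χ x‖ ^ 2 +
          1 / 2 * max (v ‖x‖) 0 * ‖χ x‖ ^ 2)) +
        ENNReal.ofReal (-(μ * formB (n - 1) (potV n μ v) R f φ f φ * sphereArea n)) := by
  obtain ⟨c, K, hc, hK, hmain⟩ := admissible_ray_inequality hn hμ H hR hf
  refine ⟨c, hc, fun χ hχ => ?_⟩
  have hray := hmain χ hχ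
  have hGm := hχ.1.hasWeakGrad.1
  generalize weakGrad (ballR n R) χ = G at hray hGm ⊢
  have hχm : AEMeasurable χ (volume.restrict (ballR n R)) := hχ.1.1.1.aemeasurable
  have hvm : AEMeasurable (fun x : Sp n => v ‖x‖) (volume.restrict (ballR n R)) :=
    (((aestronglyMeasurable_of_potV hμ H.meas).mono_measure
      (Measure.restrict_mono Ioo_subset_Ioi_self le_rfl)).comp_quasiMeasurePreserving
      (quasiMeasurePreserving_norm hn R)).aemeasurable
  have hfm : AEMeasurable (fun x : Sp n => (f ‖x‖ : ℂ)) (volume.restrict (ballR n R)) :=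
    Complex.measurable_ofReal.comp_aemeasurable
      (hf.fe.meas_fun.comp_quasiMeasurePreserving (quasiMeasurePreserving_norm hn R)).aemeasurable
  have mB : AEMeasurable (fun x : Sp n => ENNReal.ofReal (1 / 2 * max (-v ‖x‖) 0 * ‖χ x‖ ^ 2))
      (volume.restrict (ballR n R)) :=
    (((hvm.neg.sup aemeasurable_const).const_mul (1 / 2)).mul
      (hχm.norm.pow_const 2)).ennreal_ofReal
  have mA : AEMeasurable (fun x : Sp n => ENNReal.ofReal (μ * ‖G x‖ ^ 2 +
      1 / 2 * max (v ‖x‖) 0 * ‖χ x‖ ^ 2)) (volume.restrict (ballR n R)) :=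
    (((hGm.1.aemeasurable.norm.pow_const 2).const_mul μ).add
      (((hvm.sup aemeasurable_const).const_mul (1 / 2)).mul
        (hχm.norm.pow_const 2))).ennreal_ofReal
  have mD : AEMeasurable (fun x : Sp n => ENNReal.ofReal (‖χ x - (f ‖x‖ : ℂ)‖ ^ 2))
      (volume.restrict (ballR n R)) := by fun_prop
  have mG : AEMeasurable (fun x => ‖G x‖ₑ ^ 2) (volume.restrict (ballR n R)) :=
    hGm.1.enorm.pow_const 2
  have hGi : ∫⁻ x in ballR n R, ‖G x‖ₑ ^ 2 ≠ ⊤ := by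
    rw [← eLpNorm_two_sq]
    exact ENNReal.pow_ne_top hGm.2.ne
  have hs := sphereArea_pos hn
  have hu := surf_univ hn
  have hcst : ∀ x : ℝ, ∫⁻ _ : Sph n, ENNReal.ofReal x ∂(surf n)
      = ENNReal.ofReal (x * sphereArea n) := fun x => by
    rw [lintegral_const, hu, ENNReal.ofReal_mul' hs.le]
  constructor
  · rw [lintegral_polar hn mB]
    refine ne_top_of_le_ne_top ?_ (lintegral_mono_ae (hray.mono fun w hw => hw.1))
    rw [lintegral_const_mul' _ _ ENNReal.ofReal_ne_top, lintegral_add_left measurable_const,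
      lintegral_const, hu, ← lintegral_polar hn mG, one_mul]
    exact ENNReal.mul_ne_top ENNReal.ofReal_ne_top
      (ENNReal.add_ne_top.2 ⟨ENNReal.ofReal_ne_top, hGi⟩)
  · have h1 := lintegral_combine (aemeasurable_lintegral_polar hn mA)
      (aemeasurable_lintegral_polar hn mB) ENNReal.ofReal_ne_top (hray.mono fun w hw => hw.2)
    rw [hcst, hcst] at h1
    rw [lintegral_polar hn mB, lintegral_polar hn mA, lintegral_polar hn mD, ← neg_mul]
    exact h1

theorem coe_le_sub_of_add_le {A B D : ℝ≥0∞} {e : ℝ} (hB : B ≠ ⊤)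
    (h : B + ENNReal.ofReal e + D ≤ A + ENNReal.ofReal (-e)) :
    (e : EReal) ≤ (A : EReal) - (B : EReal) ∧
      ((A : EReal) - (B : EReal) ≤ (e : EReal) → D = 0) := by
  lift B to NNReal using hB
  induction A with
  | top =>
    have : ((⊤ : ℝ≥0∞) : EReal) - ((B : ℝ≥0∞) : EReal) = ⊤ := by
      rw [EReal.coe_ennreal_top]
      exact EReal.top_sub_coe _
    rw [this]
    exact ⟨le_top, fun h' => absurd h' (by simp)⟩
  | coe A =>
    have hD : D ≠ ⊤ := by
      rintro rfl
      rw [add_top, top_le_iff] at h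
      simp at h
    lift D to NNReal using hD
    have h' := ENNReal.toReal_mono (by simp) h
    rw [ENNReal.toReal_add (by simp) (by simp), ENNReal.toReal_add (by simp) (by simp),
      ENNReal.toReal_add (by simp) (by simp), ENNReal.toReal_ofReal', ENNReal.toReal_ofReal'] at h'
    simp only [ENNReal.coe_toReal] at h'
    have hm : max e 0 - max (-e) 0 = e := by
      rcases le_total 0 e with he | he
      · rw [max_eq_left he, max_eq_right (by linarith)]; ring
      · rw [max_eq_right he, max_eq_left (by linarith)]; ring
    have hsub : ((A : ℝ≥0∞) : EReal) - ((B : ℝ≥0∞) : EReal) = (((A : ℝ) - B : ℝ) : EReal) := by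
      rw [EReal.coe_sub]; rfl
    have hD0 : (0 : ℝ) ≤ D := D.2
    rw [hsub, EReal.coe_le_coe_iff, EReal.coe_le_coe_iff]
    refine ⟨by linarith, fun h2 => ?_⟩
    have : (D : ℝ) = 0 := by linarith
    exact_mod_cast this

/-- The radial minimizer. -/
theorem radial_minimizer (hn : 1 ≤ n) (hμ : 0 < μ)
    (H : RadialPotential (n - 1) (potV n μ v)) (hR : 0 < R) {f φ : ℝ → ℝ}
    (hf : IsWeakSol (n - 1) (potV n μ v) R f φ) :
    IsEnergyMinimizer R μ v (fun x : Sp n => (f ‖x‖ : ℂ)) ∧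
      (∀ χ : Sp n → ℂ, IsEnergyMinimizer R μ v χ →
        χ =ᵐ[volume.restrict (ballR n R)] fun x => (f ‖x‖ : ℂ)) ∧
      energy (ballR n R) μ v (fun x => (f ‖x‖ : ℂ)) =
        ((μ * formB (n - 1) (potV n μ v) R f φ f φ * sphereArea n : ℝ) : EReal) ∧
      HasWeakGrad (ballR n R) (fun x => (f ‖x‖ : ℂ)) (radGrad φ) := by
  have hball : MeasurableSet (ballR n R) := Metric.isOpen_ball.measurableSet
  obtain ⟨h1, h2⟩ := hasWeakGrad_radLift hn hR.le hf.fe.meas hf.fe.sq (ballR n R)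
  have h10 := memH10_radLift hn hR.le hf.fe.meas hf.fe.sq
  have hae : ∀ᵐ x ∂(volume.restrict (ballR n R)), x ∈ ballR n R ∧ x ≠ 0 := by
    filter_upwards [ae_restrict_mem hball, ae_ne_zero hn (ballR n R)] with x hx hx0 using ⟨hx, hx0⟩
  have hval : ∀ x ∈ ballR n R, x ≠ 0 → (f ‖x‖ : ℂ) = radLift R φ x + 1 := by
    intro x hx hx0
    have hxR : ‖x‖ < R := by simpa using hx
    rw [radLift_eq φ hxR.le, hf.fe.prim ‖x‖ ⟨norm_pos_iff.2 hx0, hxR.le⟩, hf.one]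
    push_cast
    ring
  have hcongr : ∀ {a b : Sp n → ℂ} {G : Sp n → EuclideanSpace ℂ (Fin n)},
      a =ᵐ[volume.restrict (ballR n R)] b → HasWeakGrad (ballR n R) a G →
      HasWeakGrad (ballR n R) b G := by
    intro a b G hab h
    refine ⟨h.1, fun ψ hψ i => ?_⟩
    rw [← h.2 ψ hψ i]
    refine integral_congr_ae ?_
    filter_upwards [hab] with x hx
    rw [hx]
  have hGcongr : ∀ {a : Sp n → ℂ} {G G' : Sp n → EuclideanSpace ℂ (Fin n)},
      G =ᵐ[volume.restrict (ballR n R)] G' → HasWeakGrad (ballR n R) a G →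
      HasWeakGrad (ballR n R) a G' := by
    intro a G G' hab h
    refine ⟨h.1.ae_eq hab, fun ψ hψ i => ?_⟩
    rw [h.2 ψ hψ i]
    congr 1
    refine integral_congr_ae ?_
    filter_upwards [hab] with x hx
    rw [hx]
  have eG : (ballR n R).indicator (radGrad φ) =ᵐ[volume.restrict (ballR n R)]
      (radGrad φ : Sp n → _) := indicator_ae_eq_restrict hball
  have e1 : (fun x : Sp n => radLift R φ x + 1) =ᵐ[volume.restrict (ballR n R)]
      fun x => (f ‖x‖ : ℂ) := by
    filter_upwards [hae] with x hx
    rw [hval x hx.1 hx.2]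
  have e2 : (radLift R φ : Sp n → ℂ) =ᵐ[volume.restrict (ballR n R)]
      fun x => (f ‖x‖ : ℂ) - 1 := by
    filter_upwards [e1] with x hx
    rw [← hx]
    ring
  have hfin : IsFiniteMeasure (volume.restrict (ballR n R)) :=
    ⟨by rw [Measure.restrict_apply_univ]; exact measure_ball_lt_top⟩
  have hGw : HasWeakGrad (ballR n R) (fun x => (f ‖x‖ : ℂ)) (radGrad φ) :=
    hcongr e1 (hGcongr eG (HasWeakGrad.add_const h1 h2 1))
  have hL2 : MemLp (fun x : Sp n => (f ‖x‖ : ℂ)) 2 (volume.restrict (ballR n R)) :=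
    (h1.add (memLp_const 1)).ae_eq e1
  have hGw' : HasWeakGrad (ballR n R) (fun x => (f ‖x‖ : ℂ) - 1) (radGrad φ) :=
    hcongr e2 (hGcongr eG h2)
  have hadm : Admissible R (fun x : Sp n => (f ‖x‖ : ℂ)) := by
    -- Up to a null set `f(|x|) - 1` is the lift of `φ`, so it inherits the approximation by test
    -- functions.
    refine ⟨⟨hL2, _, hGw⟩, ⟨h1.ae_eq e2, _, hGw'⟩, fun ε hε => ?_⟩
    obtain ⟨ψ, hψ, h3, h4⟩ := h10.2 ε hε
    refine ⟨ψ, hψ, le_trans (le_of_eq (eLpNorm_congr_ae ?_)) h3,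
      le_trans (le_of_eq (eLpNorm_congr_ae ?_)) h4⟩
    · filter_upwards [e2] with x hx
      rw [hx]
    · filter_upwards [hGw'.weakGrad_ae Metric.isOpen_ball (h1.ae_eq e2),
        h2.weakGrad_ae Metric.isOpen_ball h1, eG] with x hx hx' hx2
      rw [hx, hx', hx2]
  have hE : energy (ballR n R) μ v (fun x => (f ‖x‖ : ℂ)) =
      ((μ * formB (n - 1) (potV n μ v) R f φ f φ * sphereArea n : ℝ) : EReal) := by
    refine energy_radial hn hμ H.meas hf.fe subset_rfl ?_
    filter_upwards [hae, hGw.weakGrad_ae Metric.isOpen_ball hL2] with x hx hx2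
    refine ⟨fun _ => ?_, fun h => absurd hx.1 h⟩
    rw [hx2, norm_radGrad _ hx.2, Complex.norm_real, Real.norm_eq_abs]
    exact ⟨rfl, rfl⟩
  obtain ⟨c, hc, hdef⟩ := energy_deficit hn hμ H hR hf
  refine ⟨⟨hadm, fun χ hχ => ?_⟩, fun χ hχ => ?_, hE, hGw⟩
  · obtain ⟨hB, hle⟩ := hdef χ hχ
    rw [hE]
    exact (coe_le_sub_of_add_le hB hle).1
  · obtain ⟨hB, hle⟩ := hdef χ hχ.1
    have h3 := hχ.2 _ hadm
    rw [hE] at h3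
    -- A second minimizer has no excess energy, hence zero `L²` distance to the radial one.
    have h4 := (coe_le_sub_of_add_le hB hle).2 h3
    rw [mul_eq_zero, or_iff_right (ENNReal.ofReal_pos.2 hc).ne', lintegral_eq_zero_iff'] at h4
    · filter_upwards [h4] with x hx
      have h5 : ‖χ x - (f ‖x‖ : ℂ)‖ ^ 2 ≤ 0 := ENNReal.ofReal_eq_zero.1 hx
      have h6 : ‖χ x - (f ‖x‖ : ℂ)‖ = 0 :=
        pow_eq_zero_iff two_ne_zero |>.1 (le_antisymm h5 (sq_nonneg _))
      exact sub_eq_zero.1 (norm_eq_zero.1 h6)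
    · exact ((hχ.1.1.1.1.sub hL2.1).norm.aemeasurable.pow_const 2).ennreal_ofReal

end Minimality

/-! ### The scattering equation -/

section Equation

variable {n : ℕ} {μ : ℝ} {v : ℝ → ℝ} {R : ℝ}

theorem integrable_radMeas_iff {F : ℝ → ℝ} : Integrable F (radMeas n R) ↔
    IntegrableOn (fun r => r ^ (n - 1) * F r) (Ioo 0 R) := by
  rw [radMeas, integrable_withDensity_iff_integrable_smul' (by fun_prop)
    (Eventually.of_forall fun r => ENNReal.ofReal_lt_top)]
  refine integrable_congr ?_
  filter_upwards [ae_restrict_mem measurableSet_Ioo] with r hr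
  rw [ENNReal.toReal_ofReal (pow_nonneg hr.1.le _), smul_eq_mul]

theorem integral_radMeas (F : ℝ → ℝ) :
    ∫ r, F r ∂(radMeas n R) = ∫ r in Ioo 0 R, r ^ (n - 1) * F r := by
  rw [radMeas, integral_withDensity_eq_integral_toReal_smul (by fun_prop)
    (Eventually.of_forall fun r => ENNReal.ofReal_lt_top)]
  refine setIntegral_congr_fun measurableSet_Ioo fun r hr => ?_
  rw [ENNReal.toReal_ofReal (pow_nonneg hr.1.le _), smul_eq_mul]

theorem integrable_comp_polar (hn : 1 ≤ n) {F : Sp n → ℝ} (hF : IntegrableOn F (ballR n R)) :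
    Integrable (fun z => F (polar z)) ((surf n).prod (radMeas n R)) :=
  (measurePreserving_polar hn R).integrable_comp_of_integrable hF

theorem ae_integrable_ray (hn : 1 ≤ n) {F : Sp n → ℝ} (hF : IntegrableOn F (ballR n R)) :
    ∀ᵐ w : Sph n ∂(surf n),
      IntegrableOn (fun r => r ^ (n - 1) * F (r • (w : Sp n))) (Ioo 0 R) := by
  filter_upwards [(integrable_comp_polar hn hF).prod_right_ae] with w hw
  exact integrable_radMeas_iff.1 hw

theorem integral_ball_eq_zero (hn : 1 ≤ n) {F : Sp n → ℝ} (hF : IntegrableOn F (ballR n R))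
    (h : ∀ᵐ w : Sph n ∂(surf n), ∫ r in Ioo 0 R, r ^ (n - 1) * F (r • (w : Sp n)) = 0) :
    ∫ x in ballR n R, F x = 0 := by
  have hFm := hF.aestronglyMeasurable
  rw [← (measurePreserving_polar hn R).map_eq] at hFm ⊢
  rw [integral_map measurable_polar.aemeasurable hFm, integral_prod _ (integrable_comp_polar hn hF)]
  refine integral_eq_zero_of_ae ?_
  filter_upwards [h] with w hw
  rw [integral_radMeas]
  exact hw

theorem laplacian_eq_sum {ψ : Sp n → ℝ} (hψ : ContDiff ℝ ∞ ψ) (x : Sp n) :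
    Laplacian.laplacian ψ x = ∑ i, partialDeriv i (partialDeriv i ψ) x := by
  rw [InnerProductSpace.laplacian_eq_iteratedFDeriv_orthonormalBasis ψ
    (EuclideanSpace.basisFun (Fin n) ℝ)]
  refine Finset.sum_congr rfl fun i _ => ?_
  have hd : DifferentiableAt ℝ (fderiv ℝ ψ) x :=
    (hψ.fderiv_right (m := ∞) (by simp)).differentiable (by simp) x
  rw [iteratedFDeriv_two_apply]
  have e : partialDeriv i (partialDeriv i ψ) x =
      fderiv ℝ (fun y => fderiv ℝ ψ y (EuclideanSpace.single i 1)) x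
        (EuclideanSpace.single i 1) := rfl
  rw [e, fderiv_clm_apply hd (differentiableAt_const _)]
  simp

theorem integrableOn_pot_sq_ball (hn : 1 ≤ n) (hμ : 0 < μ) {f φ : ℝ → ℝ}
    (hf : FiniteEnergy (n - 1) (potV n μ v) R f φ) :
    IntegrableOn (fun x : Sp n => v ‖x‖ * f ‖x‖ ^ 2) (ballR n R) := by
  have h1 : IntegrableOn (fun r => r ^ (n - 1) * (Ioo 0 R).indicator (fun r => v r * f r ^ 2) r)
      (Ioi 0) := by
    have e : (fun r => r ^ (n - 1) * (Ioo 0 R).indicator (fun r => v r * f r ^ 2) r) =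
        (Ioo 0 R).indicator fun r => 2 * μ * (potV n μ v r * f r ^ 2) := by
      ext r
      by_cases hr : r ∈ Ioo 0 R
      · rw [indicator_of_mem hr, indicator_of_mem hr, potV]
        field_simp
      · rw [indicator_of_notMem hr, indicator_of_notMem hr, mul_zero]
    rw [e]
    exact ((integrable_indicator_iff measurableSet_Ioo).2 (hf.pot.const_mul _)).integrableOn
  have h2 := ((integrable_comp_norm_iff hn).2 h1).integrableOn (s := ballR n R)
  refine h2.congr ?_
  filter_upwards [ae_restrict_mem Metric.isOpen_ball.measurableSet, ae_ne_zero hn (ballR n R)]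
    with x hx hx0
  have : ‖x‖ ∈ Ioo 0 R := ⟨norm_pos_iff.2 hx0, by simpa using hx⟩
  rw [indicator_of_mem this]

/-- From `|f| ≤ 1 + f²`: the potential is integrable on `K`, and `v f²` is integrable by finiteness
of the energy. -/
theorem integrableOn_pot_mul (hn : 1 ≤ n) (hμ : 0 < μ) {f φ : ℝ → ℝ}
    (hf : FiniteEnergy (n - 1) (potV n μ v) R f φ) {K : Set (Sp n)}
    (hKb : K ⊆ ballR n R) (hv : IntegrableOn (fun x : Sp n => v ‖x‖) K) :
    IntegrableOn (fun x : Sp n => v ‖x‖ * f ‖x‖) K := by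
  have h1 := (integrableOn_pot_sq_ball hn hμ hf).mono_set hKb
  have hfm : AEStronglyMeasurable (fun x : Sp n => f ‖x‖) (volume.restrict K) :=
    (hf.meas_fun.comp_quasiMeasurePreserving (quasiMeasurePreserving_norm hn R)).mono_measure
      (Measure.restrict_mono hKb le_rfl)
  refine Integrable.mono' (hv.norm.add h1.norm) (hv.aestronglyMeasurable.mul hfm)
    (Eventually.of_forall fun x => ?_)
  simp only [Pi.add_apply, norm_mul, norm_pow, Real.norm_eq_abs]
  have h2 : |f ‖x‖| ≤ 1 + |f ‖x‖| ^ 2 := by nlinarith [sq_nonneg (|f ‖x‖| - 1)]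
  have h3 := mul_le_mul_of_nonneg_left h2 (abs_nonneg (v ‖x‖))
  linarith

/-- Along a ray a test function is itself admissible in the one-dimensional weak equation, because
it vanishes at `R` and no condition is needed at `0`. Since `∇f(|x|)` is radial, only the radial
derivative of `ψ` enters, and Fubini collects the rays. -/
theorem weak_equation_ball (hn : 1 ≤ n) (hμ : 0 < μ)
    {f φ : ℝ → ℝ} (hf : IsWeakSol (n - 1) (potV n μ v) R f φ)
    (hV : AEStronglyMeasurable (potV n μ v) (volume.restrict (Ioo 0 R)))
    (hG : MemLp (radGrad φ : Sp n → _) 2 (volume.restrict (ballR n R))) {ψ : Sp n → ℝ}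
    (hψ : IsTestFun (ballR n R) ψ) (hv : IntegrableOn (fun x : Sp n => v ‖x‖) (tsupport ψ)) :
    μ * (∑ i, ∫ x in ballR n R, partialDeriv i ψ x * (φ ‖x‖ * (x i / ‖x‖))) +
      1 / 2 * ∫ x in ballR n R, ψ x * (v ‖x‖ * f ‖x‖) = 0 := by
  obtain ⟨M, hM⟩ := hψ.2.1.exists_bound_of_continuous hψ.1.continuous
  have hbig : ∀ {F : Sp n → ℝ}, IntegrableOn F (tsupport ψ) → Integrable (fun x => ψ x * F x) := by
    intro F hF
    have h1 : IntegrableOn (fun x => ψ x * F x) (tsupport ψ) :=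
      hF.bdd_mul hψ.1.continuous.aestronglyMeasurable (Eventually.of_forall hM)
    rwa [integrableOn_iff_integrable_of_support_subset] at h1
    intro x hx
    exact subset_tsupport ψ fun h => hx (by simp [h])
  have h1 : ∀ i, IntegrableOn (fun x : Sp n => partialDeriv i ψ x * (φ ‖x‖ * (x i / ‖x‖)))
      (ballR n R) := by
    intro i
    have := (integrable_smul_of_memLp ((hψ.partialDeriv i).memLp 2 _) (memLp_component hG i)).re
    refine this.congr (Eventually.of_forall fun x => ?_)
    simp [radGrad]
  have h2 : IntegrableOn (fun x : Sp n => ψ x * (v ‖x‖ * f ‖x‖)) (ballR n R) :=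
    (hbig (integrableOn_pot_mul hn hμ hf.fe hψ.2.2 hv)).integrableOn
  have h3 : IntegrableOn (fun x : Sp n => ψ x * v ‖x‖) (ballR n R) := (hbig hv).integrableOn
  have hsum : IntegrableOn (fun x : Sp n => μ * ∑ i, partialDeriv i ψ x * (φ ‖x‖ * (x i / ‖x‖)))
      (ballR n R) := (integrable_finsetSum _ fun i _ => h1 i).const_mul μ
  rw [← integral_finsetSum _ fun i _ => h1 i, ← integral_const_mul, ← integral_const_mul,
    ← integral_add hsum (h2.const_mul _)]
  refine integral_ball_eq_zero hn (hsum.add (h2.const_mul _)) ?_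
  -- For almost every direction `ψ v` is integrable along the ray; as `ψ` is bounded by `M`, the
  -- restriction of `ψ` to the ray has finite potential energy.
  filter_upwards [ae_integrable_ray hn h3] with w hw
  have hwn : ‖(w : Sp n)‖ = 1 := norm_eq_of_mem_sphere w
  set h : ℝ → ℝ := fun r => ψ (r • (w : Sp n)) with hh
  set η : ℝ → ℝ := fun r => ∑ i, (w : Sp n) i * partialDeriv i ψ (r • (w : Sp n)) with hη
  have hηc : Continuous η := by
    refine continuous_finsetSum _ fun i _ => continuous_const.mul ?_
    exact (hψ.partialDeriv i).1.continuous.comp (by fun_prop)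
  have hder : ∀ r, HasDerivAt h (η r) r := by
    intro r
    have a1 : HasFDerivAt ψ (fderiv ℝ ψ (r • (w : Sp n))) (r • (w : Sp n)) :=
      (hψ.1.differentiable (by simp) _).hasFDerivAt
    have a2 : HasDerivAt (fun s : ℝ => s • (w : Sp n)) w r := by
      simpa using (hasDerivAt_id r).smul_const (w : Sp n)
    have a3 := a1.comp_hasDerivAt r a2
    have e : (w : Sp n) = ∑ i, (w : Sp n) i • EuclideanSpace.single i (1 : ℝ) := by
      have := (EuclideanSpace.basisFun (Fin n) ℝ).sum_repr (w : Sp n)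
      simpa using this.symm
    have a4 := congrArg (fderiv ℝ ψ (r • (w : Sp n))) e
    rw [map_sum] at a4
    have a5 : fderiv ℝ ψ (r • (w : Sp n)) w = η r := by
      rw [a4]
      simp [hη, partialDeriv]
    rwa [a5] at a3
  have hc : Continuous h := continuous_iff_continuousAt.2 fun r => (hder r).continuousAt
  have hfe : FiniteEnergy (n - 1) (potV n μ v) R h η := by
    refine ⟨hηc.aestronglyMeasurable, ((by fun_prop : Continuous fun r => r ^ (n - 1) * η r ^ 2).continuousOn.integrableOn_Icc).mono_set
        Ioo_subset_Icc_self, fun r _ => ?_, ?_⟩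
    · rw [intervalIntegral.integral_eq_sub_of_hasDerivAt (fun s _ => hder s)
        (hηc.intervalIntegrable _ _)]
      ring
    · refine Integrable.mono' ((hw.norm).const_mul (M / (2 * μ)))
        (hV.mul (hc.aestronglyMeasurable.pow 2)) ?_
      filter_upwards [ae_restrict_mem measurableSet_Ioo] with r hr
      have hr0 : ‖r • (w : Sp n)‖ = r := by
        rw [norm_smul, hwn, mul_one, Real.norm_of_nonneg hr.1.le]
      have hMr := hM (r • (w : Sp n))
      have hp : 0 < r ^ (n - 1) := pow_pos hr.1 _
      simp only [hr0, hh, potV, norm_mul, norm_div, norm_pow, Real.norm_of_nonneg hr.1.le,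
        Real.norm_of_nonneg hμ.le, Real.norm_ofNat]
      calc r ^ (n - 1) * ‖v r‖ / (2 * μ) * ‖ψ (r • (w : Sp n))‖ ^ 2
          = ‖ψ (r • (w : Sp n))‖ / (2 * μ) * (r ^ (n - 1) * (‖ψ (r • (w : Sp n))‖ * ‖v r‖)) := by
            ring
        _ ≤ M / (2 * μ) * (r ^ (n - 1) * (‖ψ (r • (w : Sp n))‖ * ‖v r‖)) := by gcongr
  have hhR : h R = 0 := hψ.eq_zero (by simp [norm_smul, hwn, le_abs_self])
  have hweak := hf.weak h η hfe hhR
  rw [formB] at hweak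
  have e : EqOn (fun r => r ^ (n - 1) * (μ * ∑ i, partialDeriv i ψ (r • (w : Sp n)) *
        (φ ‖r • (w : Sp n)‖ * ((r • (w : Sp n)) i / ‖r • (w : Sp n)‖)) +
        1 / 2 * (ψ (r • (w : Sp n)) * (v ‖r • (w : Sp n)‖ * f ‖r • (w : Sp n)‖))))
      (fun r => μ * (r ^ (n - 1) * (φ r * η r) + potV n μ v r * (f r * h r))) (Ioo 0 R) := by
    intro r hr
    have hr0 : ‖r • (w : Sp n)‖ = r := by
      rw [norm_smul, hwn, mul_one, Real.norm_of_nonneg hr.1.le]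
    have hrne : r ≠ 0 := hr.1.ne'
    simp only [hr0, hη, hh, potV, PiLp.smul_apply, smul_eq_mul]
    have : ∑ i, partialDeriv i ψ (r • (w : Sp n)) * (φ r * (r * (w : Sp n) i / r)) =
        φ r * ∑ i, (w : Sp n) i * partialDeriv i ψ (r • (w : Sp n)) := by
      rw [Finset.mul_sum]
      refine Finset.sum_congr rfl fun i _ => ?_
      field_simp
    rw [this]
    field_simp
  refine (setIntegral_congr_fun measurableSet_Ioo e).trans ?_
  rw [integral_const_mul, hweak, mul_zero]

/-- One argument covers the ball and the punctured ball, as only integrability of `v` on compact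
subsets of `Ω` is used. The Laplacian is handled by the definition of the weak gradient, with `∂ᵢψ`
as test function. -/
theorem solvesScattering_radial (hn : 1 ≤ n) (hμ : 0 < μ) (H : RadialPotential (n - 1) (potV n μ v))
    {f φ : ℝ → ℝ} (hf : IsWeakSol (n - 1) (potV n μ v) R f φ)
    (hL2 : MemLp (fun x : Sp n => (f ‖x‖ : ℂ)) 2 (volume.restrict (ballR n R)))
    (hG : HasWeakGrad (ballR n R) (fun x : Sp n => (f ‖x‖ : ℂ)) (radGrad φ))
    {Ω : Set (Sp n)} (hΩ : IsOpen Ω) (hΩb : Ω ⊆ ballR n R)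
    (hv : ∀ K ⊆ Ω, IsCompact K → IntegrableOn (fun x : Sp n => v ‖x‖) K)
    {φ₀ : Sp n → ℂ} (hφ₀ : φ₀ = fun x => (f ‖x‖ : ℂ)) : SolvesScattering Ω μ v φ₀ := by
  have hfin : IsFiniteMeasure (volume.restrict (ballR n R)) :=
    ⟨by rw [Measure.restrict_apply_univ]; exact measure_ball_lt_top⟩
  subst hφ₀
  refine ⟨?_, ?_, fun ψ hψ => ?_⟩
  · have h1 : IntegrableOn (fun x : Sp n => (f ‖x‖ : ℂ)) (ballR n R) :=
      hL2.integrable (by norm_num)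
    exact (h1.mono_set hΩb).locallyIntegrableOn
  · rw [locallyIntegrableOn_iff hΩ.isLocallyClosed]
    intro K hK hKc
    have h1 := (integrableOn_pot_mul hn hμ hf.fe (hK.trans hΩb)
      (hv K hK hKc)).ofReal (𝕜 := ℂ)
    refine h1.congr (Eventually.of_forall fun x => ?_)
    simp
  · have hψb : IsTestFun (ballR n R) ψ := ⟨hψ.1, hψ.2.1, hψ.2.2.trans hΩb⟩
    have hmain := weak_equation_ball hn hμ hf (H.meas_Ioo R) hG.1 hψb
      (hv _ hψ.2.2 hψ.2.1)
    have e1 : ∀ i, ∫ x in Ω, partialDeriv i (partialDeriv i ψ) x • (f ‖x‖ : ℂ) =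
        -((∫ x in ballR n R, partialDeriv i ψ x * (φ ‖x‖ * (x i / ‖x‖)) : ℝ) : ℂ) := by
      intro i
      rw [((hψ.partialDeriv i).partialDeriv i).setIntegral_eq,
        ← ((hψb.partialDeriv i).partialDeriv i).setIntegral_eq,
        hG.2 _ (hψb.partialDeriv i) i, ← integral_complex_ofReal]
      congr 1
      refine integral_congr_ae (Eventually.of_forall fun x => ?_)
      simp [radGrad]
    have e2 : ∫ x in Ω, Laplacian.laplacian ψ x • (f ‖x‖ : ℂ) =
        -((∑ i, ∫ x in ballR n R, partialDeriv i ψ x * (φ ‖x‖ * (x i / ‖x‖)) : ℝ) : ℂ) := by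
      simp_rw [laplacian_eq_sum hψ.1, Finset.sum_smul]
      rw [integral_finsetSum _ fun i _ => integrable_smul_of_memLp
        (((hψ.partialDeriv i).partialDeriv i).memLp 2 _)
        (hL2.mono_measure (Measure.restrict_mono hΩb le_rfl))]
      simp_rw [e1]
      push_cast
      rw [Finset.sum_neg_distrib]
    have e3 : ∫ x in Ω, ψ x • (v ‖x‖ • (f ‖x‖ : ℂ)) =
        ((∫ x in ballR n R, ψ x * (v ‖x‖ * f ‖x‖) : ℝ) : ℂ) := by
      rw [hψ.setIntegral_eq, ← hψb.setIntegral_eq, ← integral_complex_ofReal]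
      refine integral_congr_ae (Eventually.of_forall fun x => ?_)
      simp
    rw [e2, e3]
    have := congrArg (fun x : ℝ => (x : ℂ)) hmain
    push_cast at this ⊢
    linear_combination this

theorem exists_scatteringLength_minimizer (hn : 1 ≤ n) (hμ : 0 < μ) {R₀ : ℝ} (hR₀ : 0 ≤ R₀)
    (hrange : ∀ r : ℝ, R₀ < r → v r = 0)
    (hloc : LocallyIntegrableOn (fun x : Sp n => v ‖x‖) {x | x ≠ 0} volume)
    (hneg : NegPartCondition n v) (hbound : NoNegativeBoundStates n μ v) :
    ∃ a : EReal, ScatteringRange n R₀ a ∧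
      ∀ R : ℝ, R₀ < R →
        ∃ (φ₀ : Sp n → ℂ) (f₀ : ℝ → ℝ),
          IsEnergyMinimizer R μ v φ₀ ∧
          (∀ φ : Sp n → ℂ, IsEnergyMinimizer R μ v φ →
            φ =ᵐ[volume.restrict (ballR n R)] φ₀) ∧
          (∀ x ∈ puncturedBall n R, φ₀ x = (f₀ ‖x‖ : ℂ)) ∧
          (∀ r ∈ Ioc 0 R, 0 ≤ f₀ r) ∧
          SolvesScattering (puncturedBall n R) μ v φ₀ ∧
          (LocallyIntegrable (fun x : Sp n => v ‖x‖) volume →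
            SolvesScattering (ballR n R) μ v φ₀) ∧
          f₀ R = 1 ∧
          (∀ r ∈ Ioo R₀ R, f₀ r = asympProfile n a R r) ∧
          energy (ballR n R) μ v φ₀ = ((minEnergy n μ a R : ℝ) : EReal) := by
  have H := radialPotential_potV hn hμ hloc hneg hbound
  have hV0 : ∀ r, R₀ < r → potV n μ v r = 0 := fun r hr => by simp [potV, hrange r hr]
  obtain ⟨a, ha, h⟩ := exists_scatteringLength hn H hR₀ hV0
  refine ⟨a, ha, fun R hR => ?_⟩
  obtain ⟨f, φ, hf, hprof, hE⟩ := h R hR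
  obtain ⟨hmin, huniq, hen, hG⟩ := radial_minimizer hn hμ H (hR₀.trans_lt hR) hf
  have hL2 := hmin.1.1.1
  refine ⟨fun x => (f ‖x‖ : ℂ), f, hmin, huniq, fun _ _ => rfl, hf.nonneg H, ?_, fun hli => ?_,
    hf.one, hprof, ?_⟩
  · refine solvesScattering_radial hn hμ H hf hL2 hG ?_ (fun x hx => by simpa using hx.2) ?_ rfl
    · exact (isOpen_lt continuous_const continuous_norm).inter
        (isOpen_lt continuous_norm continuous_const)
    · exact fun K hK hKc => hloc.integrableOn_compact_subset
        (fun x hx => norm_pos_iff.1 (hK hx).1) hKc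
  · exact solvesScattering_radial hn hμ H hf hL2 hG Metric.isOpen_ball subset_rfl
      (fun K _ hKc => hli.integrableOn_isCompact hKc) rfl
  · rw [hen, hE μ]

end Equation

end ScatLen

theorem theoremA1 (n : ℕ) (hn : 1 ≤ n) (μ : ℝ) (hμ : 0 < μ)
    (v : ℝ → ℝ) (R₀ : ℝ) (hR₀ : 0 ≤ R₀)
    (hrange : ∀ r : ℝ, R₀ < r → v r = 0)
    (hloc : LocallyIntegrableOn (fun x : ScatLen.Sp n => v ‖x‖) {x | x ≠ 0} volume)
    (hneg : ScatLen.NegPartCondition n v)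
    (hbound : ScatLen.NoNegativeBoundStates n μ v) :
    ∃ a : EReal, ScatLen.ScatteringRange n R₀ a ∧
      ∀ R : ℝ, R₀ < R →
        ∃ (φ₀ : ScatLen.Sp n → ℂ) (f₀ : ℝ → ℝ),
          ScatLen.IsEnergyMinimizer R μ v φ₀ ∧
          (∀ φ : ScatLen.Sp n → ℂ, ScatLen.IsEnergyMinimizer R μ v φ →
            φ =ᵐ[volume.restrict (ScatLen.ballR n R)] φ₀) ∧
          (∀ x ∈ ScatLen.puncturedBall n R, φ₀ x = (f₀ ‖x‖ : ℂ)) ∧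
          (∀ r ∈ Ioc 0 R, 0 ≤ f₀ r) ∧
          ScatLen.SolvesScattering (ScatLen.puncturedBall n R) μ v φ₀ ∧
          (LocallyIntegrable (fun x : ScatLen.Sp n => v ‖x‖) volume →
            ScatLen.SolvesScattering (ScatLen.ballR n R) μ v φ₀) ∧
          f₀ R = 1 ∧
          (∀ r ∈ Ioo R₀ R, f₀ r = ScatLen.asympProfile n a R r) ∧
          ScatLen.energy (ScatLen.ballR n R) μ v φ₀ =
            ((ScatLen.minEnergy n μ a R : ℝ) : EReal) := by
  exact ScatLen.exists_scatteringLength_minimizer hn hμ hR₀ hrange hloc hneg hbound
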